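/- **Setting.** Let $F:\mathbb R^n\to\mathbb R^n$, let $\varphi_1,\dots,\varphi_m:\mathbb R^n\to\mathbb R$ be convex and $C^1$, let $C\in\mathbb R^{p\times n}$ have rank $p$ and let $d\in\mathbb R^p$. Put $\mathcal C_= =\{x: Cx=d\}$, $\mathcal C_<=\{x:\varphi_i(x)<0\ \forall i\}$, $\mathcal C=\{x:\varphi_i(x)\le 0\ \forall i,\ Cx=d\}$, and assume that $\mathcal C$ is compact and $\mathcal C_<\cap\mathcal C_=\neq\emptyset$. For $r,s>0$ let $\hat{\mathcal C}_r=\{x: Cx=d,\ \varphi_i(x)\le r\ \forall i\}$ and $\tilde{\mathcal C}_s=\{x:\|Cx-d\|\le s,\ \varphi_i(x)\le 0\ \forall i\}$. Let $x^\star\in\mathcal C$ satisfy $\langle F(x^\star),x-x^\star\rangle\ge0$ for all $x\in\mathcal C$, and let $\mathcal G(x',\mathcal C)=\max_{x\in\mathcal C}\langle F(x'),x'-x\rangle$ and $B(x)=-\sum_{i=1}^m\log(-\varphi_i(x))$ for $x\in\mathcal C_<$. **Algorithm (ACVI).** Inputs $\mu_{-1},\beta>0$, $\delta\in(0,1)$,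 $T,K\in\mathbb N$, $y_0^{(0)},\lambda_0^{(0)}\in\mathbb R^n$. Let $P_c=I-C^\top(CC^\top)^{-1}C$ and $d_c=C^\top(CC^\top)^{-1}d$. For $t=0,\dots,T-1$ set $\mu_t=\delta\mu_{t-1}$, so $\mu_t=\mu_{-1}\delta^{t+1}$, and for $k=0,\dots,K-1$ let $x_{k+1}^{(t)}$ solve $x+\frac1\beta P_cF(x)-P_cy_k^{(t)}+\frac1\beta P_c\lambda_k^{(t)}-d_c=0$, let $y_{k+1}^{(t)}$ minimise $\mu_tB(y)+\frac\beta2\|y-x_{k+1}^{(t)}-\frac1\beta\lambda_k^{(t)}\|^2$ over $\mathcal C_<$, and let $\lambda_{k+1}^{(t)}=\lambda_k^{(t)}+\beta(x_{k+1}^{(t)}-y_{k+1}^{(t)})$; then $(y_0^{(t+1)},\lambda_0^{(t+1)})=(y_K^{(t)},\lambda_K^{(t)})$. Let $\hat x_K^{(t)}=\frac1K\sum_{k=1}^Kx_k^{(t)}$. **Central path.** For $\mu>0$ let $x^\mu$ be a point for which there are $c\in\mathbb R^m$, $\nu\in\mathbb R^p$ with $F(x^\mu)+\sum_ic_i\nabla\varphi_i(x^\mu)+C^\top\nu=0$,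 $c_i\varphi_i(x^\mu)+\mu=0$, $Cx^\mu=d$, $\varphi_i(x^\mu)<0$ and $c_i>0$ for all $i$. Let $y^\mu=x^\mu$, and let $\lambda^\mu$ be such that $(x^\mu,y^\mu,\lambda^\mu)$ is a KKT point of $\min f(x)+g(y)$ subject to $x=y$, where $f(x)=\langle F(x^\mu),x\rangle+\mathbb 1[Cx=d]$ (the indicator being $0$ or $+\infty$) and $g=\mu B$ on $\mathcal C_<$, $+\infty$ elsewhere; that is, $-\lambda^\mu\in\partial f(x^\mu)$ and $\lambda^\mu\in\partial g(y^\mu)$. **Assumptions.** (i) $F$ is monotone on $\mathcal C_=$ and $L$-Lipschitz on $\mathcal C_=$ with $L>0$; (ii) $F$ is strictly monotone on $\mathcal C$ or some $\varphi_i$ is strictly convex; (iii) $\inf_{x\in S\setminus\{x^\star\}}\langle F(x),\frac{x-x^\star}{\|x-x^\star\|}\rangle=a>0$, where $S=\hat{\mathcal C}_r$ for some $r>0$ or $S=\tilde{\mathcal C}_s$ for some $s>0$. **Notation for the bounds.** $M=\sup_{x\in\mathcal C}\|F(x)\|$, $D=\max_{x\in\mathcal C}\|x^\star-x\|$, $M_0=DL+M$;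 at outer step $t$, $$\Delta^{\mu_t}=\tfrac1\beta\|\lambda_0^{(t)}-\lambda^{\mu_t}\|^2+\beta\|y_0^{(t)}-y^{\mu_t}\|^2,\qquad B^\star=\inf\{B(x):x\in\mathcal C_<,\ \|x-x^{\mu_t}\|\le 3\sqrt{\Delta^{\mu_t}/\beta}\},$$ $$M_3=m+\tfrac{Lm}{a}\Big(\tfrac ma\mu_{-1}+\tfrac{2\sqrt{\beta\Delta^{\mu_t}}}{\beta(K+1)}+\sqrt{\tfrac{\Delta^{\mu_t}}\beta}\Big)+B(y^{\mu_t})-B^\star .$$ **Theorem.** For every $\mu>0$ the pair $(x^\mu,\lambda^\mu)$ exists and is unique. Moreover, for fixed $F$, constraints, $S$, $\beta$, $\delta$, $\mu_{-1}$, $y_0^{(0)}$, $\lambda_0^{(0)}$: 1. For every $T$ there is $K_0$ such that for all $K>K_0$ and all $t\in\{0,\dots,T-1\}$ the iterates of ACVI satisfy $\|x_K^{(t)}-x^\star\|\le R$ and $\mathcal G(x_K^{(t)},\mathcal C)\le M_0R$ with $$R=\frac1a\Big(\frac{\Delta^{\mu_t}}K+\frac{2\Delta^{\mu_t}}{\sqrt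 K}+\|\lambda^{\mu_t}\|\sqrt{\frac{\Delta^{\mu_t}}{\beta K}}\Big)+\Big(\frac{mM}{a^2}+\frac{B(y^{\mu_t})-B^\star}a\Big)\mu_{-1}\delta^{t+1}.$$ 2. If in addition $\inf_{x\in S'\setminus\{x^\star\}}\langle F(x^\star),\frac{x-x^\star}{\|x-x^\star\|}\rangle=b>0$, where $S'=\hat{\mathcal C}_{r'}$ or $S'=\tilde{\mathcal C}_{s'}$ for some $r'>0$ or $s'>0$, then for every $T$ there is $K_0$ such that for all $K>K_0$ and all $t\in\{0,\dots,T-1\}$ one has $\|\hat x_K^{(t)}-x^\star\|\le\hat R$ and $\mathcal G(\hat x_K^{(t)},\mathcal C)\le M_0\hat R$ with $$\hat R=\frac1b\Big(\frac{\Delta^{\mu_t}}{2K}+\frac{2\sqrt{\beta\Delta^{\mu_t}}\,\|\lambda^{\mu_t}\|}{\beta K}\Big)+\frac{M_3}b\mu_{-1}\delta^{t+1}.$$ 3. There are constants $c,Q$ and $K_0$, independent of $K$, $T$ and $t$, such that for all $K>K_0$, all $T$ and all $t<T$ with $t\ge c\ln K$: $\|x_K^{(t)}-x^\star\|\le Q/\sqrt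 K$ and $\mathcal G(x_K^{(t)},\mathcal C)\le Q/\sqrt K$. Under the additional assumption of part 2, there are likewise $c,Q,K_0$ such that for all $K>K_0$, all $T$ and all $t<T$ with $t\ge c\ln K$: $\|\hat x_K^{(t)}-x^\star\|\le Q/K$ and $\mathcal G(\hat x_K^{(t)},\mathcal C)\le Q/K$. -/

import Mathlib

open scoped InnerProductSpace

noncomputable section

/-- The data of a constrained variational inequality on `ℝⁿ`: the operator `F`, the inequality
constraints `φ i x ≤ 0` for `i = 1, …, m`, and the equality constraints `A x = d` with a
`p × n` matrix `A`. -/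
structure CVI (n m p : ℕ) where
  F : EuclideanSpace ℝ (Fin n) → EuclideanSpace ℝ (Fin n)
  φ : Fin m → EuclideanSpace ℝ (Fin n) → ℝ
  A : Matrix (Fin p) (Fin n) ℝ
  d : EuclideanSpace ℝ (Fin p)

namespace CVI

variable {n m p : ℕ} (P : CVI n m p)

/-- `{x | A x = d}`. -/
def eqSet : Set (EuclideanSpace ℝ (Fin n)) :=
  {x | Matrix.toEuclideanLin P.A x = P.d}

/-- `{x | φ x < 0}`. -/
def strictSet : Set (EuclideanSpace ℝ (Fin n)) :=
  {x | ∀ i, P.φ i x < 0}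

/-- The constraint set `{x | φ x ≤ 0, A x = d}`. -/
def feasible : Set (EuclideanSpace ℝ (Fin n)) :=
  {x | (∀ i, P.φ i x ≤ 0) ∧ Matrix.toEuclideanLin P.A x = P.d}

/-- The enlarged set `{x | φ x ≤ r e, A x = d}`. -/
def relaxIneq (r : ℝ) : Set (EuclideanSpace ℝ (Fin n)) :=
  {x | (∀ i, P.φ i x ≤ r) ∧ Matrix.toEuclideanLin P.A x = P.d}

/-- The enlarged set `{x | φ x ≤ 0, ‖A x - d‖ ≤ s}`. -/
def relaxEq (s : ℝ) : Set (EuclideanSpace ℝ (Fin n)) :=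
  {x | (∀ i, P.φ i x ≤ 0) ∧ ‖Matrix.toEuclideanLin P.A x - P.d‖ ≤ s}

/-- `S` is one of the two kinds of enlargements of the constraint set. -/
def IsEnlargement (S : Set (EuclideanSpace ℝ (Fin n))) : Prop :=
  (∃ r : ℝ, 0 < r ∧ S = P.relaxIneq r) ∨ (∃ s : ℝ, 0 < s ∧ S = P.relaxEq s)

/-- `x` solves the variational inequality. -/
def IsSolution (x : EuclideanSpace ℝ (Fin n)) : Prop :=
  x ∈ P.feasible ∧ ∀ z ∈ P.feasible, 0 ≤ ⟪P.F x, z - x⟫_ℝ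

/-- The standing assumptions on the constraints: the `φ i` are convex and `C¹`, `A` has full row
rank, the relative interior `{φ < 0, A x = d}` is nonempty and the constraint set is compact. -/
structure Regular : Prop where
  contDiff : ∀ i, ContDiff ℝ 1 (P.φ i)
  convex : ∀ i, ConvexOn ℝ Set.univ (P.φ i)
  rank_eq : P.A.rank = p
  slater : (P.strictSet ∩ P.eqSet).Nonempty
  compact : IsCompact P.feasible

/-- Monotonicity of `F` on a set. -/
def MonotoneOp (S : Set (EuclideanSpace ℝ (Fin n))) : Prop :=
  ∀ x ∈ S, ∀ z ∈ S, 0 ≤ ⟪x - z, P.F x - P.F z⟫_ℝ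

/-- Strict monotonicity of `F` on a set. -/
def StrictMonotoneOp (S : Set (EuclideanSpace ℝ (Fin n))) : Prop :=
  ∀ x ∈ S, ∀ z ∈ S, x ≠ z → 0 < ⟪x - z, P.F x - P.F z⟫_ℝ

/-- The gap function `max_{z ∈ S} ⟨F x, x - z⟩`. -/
def gap (S : Set (EuclideanSpace ℝ (Fin n))) (x : EuclideanSpace ℝ (Fin n)) : ℝ :=
  sSup ((fun z => ⟪P.F x, x - z⟫_ℝ) '' S)

/-- The logarithmic barrier (to be used on `strictSet` only; it is `+∞` elsewhere). -/
def barrier (x : EuclideanSpace ℝ (Fin n)) : ℝ :=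
  -∑ i, Real.log (-P.φ i x)

/-! ### The central path -/

/-- `x` solves the barrier KKT system with parameter `μ`. -/
def IsCentralPoint (μ : ℝ) (x : EuclideanSpace ℝ (Fin n)) : Prop :=
  ∃ (c : Fin m → ℝ) (ν : EuclideanSpace ℝ (Fin p)),
    P.F x + ∑ i, c i • gradient (P.φ i) x + Matrix.toEuclideanLin P.A.transpose ν = 0 ∧
    (∀ i, c i * P.φ i x + μ = 0) ∧
    Matrix.toEuclideanLin P.A x = P.d ∧
    (∀ i, P.φ i x < 0) ∧ (∀ i, 0 < c i)

/-- With `f z = ⟨F x, z⟩ + 𝟙(A z = d)` and `g z = μ * barrier z`, the triple `(x, x, l)` is a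
KKT point of `min f u + g v` subject to `u = v`, that is `0 ∈ ∂f x + l` and `0 ∈ ∂g x - l`. -/
def IsSplitMultiplier (μ : ℝ) (x l : EuclideanSpace ℝ (Fin n)) : Prop :=
  x ∈ P.eqSet ∧ x ∈ P.strictSet ∧
  (∀ z ∈ P.eqSet, ⟪P.F x, x⟫_ℝ + ⟪-l, z - x⟫_ℝ ≤ ⟪P.F x, z⟫_ℝ) ∧
  (∀ z ∈ P.strictSet, μ * P.barrier x + ⟪l, z - x⟫_ℝ ≤ μ * P.barrier z)

/-- The point `x^μ` of the central path together with its multiplier `λ^μ`. -/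
def IsCentralPair (μ : ℝ) (x l : EuclideanSpace ℝ (Fin n)) : Prop :=
  P.IsCentralPoint μ x ∧ P.IsSplitMultiplier μ x l

/-! ### The algorithm -/

/-- `P_c = I - Aᵀ (A Aᵀ)⁻¹ A`. -/
def Pc : EuclideanSpace ℝ (Fin n) →ₗ[ℝ] EuclideanSpace ℝ (Fin n) :=
  Matrix.toEuclideanLin (1 - P.A.transpose * (P.A * P.A.transpose)⁻¹ * P.A)

/-- `d_c = Aᵀ (A Aᵀ)⁻¹ d`. -/
def dc : EuclideanSpace ℝ (Fin n) :=
  Matrix.toEuclideanLin (P.A.transpose * (P.A * P.A.transpose)⁻¹) P.d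

/-- The barrier parameter `μ_t = δ μ_{t-1}` of outer step `t`, where `μ₀` stands for `μ_{-1}`. -/
def muSeq (μ₀ δ : ℝ) (t : ℕ) : ℝ := μ₀ * δ ^ (t + 1)

/-- The objective of the `y`-step, to be minimised over `strictSet`. -/
def yObjective (μ β : ℝ) (x l y : EuclideanSpace ℝ (Fin n)) : ℝ :=
  μ * P.barrier y + β / 2 * ‖y - x - (1 / β) • l‖ ^ 2

/-- The sequences `x t k`, `y t k`, `l t k` (outer index `t`, inner index `k`) are produced by ACVI
with `T` outer and `K` inner iterations from the initial point `(y₀, l₀)`. -/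
structure IsRun (β δ μ₀ : ℝ) (T K : ℕ) (y₀ l₀ : EuclideanSpace ℝ (Fin n))
    (x y l : ℕ → ℕ → EuclideanSpace ℝ (Fin n)) : Prop where
  init_y : y 0 0 = y₀
  init_l : l 0 0 = l₀
  step_x : ∀ t < T, ∀ k < K,
    x t (k + 1) + (1 / β) • P.Pc (P.F (x t (k + 1))) - P.Pc (y t k) + (1 / β) • P.Pc (l t k)
      - P.dc = 0
  step_y : ∀ t < T, ∀ k < K,
    y t (k + 1) ∈ P.strictSet ∧
      IsMinOn (P.yObjective (muSeq μ₀ δ t) β (x t (k + 1)) (l t k)) P.strictSet (y t (k + 1))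
  step_l : ∀ t < T, ∀ k < K, l t (k + 1) = l t k + β • (x t (k + 1) - y t (k + 1))
  warm_y : ∀ t, t + 1 < T → y (t + 1) 0 = y t K
  warm_l : ∀ t, t + 1 < T → l (t + 1) 0 = l t K

/-- The average `(1/K) ∑_{k=1}^K x k`. -/
def average (K : ℕ) (x : ℕ → EuclideanSpace ℝ (Fin n)) : EuclideanSpace ℝ (Fin n) :=
  (1 / (K : ℝ)) • ∑ k ∈ Finset.Icc 1 K, x k

/-! ### The constants of the bounds -/

/-- `Δ^μ = (1/β) ‖λ_0 - λ^μ‖² + β ‖y_0 - y^μ‖²`, with `y^μ = x^μ`. -/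
def Delta (β : ℝ) (y₀ l₀ xμ lμ : EuclideanSpace ℝ (Fin n)) : ℝ :=
  1 / β * ‖l₀ - lμ‖ ^ 2 + β * ‖y₀ - xμ‖ ^ 2

/-- `B^⋆`: the infimum of the barrier over the ball of radius `3 √(Δ/β)` around `x^μ`. -/
def barrierInf (β Δ : ℝ) (xμ : EuclideanSpace ℝ (Fin n)) : ℝ :=
  sInf (P.barrier '' {z | z ∈ P.strictSet ∧ ‖z - xμ‖ ≤ 3 * √(Δ / β)})

/-- `M = sup_{x ∈ 𝒞} ‖F x‖`. -/
def opBound : ℝ := sSup ((fun z => ‖P.F z‖) '' P.feasible)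

/-- `D = max_{z ∈ 𝒞} ‖x^⋆ - z‖`. -/
def radius (xs : EuclideanSpace ℝ (Fin n)) : ℝ := sSup ((fun z => ‖xs - z‖) '' P.feasible)

/-- `M₀ = D L + M`. -/
def M₀ (L : ℝ) (xs : EuclideanSpace ℝ (Fin n)) : ℝ := P.radius xs * L + P.opBound

/-- `M₃ = m + (L m / a) ((m/a) μ_{-1} + 2 √(β Δ) / (β (K+1)) + √(Δ/β)) + B(y^μ) - B^⋆`. -/
def M₃ (L a β μ₀ Δ : ℝ) (K : ℕ) (xμ : EuclideanSpace ℝ (Fin n)) : ℝ :=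
  m + L * m / a * (m / a * μ₀ + 2 * √(β * Δ) / (β * (K + 1)) + √(Δ / β))
    + P.barrier xμ - P.barrierInf β Δ xμ

/-- The bound for the last iterate. -/
def lastBound (a β δ μ₀ Δ : ℝ) (t K : ℕ) (xμ lμ : EuclideanSpace ℝ (Fin n)) : ℝ :=
  1 / a * (Δ / K + 2 * Δ / √K + ‖lμ‖ * √(Δ / (β * K)))
    + (m * P.opBound / a ^ 2 + (P.barrier xμ - P.barrierInf β Δ xμ) / a) * (μ₀ * δ ^ (t + 1))

/-- The bound for the average iterate. -/
def avgBound (L a b β δ μ₀ Δ : ℝ) (t K : ℕ) (xμ lμ : EuclideanSpace ℝ (Fin n)) : ℝ :=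
  1 / b * (Δ / (2 * K) + 2 * √(β * Δ) * ‖lμ‖ / (β * K))
    + P.M₃ L a β μ₀ Δ K xμ / b * (μ₀ * δ ^ (t + 1))

end CVI

end

/-!
Write `B` for the logarithmic barrier, `xᵘ` for the point of the central path with parameter `μ`,
and `λᵘ` for its multiplier. The barrier KKT system says that `xᵘ` is strictly feasible and
`F xᵘ + μ ∇B(xᵘ)` is orthogonal to the affine constraints (`IsStationary`), and the split problem
forces `λᵘ = μ ∇B(xᵘ)` (`isCentralPair_iff`). Such points are unique because `F` and `∇B` are
monotone, one of them strictly. They exist because forward-backward splitting is a contraction for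
the strongly monotone operator `F + ε`, and the barrier keeps its solutions in a compact subset of
the strictly feasible set as `ε → 0` (`exists_isStationary`).

The inner loop satisfies an energy identity against any pair `(z, l')` with `z` on the affine
constraints (`IsInnerRun.step_identity`). Against `(xᵘ, λᵘ)` all the monotonicity terms have a sign,
so `Delta` is nonincreasing, the squared increments are summable, and, being antitone, they are
`O(1/k)` (`IsInnerRun.residual_le`). Against a Slater point and the multiplier `0` it shows that a
long inner loop visits a bounded region that does not depend on where the loop started. Since
`Delta` is then nonincreasing, and the central path is bounded, the iterates of all the outer steps
stay in one bounded set (`IsWellPosed.exists_uniform_bound`).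

*Rates.* By the energy identity, the last iterate and the averaged iterate satisfy the variational
inequality at the solution `xs` up to `m μ + O(1/√K)` and `m μ + O(1/K)`, and they are within
`O(1/√K)` and `O(1/K)` of `{φ ≤ 0}`. A move towards a Slater point makes them feasible at a
proportional cost (`exists_feasible_near`), so that the angle condition on the feasible set bounds
their distance to `xs`. After `log K / log (1/δ)` outer steps also `m μ = O(1/K)`. This gives
`IsWellPosed.last_rate` and `IsWellPosed.average_rate`.

*Explicit bounds.* At a fixed outer step `t` with parameter `μ = μ_t`, compactness turns the decay
of the increments into convergence of the inner iterates to `(xᵘ, λᵘ)`, uniformly over bounded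
starting points (`IsWellPosed.exists_inner_convergence`). It remains to see that the explicit bounds
hold at `xᵘ` with room to spare. The angle condition and `⟪F xᵘ, xᵘ - xs⟫ ≤ m μ` give
`‖xᵘ - xs‖ ≤ m μ / a ≤ m M μ / a²`, while the bound for the last iterate also contains the term
`(B(xᵘ) - B⋆) μ / a`. This term is bounded below by a positive constant: the barrier gradient does
not vanish at `xᵘ` (`IsStationary.barrierGrad_ne_zero`), and the radius in the definition of `B⋆`
does not shrink as `K` grows, because the warm start approaches the previous point of the central
path, which differs from the present one in its position or its multiplier
(`IsWellPosed.exists_le_Delta`). When that radius is zero the run starts at `(xᵘ, λᵘ)` and stays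
there. The bound for the averaged iterate exceeds `‖xᵘ - xs‖ ≤ m μ / b` by at least
`(L m² μ₀ / a²) μ / b`. If the affine constraints admit only the point `xs`, all iterates equal
`xs`, and the bounds hold trivially.
-/

namespace CVI

open Filter Topology Set

/-! ### Convexity inequalities for the constraints and the barrier -/

section

variable {n m p : ℕ} {P : CVI n m p} {x y z : EuclideanSpace ℝ (Fin n)}

/-- The gradient of the logarithmic barrier, `∑ᵢ (-φᵢ(y))⁻¹ ∇φᵢ(y)`. -/
noncomputable def barrierGrad (P : CVI n m p) (y : EuclideanSpace ℝ (Fin n)) :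
    EuclideanSpace ℝ (Fin n) :=
  ∑ i, (-(P.φ i y))⁻¹ • gradient (P.φ i) y

lemma Regular.hasGradientAt (hP : P.Regular) (i : Fin m) (x : EuclideanSpace ℝ (Fin n)) :
    HasGradientAt (P.φ i) (gradient (P.φ i) x) x :=
  (((hP.contDiff i).differentiable one_ne_zero) x).hasGradientAt

lemma Regular.continuous_φ (hP : P.Regular) (i : Fin m) : Continuous (P.φ i) :=
  (hP.contDiff i).continuous

lemma Regular.continuous_gradient (hP : P.Regular) (i : Fin m) :
    Continuous (gradient (P.φ i)) :=
  (InnerProductSpace.toDual ℝ (EuclideanSpace ℝ (Fin n))).symm.continuous.comp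
    ((hP.contDiff i).continuous_fderiv one_ne_zero)

lemma hasDerivAt_line (x v : EuclideanSpace ℝ (Fin n)) (t : ℝ) :
    HasDerivAt (fun s : ℝ => x + s • v) v t := by
  simpa using ((hasDerivAt_id t).smul_const v).const_add x

lemma hasDerivAt_comp_line {f : EuclideanSpace ℝ (Fin n) → ℝ}
    {g x : EuclideanSpace ℝ (Fin n)} (h : HasGradientAt f g x) (v : EuclideanSpace ℝ (Fin n)) :
    HasDerivAt (fun s : ℝ => f (x + s • v)) ⟪g, v⟫_ℝ 0 := by
  have h1 : HasFDerivAt f (InnerProductSpace.toDual ℝ _ g) (x + (0 : ℝ) • v) := by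
    simpa using h.hasFDerivAt
  have h2 := h1.comp_hasDerivAt (0 : ℝ) (hasDerivAt_line x v 0)
  rwa [InnerProductSpace.toDual_apply_apply] at h2

lemma Regular.gradient_le (hP : P.Regular) (i : Fin m) (x z : EuclideanSpace ℝ (Fin n)) :
    P.φ i x + ⟪gradient (P.φ i) x, z - x⟫_ℝ ≤ P.φ i z := by
  have hd := hasDerivAt_comp_line (hP.hasGradientAt i x) (z - x)
  have hc : ConvexOn ℝ univ (fun s : ℝ => P.φ i (x + s • (z - x))) := by
    have := (hP.convex i).comp_affineMap (AffineMap.lineMap x z : ℝ →ᵃ[ℝ] _)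
    refine (this.congr fun s _ => ?_)
    simp [AffineMap.lineMap_apply, add_comm]
  have := hc.le_slope_of_hasDerivAt (mem_univ 0) (mem_univ 1) zero_lt_one hd
  simp only [slope_def_field, one_smul, zero_smul, add_zero, add_sub_cancel, sub_zero,
    div_one] at this
  linarith

/-- The strict form of the gradient inequality, for a strictly convex constraint. -/
lemma Regular.gradient_lt (hP : P.Regular) {i : Fin m} (hi : StrictConvexOn ℝ univ (P.φ i))
    (hxz : x ≠ z) : P.φ i x + ⟪gradient (P.φ i) x, z - x⟫_ℝ < P.φ i z := by
  have h1 := hi.2 (mem_univ x) (mem_univ z) hxz (show (0 : ℝ) < 1 / 2 by norm_num)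
    (show (0 : ℝ) < 1 / 2 by norm_num) (by norm_num)
  have h2 := hP.gradient_le i x ((1 / 2 : ℝ) • x + (1 / 2 : ℝ) • z)
  have h3 : (1 / 2 : ℝ) • x + (1 / 2 : ℝ) • z - x = (1 / 2 : ℝ) • (z - x) := by module
  rw [h3, inner_smul_right] at h2
  simp only [smul_eq_mul] at h1
  linarith

lemma isOpen_strictSet (hP : P.Regular) : IsOpen P.strictSet := by
  have : P.strictSet = ⋂ i, {x | P.φ i x < 0} := by ext; simp [strictSet]
  rw [this]
  exact isOpen_iInter_of_finite fun i => isOpen_lt (hP.continuous_φ i) continuous_const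

lemma hasGradientAt_barrier (hP : P.Regular) (hx : x ∈ P.strictSet) :
    HasGradientAt P.barrier (P.barrierGrad x) x := by
  have h : ∀ i ∈ Finset.univ, HasFDerivAt (fun z => Real.log (-P.φ i z))
      ((-(P.φ i x))⁻¹ • -(InnerProductSpace.toDual ℝ _ (gradient (P.φ i) x))) x := by
    intro i _
    have h1 := (hP.hasGradientAt i x).hasFDerivAt.neg
    exact h1.log (by have := hx i; simp; linarith)
  have h2 := (HasFDerivAt.fun_sum h).neg
  rw [hasGradientAt_iff_hasFDerivAt]
  refine (h2.congr_fderiv ?_)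
  simp [barrierGrad, map_sum, ← Finset.sum_neg_distrib]

lemma continuousOn_barrierGrad (hP : P.Regular) : ContinuousOn P.barrierGrad P.strictSet := by
  refine continuousOn_finsetSum _ fun i _ => ?_
  refine ContinuousOn.smul (f := fun y => (-P.φ i y)⁻¹) ?_ (hP.continuous_gradient i).continuousOn
  exact ((hP.continuous_φ i).neg.continuousOn).inv₀ fun x hx => by
    have := hx i; simp; linarith

lemma inner_barrierGrad (y v : EuclideanSpace ℝ (Fin n)) :
    ⟪P.barrierGrad y, v⟫_ℝ = ∑ i, (-(P.φ i y))⁻¹ * ⟪gradient (P.φ i) y, v⟫_ℝ := by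
  simp [barrierGrad, sum_inner, inner_smul_left]

/-- The gradient inequality of the convex function `barrier`, which follows constraint by constraint
from `log s ≤ s - 1`. -/
lemma barrier_le (hP : P.Regular) (hx : x ∈ P.strictSet) (hz : z ∈ P.strictSet) :
    P.barrier x + ⟪P.barrierGrad x, z - x⟫_ℝ ≤ P.barrier z := by
  rw [inner_barrierGrad, barrier, barrier, ← Finset.sum_neg_distrib, ← Finset.sum_neg_distrib,
    ← Finset.sum_add_distrib]
  refine Finset.sum_le_sum fun i _ => ?_
  have hq : 0 < -P.φ i x := by linarith [hx i]
  have hp : 0 < -P.φ i z := by linarith [hz i]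
  have h1 := hP.gradient_le i x z
  have h2 : (-(P.φ i x))⁻¹ * ⟪gradient (P.φ i) x, z - x⟫_ℝ
      ≤ (-(P.φ i x))⁻¹ * (P.φ i z - P.φ i x) := by
    gcongr; linarith
  have h3 : (-(P.φ i x))⁻¹ * (P.φ i z - P.φ i x) = 1 - (-P.φ i z) / (-P.φ i x) := by
    have := hq.ne'
    rw [neg_ne_zero] at this
    field_simp; ring
  have h4 := Real.log_le_sub_one_of_pos (div_pos hp hq)
  rw [Real.log_div hp.ne' hq.ne'] at h4
  linarith

/-- The directional derivative of the barrier towards a point with `φ ≤ 0` is at most the number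
of constraints. -/
lemma inner_barrierGrad_le (hP : P.Regular) (hy : y ∈ P.strictSet) (hz : ∀ i, P.φ i z ≤ 0) :
    ⟪P.barrierGrad y, z - y⟫_ℝ ≤ m := by
  rw [inner_barrierGrad]
  calc _ ≤ ∑ i : Fin m, (1 : ℝ) := Finset.sum_le_sum fun i _ => ?_
    _ = m := by simp
  have hq : 0 < -P.φ i y := by linarith [hy i]
  have h1 := hP.gradient_le i y z
  rw [inv_mul_le_iff₀ hq]
  linarith [hz i]

/-- A quantitative form of `inner_barrierGrad_le`: a Slater point controls the weights
`(-φᵢ(y))⁻¹` of the barrier gradient. -/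
lemma sum_inv_le (hP : P.Regular) {σ : ℝ} (hy : y ∈ P.strictSet) (hz : ∀ i, P.φ i z ≤ -σ) :
    σ * ∑ i, (-(P.φ i y))⁻¹ ≤ m + ⟪P.barrierGrad y, y - z⟫_ℝ := by
  have : (m : ℝ) = ∑ i : Fin m, (1 : ℝ) := by simp
  rw [inner_barrierGrad, this, ← Finset.sum_add_distrib, Finset.mul_sum]
  refine Finset.sum_le_sum fun i _ => ?_
  have hq : 0 < -P.φ i y := by linarith [hy i]
  have h1 := hP.gradient_le i y z
  rw [← neg_sub z y, inner_neg_right]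
  have h2 : (-(P.φ i y))⁻¹ * (-P.φ i y) = 1 := inv_mul_cancel₀ hq.ne'
  nlinarith [inv_pos.2 hq, hz i, mul_le_mul_of_nonneg_left
    (show ⟪gradient (P.φ i) y, z - y⟫_ℝ ≤ -σ - P.φ i y by linarith [hz i]) (inv_pos.2 hq).le]

lemma inv_neg_sub_nonneg {a b : ℝ} (ha : a < 0) (hb : b < 0) :
    0 ≤ (-b)⁻¹ * (b - a) - (-a)⁻¹ * (b - a) := by
  have h : (-b)⁻¹ * (b - a) - (-a)⁻¹ * (b - a) = (b - a) ^ 2 / (a * b) := by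
    have := ha.ne
    have := hb.ne
    field_simp; ring
  rw [h]
  exact div_nonneg (sq_nonneg _) (mul_pos_of_neg_of_neg ha hb).le

lemma barrierGrad_term_nonneg (hP : P.Regular) (hx : x ∈ P.strictSet) (hy : y ∈ P.strictSet)
    (i : Fin m) : 0 ≤ (-(P.φ i y))⁻¹ * ⟪gradient (P.φ i) y, y - x⟫_ℝ
      - (-(P.φ i x))⁻¹ * ⟪gradient (P.φ i) x, y - x⟫_ℝ := by
  have hp : 0 < -P.φ i y := by linarith [hy i]
  have hq : 0 < -P.φ i x := by linarith [hx i]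
  have h1 := hP.gradient_le i x y
  have h2 := hP.gradient_le i y x
  rw [← neg_sub y x, inner_neg_right] at h2
  have h3 := mul_le_mul_of_nonneg_left (show P.φ i y - P.φ i x ≤ ⟪gradient (P.φ i) y, y - x⟫_ℝ
    by linarith) (inv_pos.2 hp).le
  have h4 := mul_le_mul_of_nonneg_left (show ⟪gradient (P.φ i) x, y - x⟫_ℝ ≤ P.φ i y - P.φ i x
    by linarith) (inv_pos.2 hq).le
  have h5 : 0 ≤ (-(P.φ i y))⁻¹ * (P.φ i y - P.φ i x) - (-(P.φ i x))⁻¹ * (P.φ i y - P.φ i x) :=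
    inv_neg_sub_nonneg (hx i) (hy i)
  linarith

lemma inner_barrierGrad_sub (x y : EuclideanSpace ℝ (Fin n)) :
    ⟪P.barrierGrad y - P.barrierGrad x, y - x⟫_ℝ
      = ∑ i, ((-(P.φ i y))⁻¹ * ⟪gradient (P.φ i) y, y - x⟫_ℝ
      - (-(P.φ i x))⁻¹ * ⟪gradient (P.φ i) x, y - x⟫_ℝ) := by
  rw [inner_sub_left, inner_barrierGrad, inner_barrierGrad, Finset.sum_sub_distrib]

lemma barrierGrad_monotone (hP : P.Regular) (hx : x ∈ P.strictSet) (hy : y ∈ P.strictSet) :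
    0 ≤ ⟪P.barrierGrad y - P.barrierGrad x, y - x⟫_ℝ := by
  rw [inner_barrierGrad_sub]
  exact Finset.sum_nonneg fun i _ => barrierGrad_term_nonneg hP hx hy i

lemma barrierGrad_strictMonotone (hP : P.Regular) (hs : ∃ i, StrictConvexOn ℝ univ (P.φ i))
    (hx : x ∈ P.strictSet) (hy : y ∈ P.strictSet) (hxy : x ≠ y) :
    0 < ⟪P.barrierGrad y - P.barrierGrad x, y - x⟫_ℝ := by
  obtain ⟨i, hi⟩ := hs
  rw [inner_barrierGrad_sub]
  refine Finset.sum_pos' (fun i _ => barrierGrad_term_nonneg hP hx hy i)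
    ⟨i, Finset.mem_univ i, ?_⟩
  have hp : 0 < -P.φ i y := by linarith [hy i]
  have hq : 0 < -P.φ i x := by linarith [hx i]
  have h1 := hP.gradient_lt hi hxy
  have h2 := hP.gradient_le i y x
  rw [← neg_sub y x, inner_neg_right] at h2
  have h3 := mul_le_mul_of_nonneg_left (show P.φ i y - P.φ i x ≤ ⟪gradient (P.φ i) y, y - x⟫_ℝ
    by linarith) (inv_pos.2 hp).le
  have h4 := mul_lt_mul_of_pos_left (show ⟪gradient (P.φ i) x, y - x⟫_ℝ < P.φ i y - P.φ i x
    by linarith) (inv_pos.2 hq)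
  have h5 : 0 ≤ (-(P.φ i y))⁻¹ * (P.φ i y - P.φ i x) - (-(P.φ i x))⁻¹ * (P.φ i y - P.φ i x) :=
    inv_neg_sub_nonneg (hx i) (hy i)
  linarith

/-! ### Bounds on bounded sets -/

lemma exists_log_neg_φ_le (hP : P.Regular) (c : EuclideanSpace ℝ (Fin n)) (ρ : ℝ) :
    ∃ Λ : ℝ, 0 ≤ Λ ∧ ∀ y, ‖y - c‖ ≤ ρ → ∀ i, Real.log (-P.φ i y) ≤ Λ := by
  have h : ∀ i : Fin m, ∃ Λ : ℝ, ∀ y ∈ Metric.closedBall c ρ, |P.φ i y| ≤ Λ := fun i =>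
    (isCompact_closedBall c ρ).exists_bound_of_continuousOn (hP.continuous_φ i).continuousOn
  choose Λ hΛ using h
  refine ⟨∑ i, |Λ i|, by positivity, fun y hy i => ?_⟩
  have h1 := hΛ i y (by simpa [dist_eq_norm] using hy)
  rw [Real.log_neg_eq_log, ← Real.log_abs]
  calc _ ≤ |P.φ i y| := Real.log_le_self (abs_nonneg _)
    _ ≤ |Λ i| := h1.trans (le_abs_self _)
    _ ≤ _ := Finset.single_le_sum (f := fun i => |Λ i|) (fun i _ => abs_nonneg _)
      (Finset.mem_univ i)

lemma exists_le_barrier (hP : P.Regular) (c : EuclideanSpace ℝ (Fin n)) (ρ : ℝ) :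
    ∃ b : ℝ, ∀ y, ‖y - c‖ ≤ ρ → b ≤ P.barrier y := by
  obtain ⟨Λ, -, h⟩ := exists_log_neg_φ_le hP c ρ
  refine ⟨-∑ i : Fin m, Λ, fun y hy => ?_⟩
  rw [barrier]
  exact neg_le_neg (Finset.sum_le_sum fun i _ => h y hy i)

/-- On a bounded set, a bound on the barrier keeps the constraints uniformly away from `0`. -/
lemma exists_φ_le_neg (hP : P.Regular) (c : EuclideanSpace ℝ (Fin n)) (ρ b : ℝ) :
    ∃ τ : ℝ, 0 < τ ∧ ∀ y ∈ P.strictSet, ‖y - c‖ ≤ ρ → P.barrier y ≤ b →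
      ∀ i, P.φ i y ≤ -τ := by
  obtain ⟨Λ, hΛ, h⟩ := exists_log_neg_φ_le hP c ρ
  refine ⟨Real.exp (-(b + m * Λ)), Real.exp_pos _, fun y hy hyc hb i => ?_⟩
  have hp : 0 < -P.φ i y := by linarith [hy i]
  suffices Real.exp (-(b + m * Λ)) ≤ -P.φ i y by linarith
  rw [← Real.le_log_iff_exp_le hp]
  rw [barrier, ← Finset.add_sum_erase _ _ (Finset.mem_univ i)] at hb
  have h1 : ∑ j ∈ Finset.univ.erase i, Real.log (-P.φ j y) ≤ ∑ j ∈ Finset.univ.erase i, Λ :=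
    Finset.sum_le_sum fun j _ => h y hyc j
  have h2 : ∑ j ∈ Finset.univ.erase i, Λ ≤ ∑ j : Fin m, Λ :=
    Finset.sum_le_sum_of_subset_of_nonneg (Finset.erase_subset _ _) fun _ _ _ => hΛ
  simp only [Finset.sum_const, Finset.card_univ, Fintype.card_fin, nsmul_eq_mul] at h1 h2
  linarith

lemma exists_norm_gradient_le (hP : P.Regular) (c : EuclideanSpace ℝ (Fin n)) (ρ : ℝ) :
    ∃ G : ℝ, 0 ≤ G ∧ ∀ y, ‖y - c‖ ≤ ρ → ∀ i, ‖gradient (P.φ i) y‖ ≤ G := by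
  have h : ∀ i : Fin m, ∃ G : ℝ, ∀ y ∈ Metric.closedBall c ρ, ‖gradient (P.φ i) y‖ ≤ G := fun i =>
    (isCompact_closedBall c ρ).exists_bound_of_continuousOn (hP.continuous_gradient i).continuousOn
  choose G hG using h
  refine ⟨∑ i, |G i|, by positivity, fun y hy i => ?_⟩
  exact (hG i y (by simpa [dist_eq_norm] using hy)).trans <| (le_abs_self _).trans <|
    Finset.single_le_sum (f := fun i => |G i|) (fun i _ => abs_nonneg _) (Finset.mem_univ i)

lemma norm_barrierGrad_le {G : ℝ} (hy : y ∈ P.strictSet)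
    (hG : ∀ i, ‖gradient (P.φ i) y‖ ≤ G) :
    ‖P.barrierGrad y‖ ≤ G * ∑ i, (-(P.φ i y))⁻¹ := by
  rw [barrierGrad, Finset.mul_sum]
  refine (norm_sum_le _ _).trans (Finset.sum_le_sum fun i _ => ?_)
  have hp : 0 < -P.φ i y := by linarith [hy i]
  rw [norm_smul, Real.norm_of_nonneg (inv_pos.2 hp).le, mul_comm]
  exact mul_le_mul_of_nonneg_right (hG i) (inv_pos.2 hp).le

/-- The Slater point with a margin that is uniform in the constraints, also when there are none. -/
lemma Regular.exists_slater (hP : P.Regular) :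
    ∃ xS ∈ P.eqSet, ∃ σ : ℝ, 0 < σ ∧ ∀ i, P.φ i xS ≤ -σ := by
  obtain ⟨xS, h1, h2⟩ := hP.slater
  obtain ⟨τ, hτ, h⟩ := exists_φ_le_neg hP xS 0 (P.barrier xS)
  exact ⟨xS, h2, τ, hτ, h xS h1 (by simp) le_rfl⟩

end

/-! ### The projection onto the affine constraints -/

section

variable {n m p : ℕ} {P : CVI n m p} {x y z l : EuclideanSpace ℝ (Fin n)}

lemma toEuclideanLin_mul {a b c : ℕ} (M : Matrix (Fin a) (Fin b) ℝ) (N : Matrix (Fin b) (Fin c) ℝ)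
    (u : EuclideanSpace ℝ (Fin c)) :
    Matrix.toEuclideanLin (M * N) u = Matrix.toEuclideanLin M (Matrix.toEuclideanLin N u) := by
  simp [Matrix.toLpLin_apply, Matrix.mulVec_mulVec]

lemma inner_toEuclideanLin_transpose {a b : ℕ} (M : Matrix (Fin a) (Fin b) ℝ)
    (u : EuclideanSpace ℝ (Fin a)) (v : EuclideanSpace ℝ (Fin b)) :
    ⟪Matrix.toEuclideanLin M.transpose u, v⟫_ℝ = ⟪u, Matrix.toEuclideanLin M v⟫_ℝ := by
  have := Matrix.toEuclideanLin_conjTranspose_eq_adjoint M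
  rw [Matrix.conjTranspose_eq_transpose_of_trivial] at this
  rw [this, LinearMap.adjoint_inner_left]

lemma Regular.isUnit_det (hP : P.Regular) : IsUnit (P.A * P.A.transpose).det := by
  have h1 : (P.A * P.A.transpose).rank = p := by
    rw [Matrix.rank_self_mul_transpose, hP.rank_eq]
  rw [← Matrix.isUnit_iff_isUnit_det, ← Matrix.mulVec_surjective_iff_isUnit]
  have h2 : LinearMap.range (P.A * P.A.transpose).mulVecLin = ⊤ := by
    apply Submodule.eq_top_of_finrank_eq
    rw [← Matrix.rank, h1]
    simp
  exact LinearMap.range_eq_top.1 h2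

lemma A_dc (hP : P.Regular) : Matrix.toEuclideanLin P.A P.dc = P.d := by
  rw [dc, ← toEuclideanLin_mul, ← Matrix.mul_assoc, Matrix.mul_nonsing_inv _ hP.isUnit_det]
  simp

lemma A_Pc (hP : P.Regular) (u : EuclideanSpace ℝ (Fin n)) :
    Matrix.toEuclideanLin P.A (P.Pc u) = 0 := by
  rw [Pc, ← toEuclideanLin_mul, Matrix.mul_sub, ← Matrix.mul_assoc, ← Matrix.mul_assoc,
    Matrix.mul_nonsing_inv _ hP.isUnit_det]
  simp

lemma Pc_apply (u : EuclideanSpace ℝ (Fin n)) :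
    P.Pc u = u - Matrix.toEuclideanLin P.A.transpose
      (Matrix.toEuclideanLin ((P.A * P.A.transpose)⁻¹ * P.A) u) := by
  rw [Pc, ← toEuclideanLin_mul, ← Matrix.mul_assoc]
  simp

lemma inner_Pc {v : EuclideanSpace ℝ (Fin n)} (hv : Matrix.toEuclideanLin P.A v = 0)
    (u : EuclideanSpace ℝ (Fin n)) : ⟪P.Pc u, v⟫_ℝ = ⟪u, v⟫_ℝ := by
  rw [Pc_apply, inner_sub_left, inner_toEuclideanLin_transpose, hv]
  simp

lemma inner_dc {v : EuclideanSpace ℝ (Fin n)} (hv : Matrix.toEuclideanLin P.A v = 0) :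
    ⟪P.dc, v⟫_ℝ = 0 := by
  rw [dc, toEuclideanLin_mul, inner_toEuclideanLin_transpose, hv]
  simp

lemma A_sub (hx : x ∈ P.eqSet) (hz : z ∈ P.eqSet) : Matrix.toEuclideanLin P.A (z - x) = 0 := by
  rw [map_sub, show Matrix.toEuclideanLin P.A x = P.d from hx,
    show Matrix.toEuclideanLin P.A z = P.d from hz, sub_self]

lemma add_mem_eqSet {v : EuclideanSpace ℝ (Fin n)} (hx : x ∈ P.eqSet)
    (hv : Matrix.toEuclideanLin P.A v = 0) : x + v ∈ P.eqSet := by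
  show Matrix.toEuclideanLin P.A (x + v) = P.d
  rw [map_add, hv, add_zero]; exact hx

lemma add_smul_mem_eqSet (hx : x ∈ P.eqSet) (hy : y ∈ P.eqSet) (hz : z ∈ P.eqSet) (t : ℝ) :
    x + t • (z - y) ∈ P.eqSet :=
  add_mem_eqSet hx (by rw [map_smul, A_sub hy hz, smul_zero])

lemma isClosed_eqSet : IsClosed P.eqSet :=
  isClosed_eq (LinearMap.continuous_of_finiteDimensional _) continuous_const

lemma mem_feasible (hx : x ∈ P.eqSet) (h : ∀ i, P.φ i x ≤ 0) : x ∈ P.feasible := ⟨h, hx⟩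

lemma feasible_subset : P.feasible ⊆ P.eqSet := fun _ h => h.2

lemma mem_feasible_of_strict (hx : x ∈ P.eqSet) (h : x ∈ P.strictSet) : x ∈ P.feasible :=
  ⟨fun i => (h i).le, hx⟩

/-- A vector orthogonal to the direction space of `eqSet` lies in the range of `Aᵀ`. -/
lemma exists_transpose_eq (hP : P.Regular) {g : EuclideanSpace ℝ (Fin n)} (hx : x ∈ P.eqSet)
    (hg : ∀ z ∈ P.eqSet, ⟪g, z - x⟫_ℝ = 0) :
    ∃ ν, Matrix.toEuclideanLin P.A.transpose ν = g := by
  have h1 : ⟪P.Pc g, P.Pc g⟫_ℝ = 0 := by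
    rw [inner_Pc (A_Pc hP g)]
    simpa using hg _ (add_mem_eqSet hx (A_Pc hP g))
  rw [inner_self_eq_zero, Pc_apply, sub_eq_zero] at h1
  exact ⟨_, h1.symm⟩

/-! ### First-order conditions -/

/-- Fermat's rule along a line. -/
lemma inner_eq_zero_of_eventually_le {f : EuclideanSpace ℝ (Fin n) → ℝ}
    {g v : EuclideanSpace ℝ (Fin n)} (h : HasGradientAt f g x)
    (hmin : ∀ᶠ t in 𝓝 (0 : ℝ), f x ≤ f (x + t • v)) : ⟪g, v⟫_ℝ = 0 := by
  refine IsLocalMin.hasDerivAt_eq_zero (f := fun s : ℝ => f (x + s • v)) ?_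
    (hasDerivAt_comp_line h v)
  simpa [IsLocalMin, IsMinFilter] using hmin

lemma eventually_add_smul_mem {U : Set (EuclideanSpace ℝ (Fin n))} (hU : IsOpen U) (hx : x ∈ U)
    (v : EuclideanSpace ℝ (Fin n)) : ∀ᶠ t in 𝓝 (0 : ℝ), x + t • v ∈ U := by
  have h : ContinuousAt (fun t : ℝ => x + t • v) 0 := by fun_prop
  exact h.eventually_mem (hU.mem_nhds (by simpa using hx))

/-- The reduced form of the central path equations: `x` is strictly feasible and
`F x + μ ∇B(x)` is orthogonal to the affine constraints. -/
structure IsStationary (P : CVI n m p) (μ : ℝ) (x : EuclideanSpace ℝ (Fin n)) : Prop where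
  mem_eq : x ∈ P.eqSet
  mem_strict : x ∈ P.strictSet
  inner_eq : ∀ z ∈ P.eqSet, ⟪P.F x + μ • P.barrierGrad x, z - x⟫_ℝ = 0

lemma IsStationary.mem_feasible {μ : ℝ} (h : P.IsStationary μ x) : x ∈ P.feasible :=
  mem_feasible_of_strict h.mem_eq h.mem_strict

lemma isCentralPoint_iff (hP : P.Regular) {μ : ℝ} (hμ : 0 < μ) :
    P.IsCentralPoint μ x ↔ P.IsStationary μ x := by
  constructor
  · rintro ⟨c, ν, h1, h2, h3, h4, -⟩
    refine ⟨h3, h4, fun z hz => ?_⟩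
    have h5 : μ • P.barrierGrad x = ∑ i, c i • gradient (P.φ i) x := by
      rw [barrierGrad, Finset.smul_sum]
      refine Finset.sum_congr rfl fun i _ => ?_
      rw [smul_smul]
      congr 1
      have := (h4 i).ne
      have := h2 i
      field_simp
      linarith
    rw [h5, eq_neg_of_add_eq_zero_left h1, inner_neg_left, inner_toEuclideanLin_transpose,
      A_sub h3 hz, inner_zero_right, neg_zero]
  · rintro ⟨h1, h2, h3⟩
    obtain ⟨ν, hν⟩ := exists_transpose_eq hP h1 h3
    refine ⟨fun i => μ * (-(P.φ i x))⁻¹, -ν, ?_, fun i => ?_, h1, h2, fun i => ?_⟩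
    · rw [map_neg, hν, barrierGrad, Finset.smul_sum]
      simp [smul_smul]
    · have := (h2 i).ne
      field_simp
      ring
    · exact mul_pos hμ (inv_pos.2 (by linarith [h2 i]))

/-- The multiplier of the split problem is forced to be `μ ∇B(x)`. -/
lemma isCentralPair_iff (hP : P.Regular) {μ : ℝ} (hμ : 0 < μ) :
    P.IsCentralPair μ x l ↔ P.IsStationary μ x ∧ l = μ • P.barrierGrad x := by
  rw [IsCentralPair, isCentralPoint_iff hP hμ]
  refine and_congr_right fun hx => ⟨fun ⟨_, _, _, h⟩ => ?_, ?_⟩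
  · rw [← sub_eq_zero, ← inner_self_eq_zero (𝕜 := ℝ)]
    have hg : HasGradientAt (fun z => μ * P.barrier z - ⟪l, z - x⟫_ℝ) (μ • P.barrierGrad x - l)
        x := by
      have h1 := ((hasGradientAt_barrier hP hx.mem_strict).hasFDerivAt).const_mul μ
      have h2 : HasFDerivAt (fun z => ⟪l, z - x⟫_ℝ) (InnerProductSpace.toDual ℝ _ l) x := by
        have := (InnerProductSpace.toDual ℝ _ l).hasFDerivAt (x := x)
        simpa [inner_sub_right] using this.sub_const ⟪l, x⟫_ℝ
      rw [hasGradientAt_iff_hasFDerivAt]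
      rw [map_sub, map_smul]
      exact h1.sub h2
    have h0 := inner_eq_zero_of_eventually_le (v := l - μ • P.barrierGrad x) hg (by
      filter_upwards [eventually_add_smul_mem (isOpen_strictSet hP) hx.mem_strict
        (l - μ • P.barrierGrad x)] with t ht
      have := h _ ht
      simp only [sub_self, inner_zero_right, sub_zero]
      linarith)
    rw [← neg_sub, inner_neg_left] at h0
    linarith
  · rintro rfl
    refine ⟨hx.mem_eq, hx.mem_strict, fun z hz => ?_, fun z hz => ?_⟩
    · have := hx.inner_eq z hz
      rw [inner_add_left, inner_sub_right (P.F x)] at this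
      rw [inner_neg_left]
      linarith
    · have := mul_le_mul_of_nonneg_left (barrier_le hP hx.mem_strict hz) hμ.le
      rw [inner_smul_left]
      simp only [conj_trivial]
      linarith

lemma IsStationary.eq (hP : P.Regular) (hmono : P.MonotoneOp P.eqSet)
    (hstrict : P.StrictMonotoneOp P.feasible ∨ ∃ i, StrictConvexOn ℝ Set.univ (P.φ i))
    {μ : ℝ} (hμ : 0 < μ) (hx : P.IsStationary μ x) (hy : P.IsStationary μ y) : x = y := by
  by_contra hne
  have h1 := hx.inner_eq y hy.mem_eq
  have h2 := hy.inner_eq x hx.mem_eq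
  have h3 := hmono y hy.mem_eq x hx.mem_eq
  have h4 := barrierGrad_monotone hP hx.mem_strict hy.mem_strict
  have key : ⟪y - x, P.F y - P.F x⟫_ℝ + μ * ⟪P.barrierGrad y - P.barrierGrad x, y - x⟫_ℝ = 0 := by
    rw [← neg_sub y x, inner_neg_right] at h2
    rw [inner_add_left, inner_smul_left] at h1 h2
    simp only [conj_trivial] at h1 h2
    rw [real_inner_comm, inner_sub_left, inner_sub_left]
    linarith
  rcases hstrict with hs | hs
  · have := hs y hy.mem_feasible x hx.mem_feasible (Ne.symm hne)
    have := mul_nonneg hμ.le h4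
    linarith
  · have := mul_pos hμ (barrierGrad_strictMonotone hP hs hx.mem_strict hy.mem_strict hne)
    linarith

end

/-! ### Existence of the central path -/

section

variable {n m p : ℕ} {P : CVI n m p} {x y z w : EuclideanSpace ℝ (Fin n)}

lemma hasGradientAt_barrier_add_sq (hP : P.Regular) (μ κ : ℝ) (w : EuclideanSpace ℝ (Fin n))
    (hx : x ∈ P.strictSet) :
    HasGradientAt (fun y => μ * P.barrier y + κ / 2 * ‖y - w‖ ^ 2)
      (μ • P.barrierGrad x + κ • (x - w)) x := by
  have h1 := ((hasGradientAt_barrier hP hx).hasFDerivAt).const_mul μ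
  have h2 := (((hasFDerivAt_id x).sub_const w).norm_sq).const_mul (κ / 2)
  rw [hasGradientAt_iff_hasFDerivAt]
  refine (h1.add h2).congr_fderiv ?_
  ext v
  simp
  ring

lemma isCompact_feasible_inter (hP : P.Regular) (τ : ℝ) :
    IsCompact (P.feasible ∩ {y | ∀ i, P.φ i y ≤ -τ}) := by
  refine hP.compact.inter_right ?_
  simp only [ofPred_forall]
  exact isClosed_iInter fun i => isClosed_le (hP.continuous_φ i) continuous_const

lemma Regular.exists_norm_le (hP : P.Regular) : ∃ W : ℝ, 0 < W ∧ ∀ x ∈ P.feasible, ‖x‖ ≤ W := by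
  obtain ⟨W, hW⟩ := hP.compact.isBounded.exists_norm_le
  exact ⟨max W 1, by positivity, fun x hx => (hW x hx).trans (le_max_left _ _)⟩

/-- The proximal point of the barrier restricted to the affine constraints. -/
lemma exists_prox (hP : P.Regular) {μ κ : ℝ} (hμ : 0 < μ) (hκ : 0 < κ)
    (w : EuclideanSpace ℝ (Fin n)) :
    ∃ u ∈ P.eqSet, u ∈ P.strictSet ∧
      ∀ z ∈ P.eqSet, ⟪μ • P.barrierGrad u + κ • (u - w), z - u⟫_ℝ = 0 := by
  obtain ⟨xS, hS1, hS2⟩ := hP.slater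
  obtain ⟨W, hW, hWb⟩ := hP.exists_norm_le
  set J : EuclideanSpace ℝ (Fin n) → ℝ := fun y => μ * P.barrier y + κ / 2 * ‖y - w‖ ^ 2 with hJ
  obtain ⟨τ, hτ, hτb⟩ := exists_φ_le_neg hP 0 W (J xS / μ)
  have hlow : ∀ y ∈ P.eqSet, y ∈ P.strictSet → J y ≤ J xS →
      y ∈ P.feasible ∩ {y | ∀ i, P.φ i y ≤ -τ} := by
    intro y hy hys hyJ
    have hyf := mem_feasible_of_strict hy hys
    refine ⟨hyf, hτb y hys (by simpa using hWb y hyf) ?_⟩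
    rw [le_div_iff₀' hμ]
    have : 0 ≤ κ / 2 * ‖y - w‖ ^ 2 := by positivity
    simp only [hJ] at hyJ ⊢
    linarith
  have hstr : ∀ y ∈ P.feasible ∩ {y | ∀ i, P.φ i y ≤ -τ}, y ∈ P.strictSet := fun y hy i => by
    have := hy.2 i; linarith
  have hcont : ContinuousOn J (P.feasible ∩ {y | ∀ i, P.φ i y ≤ -τ}) := fun y hy =>
    (hasGradientAt_barrier_add_sq hP μ κ w (hstr y hy)).hasFDerivAt.continuousAt.continuousWithinAt
  obtain ⟨u, hu, hmin⟩ := (isCompact_feasible_inter hP τ).exists_isMinOn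
    ⟨xS, hlow xS hS2 hS1 le_rfl⟩ hcont
  refine ⟨u, hu.1.2, hstr u hu, fun z hz => ?_⟩
  refine inner_eq_zero_of_eventually_le (hasGradientAt_barrier_add_sq hP μ κ w (hstr u hu)) ?_
  filter_upwards [eventually_add_smul_mem (isOpen_strictSet hP) (hstr u hu) (z - u)] with t ht
  by_cases hle : J (u + t • (z - u)) ≤ J xS
  · exact hmin (hlow _ (add_smul_mem_eqSet hu.1.2 hu.1.2 hz t) ht hle)
  · exact (hmin (hlow xS hS2 hS1 le_rfl)).trans (not_le.1 hle).le

lemma continuousOn_F {L : ℝ} (hlip : ∀ x ∈ P.eqSet, ∀ z ∈ P.eqSet, ‖P.F x - P.F z‖ ≤ L * ‖x - z‖) :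
    ContinuousOn P.F P.eqSet := by
  have : LipschitzOnWith (Real.toNNReal L) P.F P.eqSet := by
    refine LipschitzOnWith.of_dist_le_mul fun x hx z hz => ?_
    rw [dist_eq_norm, dist_eq_norm]
    exact (hlip x hx z hz).trans (by gcongr; exact Real.le_coe_toNNReal L)
  exact this.continuousOn

/-- The barrier problem for the strongly monotone operator `F + ε`, solved by the contraction
principle applied to forward-backward splitting. -/
lemma exists_stationary_regularized (hP : P.Regular) {L : ℝ} (hL : 0 < L)
    (hmono : P.MonotoneOp P.eqSet)
    (hlip : ∀ x ∈ P.eqSet, ∀ z ∈ P.eqSet, ‖P.F x - P.F z‖ ≤ L * ‖x - z‖)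
    {μ ε : ℝ} (hμ : 0 < μ) (hε : 0 < ε) :
    ∃ u ∈ P.eqSet, u ∈ P.strictSet ∧
      ∀ z ∈ P.eqSet, ⟪P.F u + ε • u + μ • P.barrierGrad u, z - u⟫_ℝ = 0 := by
  obtain ⟨xS, hS1, hS2⟩ := hP.slater
  -- the step size `1 / κ` for which the forward step contracts
  set κ : ℝ := (L + ε) ^ 2 / ε with hκdef
  have hκ : 0 < κ := by positivity
  set G : EuclideanSpace ℝ (Fin n) → EuclideanSpace ℝ (Fin n) := fun x => P.F x + ε • x with hG
  choose prox hp1 hp2 hp3 using fun w => exists_prox hP hμ hκ w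
  have hne : ∀ w w', ‖prox w - prox w'‖ ≤ ‖w - w'‖ := by
    intro w w'
    have h1 := hp3 w _ (hp1 w')
    have h2 := hp3 w' _ (hp1 w)
    have h3 := barrierGrad_monotone hP (hp2 w') (hp2 w)
    have h4 : κ * (‖prox w - prox w'‖ ^ 2 - ⟪w - w', prox w - prox w'⟫_ℝ) ≤ 0 := by
      have h5 : κ * (‖prox w - prox w'‖ ^ 2 - ⟪w - w', prox w - prox w'⟫_ℝ)
          + μ * ⟪P.barrierGrad (prox w) - P.barrierGrad (prox w'), prox w - prox w'⟫_ℝ = 0 := by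
        rw [← neg_sub (prox w) (prox w'), inner_neg_right] at h1
        rw [← real_inner_self_eq_norm_sq]
        simp only [inner_add_left, inner_sub_left, inner_smul_left, conj_trivial] at h1 h2 ⊢
        linarith
      have := mul_nonneg hμ.le h3
      linarith
    have h6 := real_inner_le_norm (w - w') (prox w - prox w')
    have h7 : ‖prox w - prox w'‖ ^ 2 ≤ ‖w - w'‖ * ‖prox w - prox w'‖ := by
      nlinarith [nonpos_of_mul_nonpos_right h4 hκ]
    by_contra! hlt
    nlinarith [norm_nonneg (w - w')]
  have hq1 : 0 < ε / κ := by positivity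
  have hq2 : ε / κ ≤ 1 := by
    rw [div_le_one hκ, hκdef, le_div_iff₀ hε]
    nlinarith
  have hfor : ∀ x ∈ P.eqSet, ∀ z ∈ P.eqSet,
      ‖x - κ⁻¹ • G x - (z - κ⁻¹ • G z)‖ ≤ √(1 - ε / κ) * ‖x - z‖ := by
    intro x hx z hz
    have h1 : ‖G x - G z‖ ≤ (L + ε) * ‖x - z‖ := by
      have : G x - G z = (P.F x - P.F z) + ε • (x - z) := by simp only [hG]; module
      rw [this]
      refine (norm_add_le _ _).trans ?_
      rw [norm_smul, Real.norm_of_nonneg hε.le]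
      linarith [hlip x hx z hz]
    have h2 : ε * ‖x - z‖ ^ 2 ≤ ⟪x - z, G x - G z⟫_ℝ := by
      have : G x - G z = (P.F x - P.F z) + ε • (x - z) := by simp only [hG]; module
      rw [this, inner_add_right, inner_smul_right, real_inner_self_eq_norm_sq]
      linarith [hmono x hx z hz]
    have h3 : x - κ⁻¹ • G x - (z - κ⁻¹ • G z) = (x - z) - κ⁻¹ • (G x - G z) := by module
    have h4 : ‖G x - G z‖ ^ 2 ≤ (L + ε) ^ 2 * ‖x - z‖ ^ 2 := by
      rw [← mul_pow]; gcongr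
    rw [h3, ← Real.sqrt_sq (norm_nonneg (x - z)), ← Real.sqrt_mul (by linarith)]
    refine Real.le_sqrt_of_sq_le ?_
    rw [norm_sub_sq_real, inner_smul_right, norm_smul, mul_pow, Real.norm_of_nonneg (by positivity)]
    have h5 : (L + ε) ^ 2 = ε * κ := by rw [hκdef]; field_simp
    rw [h5] at h4
    have h6 : κ⁻¹ ^ 2 * ‖G x - G z‖ ^ 2 ≤ κ⁻¹ ^ 2 * (ε * κ * ‖x - z‖ ^ 2) := by gcongr
    have h7 : κ⁻¹ ^ 2 * (ε * κ * ‖x - z‖ ^ 2) = ε / κ * ‖x - z‖ ^ 2 := by field_simp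
    have h8 : κ⁻¹ * (ε * ‖x - z‖ ^ 2) ≤ κ⁻¹ * ⟪x - z, G x - G z⟫_ℝ := by gcongr
    have h9 : κ⁻¹ * (ε * ‖x - z‖ ^ 2) = ε / κ * ‖x - z‖ ^ 2 := by field_simp
    linarith
  let f : P.eqSet → P.eqSet := fun x => ⟨prox (x - κ⁻¹ • G x), hp1 _⟩
  have hf : ContractingWith (Real.toNNReal √(1 - ε / κ)) f := by
    constructor
    · rw [Real.toNNReal_lt_one, Real.sqrt_lt' one_pos]
      linarith
    · refine LipschitzWith.of_dist_le_mul fun x z => ?_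
      rw [Subtype.dist_eq, dist_eq_norm, Subtype.dist_eq, dist_eq_norm,
        Real.coe_toNNReal _ (Real.sqrt_nonneg _)]
      exact (hne _ _).trans (hfor x x.2 z z.2)
  have : CompleteSpace P.eqSet := isClosed_eqSet.completeSpace_coe
  have : Nonempty P.eqSet := ⟨⟨xS, hS2⟩⟩
  obtain ⟨⟨u, hu⟩, hfix⟩ : ∃ v, f v = v := ⟨_, hf.fixedPoint_isFixedPt⟩
  have hfix' : prox (u - κ⁻¹ • G u) = u := congrArg Subtype.val hfix
  refine ⟨u, hu, hfix' ▸ hp2 _, fun z hz => ?_⟩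
  have := hp3 (u - κ⁻¹ • G u) z hz
  rw [hfix', sub_sub_cancel, smul_inv_smul₀ hκ.ne'] at this
  rw [add_comm]; exact this

/-- The points of the central path are limits of solutions of the regularised problems. -/
lemma exists_isStationary (hP : P.Regular) {L : ℝ} (hL : 0 < L)
    (hmono : P.MonotoneOp P.eqSet)
    (hlip : ∀ x ∈ P.eqSet, ∀ z ∈ P.eqSet, ‖P.F x - P.F z‖ ≤ L * ‖x - z‖)
    {μ : ℝ} (hμ : 0 < μ) : ∃ x, P.IsStationary μ x := by
  obtain ⟨xS, hS1, hS2⟩ := hP.slater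
  obtain ⟨W, hW, hWb⟩ := hP.exists_norm_le
  have hF := continuousOn_F hlip
  choose u hu1 hu2 hu3 using fun k : ℕ =>
    exists_stationary_regularized hP hL hmono hlip hμ (Nat.one_div_pos_of_nat (α := ℝ) (n := k))
  have hcont : ContinuousOn (fun x => (‖P.F x‖ + ‖x‖) * ‖xS - x‖) P.feasible :=
    ((hF.mono feasible_subset).norm.add continuousOn_id.norm).mul (by fun_prop)
  obtain ⟨c, hc⟩ := hP.compact.exists_bound_of_continuousOn hcont
  have hfeas : ∀ k, u k ∈ P.feasible := fun k => mem_feasible_of_strict (hu1 k) (hu2 k)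
  have hB : ∀ k, P.barrier (u k) ≤ P.barrier xS + c / μ := by
    intro k
    have h1 := barrier_le hP (hu2 k) hS1
    have h2 := hu3 k xS hS2
    rw [inner_add_left, inner_smul_left, conj_trivial] at h2
    have hε : (1 : ℝ) / (k + 1) ≤ 1 := by
      rw [div_le_one (by positivity)]; linarith [k.cast_nonneg (α := ℝ)]
    have h3 : ‖P.F (u k) + ((1 : ℝ) / (k + 1)) • u k‖ ≤ ‖P.F (u k)‖ + ‖u k‖ := by
      refine (norm_add_le _ _).trans ?_
      rw [norm_smul, Real.norm_of_nonneg (by positivity)]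
      gcongr
      exact mul_le_of_le_one_left (norm_nonneg _) hε
    have h4 : ⟪P.F (u k) + ((1 : ℝ) / (k + 1)) • u k, xS - u k⟫_ℝ ≤ c := by
      refine (real_inner_le_norm _ _).trans (le_trans ?_ ((le_abs_self _).trans (hc _ (hfeas k))))
      gcongr
    have h5 : -⟪P.barrierGrad (u k), xS - u k⟫_ℝ ≤ c / μ := by
      rw [le_div_iff₀ hμ]; linarith
    linarith
  obtain ⟨τ, hτ, hτb⟩ := exists_φ_le_neg hP 0 W (P.barrier xS + c / μ)
  obtain ⟨x, hx, ψ, hψ, hlim⟩ := (isCompact_feasible_inter hP τ).tendsto_subseq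
    (x := u) fun k => ⟨hfeas k, hτb _ (hu2 k) (by simpa using hWb _ (hfeas k)) (hB k)⟩
  have hxs : x ∈ P.strictSet := fun i => by have := hx.2 i; linarith
  refine ⟨x, hx.1.2, hxs, fun z hz => ?_⟩
  have t1 : Tendsto (fun k => P.F (u (ψ k))) atTop (𝓝 (P.F x)) :=
    (hF x hx.1.2).tendsto.comp (tendsto_nhdsWithin_iff.2 ⟨hlim, .of_forall fun k => hu1 _⟩)
  have t2 : Tendsto (fun k => P.barrierGrad (u (ψ k))) atTop (𝓝 (P.barrierGrad x)) :=
    ((continuousOn_barrierGrad hP) x hxs).tendsto.comp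
      (tendsto_nhdsWithin_iff.2 ⟨hlim, .of_forall fun k => hu2 _⟩)
  have t3 : Tendsto (fun k => (1 : ℝ) / ((ψ k : ℕ) + 1)) atTop (𝓝 0) :=
    tendsto_one_div_add_atTop_nhds_zero_nat.comp hψ.tendsto_atTop
  have t4 := ((t1.add (t3.smul hlim)).add (t2.const_smul μ)).inner (𝕜 := ℝ)
    (tendsto_const_nhds (x := z) |>.sub hlim)
  rw [zero_smul, add_zero] at t4
  exact tendsto_nhds_unique t4 (tendsto_const_nhds.congr fun k => (hu3 (ψ k) z hz).symm)

lemma existsUnique_isCentralPair (hP : P.Regular) {L : ℝ} (hL : 0 < L)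
    (hmono : P.MonotoneOp P.eqSet)
    (hlip : ∀ x ∈ P.eqSet, ∀ z ∈ P.eqSet, ‖P.F x - P.F z‖ ≤ L * ‖x - z‖)
    (hstrict : P.StrictMonotoneOp P.feasible ∨ ∃ i, StrictConvexOn ℝ Set.univ (P.φ i))
    {μ : ℝ} (hμ : 0 < μ) :
    ∃! z : EuclideanSpace ℝ (Fin n) × EuclideanSpace ℝ (Fin n), P.IsCentralPair μ z.1 z.2 := by
  obtain ⟨x, hx⟩ := exists_isStationary hP hL hmono hlip hμ
  refine ⟨(x, μ • P.barrierGrad x), (isCentralPair_iff hP hμ).2 ⟨hx, rfl⟩, ?_⟩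
  rintro ⟨x', l'⟩ h
  obtain ⟨h1, h2⟩ := (isCentralPair_iff hP hμ).1 h
  simp only at h1 h2
  obtain rfl := h1.eq hP hmono hstrict hμ hx
  rw [h2]

end

/-! ### The inner loop -/

section

variable {n m p : ℕ} {P : CVI n m p} {z : EuclideanSpace ℝ (Fin n)} {μ β : ℝ} {K : ℕ}
  {x y l : ℕ → EuclideanSpace ℝ (Fin n)}

/-- The optimality conditions satisfied by `K` inner iterations with barrier parameter `μ`: the
`x`-step is stationary along the affine constraints and `l (k + 1) = μ ∇B(y (k + 1))`. Nothing is
required of the initial pair `(y 0, l 0)`. -/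
structure IsInnerRun (P : CVI n m p) (μ β : ℝ) (K : ℕ) (x y l : ℕ → EuclideanSpace ℝ (Fin n)) :
    Prop where
  x_mem : ∀ k < K, x (k + 1) ∈ P.eqSet
  inner_eq : ∀ k < K, ∀ u ∈ P.eqSet, ∀ v ∈ P.eqSet,
    ⟪P.F (x (k + 1)) + l (k + 1) + β • (y (k + 1) - y k), u - v⟫_ℝ = 0
  y_mem : ∀ k < K, y (k + 1) ∈ P.strictSet
  l_eq : ∀ k < K, l (k + 1) = μ • P.barrierGrad (y (k + 1))
  step : ∀ k < K, l (k + 1) = l k + β • (x (k + 1) - y (k + 1))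

/-- The inner loop of each outer step satisfies the first-order conditions of its two
steps. -/
lemma IsRun.isInnerRun (hP : P.Regular) {δ μ₀ : ℝ} {T : ℕ} {y₀ l₀ : EuclideanSpace ℝ (Fin n)}
    {x y l : ℕ → ℕ → EuclideanSpace ℝ (Fin n)} (hβ : 0 < β)
    (h : P.IsRun β δ μ₀ T K y₀ l₀ x y l) {t : ℕ} (ht : t < T) :
    P.IsInnerRun (muSeq μ₀ δ t) β K (x t) (y t) (l t) where
  x_mem k hk := by
    have h1 := congrArg (Matrix.toEuclideanLin P.A) (h.step_x t ht k hk)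
    simp only [map_sub, map_add, map_smul, A_Pc hP, A_dc hP, map_zero, smul_zero, add_zero,
      sub_zero, sub_eq_zero] at h1
    exact h1
  inner_eq k hk u hu v hv := by
    have hA := A_sub hv hu
    have h1 := congrArg (fun w => ⟪w, u - v⟫_ℝ) (h.step_x t ht k hk)
    simp only [inner_sub_left, inner_add_left, inner_smul_left, inner_Pc hA, inner_dc hA,
      conj_trivial, inner_zero_left] at h1
    rw [h.step_l t ht k hk]
    simp only [inner_sub_left, inner_add_left, inner_smul_left, conj_trivial]
    field_simp at h1
    linarith
  y_mem k hk := (h.step_y t ht k hk).1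
  l_eq k hk := by
    obtain ⟨h1, h2⟩ := h.step_y t ht k hk
    have h3 : muSeq μ₀ δ t • P.barrierGrad (y t (k + 1))
        + β • (y t (k + 1) - (x t (k + 1) + (1 / β) • l t k)) = 0 := by
      rw [← inner_self_eq_zero (𝕜 := ℝ)]
      refine inner_eq_zero_of_eventually_le (hasGradientAt_barrier_add_sq hP _ β _ h1) ?_
      filter_upwards [eventually_add_smul_mem (isOpen_strictSet hP) h1 _] with s hs
      have h3 : P.yObjective (muSeq μ₀ δ t) β (x t (k + 1)) (l t k) (y t (k + 1)) ≤
        P.yObjective (muSeq μ₀ δ t) β (x t (k + 1)) (l t k) _ := h2 hs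
      simpa only [yObjective, sub_sub] using h3
    rw [h.step_l t ht k hk, ← sub_eq_zero, ← neg_eq_zero, ← h3]
    match_scalars <;> field_simp
  step k hk := h.step_l t ht k hk

/-- The squared length of the `k`-th inner step in the metric of `Delta`. -/
noncomputable def residual (β : ℝ) (y l : ℕ → EuclideanSpace ℝ (Fin n)) (k : ℕ) : ℝ :=
  1 / β * ‖l (k + 1) - l k‖ ^ 2 + β * ‖y (k + 1) - y k‖ ^ 2

lemma residual_nonneg (hβ : 0 < β) (k : ℕ) : 0 ≤ residual β y l k := by
  unfold residual; positivity

lemma Delta_nonneg (hβ : 0 < β) (a b c d : EuclideanSpace ℝ (Fin n)) : 0 ≤ Delta β a b c d := by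
  unfold Delta; positivity

/-- The Hilbert space identity behind the energy identity and the monotonicity of the residual. -/
lemma step_identity_aux {E : Type*} [NormedAddCommGroup E] [InnerProductSpace ℝ E] (hβ : 0 < β)
    (a b c d g : E) (h : ⟪g + b + β • (d - c), d + (1 / β) • (b - a)⟫_ℝ = 0) :
    ⟪g, d + (1 / β) • (b - a)⟫_ℝ + ⟪b, d⟫_ℝ
      + 1 / 2 * ((1 / β * ‖b‖ ^ 2 + β * ‖d‖ ^ 2) - (1 / β * ‖a‖ ^ 2 + β * ‖c‖ ^ 2))
      + 1 / 2 * (1 / β * ‖b - a‖ ^ 2 + β * ‖d - c‖ ^ 2) + ⟪b - a, d - c⟫_ℝ = 0 := by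
  rw [← h]
  simp only [← real_inner_self_eq_norm_sq, inner_add_left, inner_add_right, inner_sub_left,
    inner_sub_right, inner_smul_left, inner_smul_right, conj_trivial]
  rw [real_inner_comm a b, real_inner_comm c d, real_inner_comm d a, real_inner_comm d b,
    real_inner_comm c a, real_inner_comm c b]
  field_simp
  ring

lemma IsInnerRun.x_eq (h : P.IsInnerRun μ β K x y l) (hβ : 0 < β) {k : ℕ} (hk : k < K) :
    x (k + 1) = y (k + 1) + (1 / β) • (l (k + 1) - l k) := by
  rw [h.step k hk]
  match_scalars <;> field_simp <;> ring

/-- The basic energy identity: the inner step measured against an arbitrary pair `(z, l')` with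
`z` on the affine constraints. -/
lemma IsInnerRun.step_identity (h : P.IsInnerRun μ β K x y l) (hβ : 0 < β) {k : ℕ} (hk : k < K)
    (hz : z ∈ P.eqSet) (l' : EuclideanSpace ℝ (Fin n)) :
    ⟪P.F (x (k + 1)) + l', x (k + 1) - z⟫_ℝ + ⟪l (k + 1) - l', y (k + 1) - z⟫_ℝ
      + 1 / 2 * (Delta β (y (k + 1)) (l (k + 1)) z l' - Delta β (y k) (l k) z l')
      + 1 / 2 * residual β y l k + ⟪l (k + 1) - l k, y (k + 1) - y k⟫_ℝ = 0 := by
  have h1 := h.inner_eq k hk _ (h.x_mem k hk) z hz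
  have hx : x (k + 1) - z = (y (k + 1) - z) + (1 / β) • ((l (k + 1) - l') - (l k - l')) := by
    rw [h.x_eq hβ hk]; module
  have h2 := step_identity_aux hβ (l k - l') (l (k + 1) - l') (y k - z) (y (k + 1) - z)
    (P.F (x (k + 1)) + l') (by
      rw [← hx, ← h1]; congr 1; module)
  rw [← hx] at h2
  simp only [sub_sub_sub_cancel_right] at h2
  exact h2

/-- The multipliers `l (k + 1)` depend monotonically on the points `y (k + 1)`. -/
lemma IsInnerRun.inner_l_nonneg (h : P.IsInnerRun μ β K x y l) (hP : P.Regular) (hμ : 0 < μ)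
    {k j : ℕ} (hk : k < K) (hj : j < K) :
    0 ≤ ⟪l (k + 1) - l (j + 1), y (k + 1) - y (j + 1)⟫_ℝ := by
  rw [h.l_eq k hk, h.l_eq j hj, ← smul_sub, inner_smul_left, conj_trivial]
  exact mul_nonneg hμ.le (barrierGrad_monotone hP (h.y_mem j hj) (h.y_mem k hk))

lemma half_residual_add_inner_nonneg_aux {E : Type*} [NormedAddCommGroup E] [InnerProductSpace ℝ E]
    (hβ : 0 < β) (b d : E) : 0 ≤ 1 / 2 * (1 / β * ‖b‖ ^ 2 + β * ‖d‖ ^ 2) + ⟪b, d⟫_ℝ := by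
  have h := sq_nonneg ‖b + β • d‖
  rw [norm_add_sq_real, norm_smul, Real.norm_of_nonneg hβ.le, inner_smul_right] at h
  have h2 : 1 / 2 * (1 / β * ‖b‖ ^ 2 + β * ‖d‖ ^ 2) + ⟪b, d⟫_ℝ
      = 1 / (2 * β) * (‖b‖ ^ 2 + 2 * (β * ⟪b, d⟫_ℝ) + (β * ‖d‖) ^ 2) := by
    field_simp
    ring
  rw [h2]
  positivity

/-- Completing the square: the cross term is absorbed by half of the residual. -/
lemma half_residual_add_inner_nonneg (hβ : 0 < β) (k : ℕ) :
    0 ≤ 1 / 2 * residual β y l k + ⟪l (k + 1) - l k, y (k + 1) - y k⟫_ℝ :=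
  half_residual_add_inner_nonneg_aux hβ _ _

/-- The inner step measured against the point of the central path and its multiplier: the first two
terms are nonnegative by monotonicity. -/
lemma IsInnerRun.central_identity (h : P.IsInnerRun μ β K x y l) (hβ : 0 < β)
    {xμ : EuclideanSpace ℝ (Fin n)} (hx : P.IsStationary μ xμ) {k : ℕ} (hk : k < K) :
    ⟪x (k + 1) - xμ, P.F (x (k + 1)) - P.F xμ⟫_ℝ
      + ⟪l (k + 1) - μ • P.barrierGrad xμ, y (k + 1) - xμ⟫_ℝ
      + 1 / 2 * (Delta β (y (k + 1)) (l (k + 1)) xμ (μ • P.barrierGrad xμ)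
        - Delta β (y k) (l k) xμ (μ • P.barrierGrad xμ))
      + 1 / 2 * residual β y l k + ⟪l (k + 1) - l k, y (k + 1) - y k⟫_ℝ = 0 := by
  have h1 := h.step_identity hβ hk hx.mem_eq (μ • P.barrierGrad xμ)
  have h2 := hx.inner_eq _ (h.x_mem k hk)
  rw [inner_add_left] at h1 h2
  rw [real_inner_comm, inner_sub_left]
  linarith

lemma IsInnerRun.inner_l_central_nonneg (h : P.IsInnerRun μ β K x y l) (hP : P.Regular)
    (hμ : 0 < μ) {xμ : EuclideanSpace ℝ (Fin n)} (hx : P.IsStationary μ xμ) {k : ℕ} (hk : k < K) :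
    0 ≤ ⟪l (k + 1) - μ • P.barrierGrad xμ, y (k + 1) - xμ⟫_ℝ := by
  rw [h.l_eq k hk, ← smul_sub, inner_smul_left, conj_trivial]
  exact mul_nonneg hμ.le (barrierGrad_monotone hP hx.mem_strict (h.y_mem k hk))

/-- The inner loop is Fejér monotone towards the point of the central path and its multiplier. -/
lemma IsInnerRun.Delta_succ_le (h : P.IsInnerRun μ β K x y l) (hP : P.Regular) (hβ : 0 < β)
    (hμ : 0 < μ) (hmono : P.MonotoneOp P.eqSet)
    {xμ : EuclideanSpace ℝ (Fin n)} (hx : P.IsStationary μ xμ) {k : ℕ} (hk : k < K) :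
    Delta β (y (k + 1)) (l (k + 1)) xμ (μ • P.barrierGrad xμ)
      ≤ Delta β (y k) (l k) xμ (μ • P.barrierGrad xμ) := by
  have h1 := h.central_identity hβ hx hk
  have h2 := h.inner_l_central_nonneg hP hμ hx hk
  have h3 := hmono _ (h.x_mem k hk) _ hx.mem_eq
  have h4 := half_residual_add_inner_nonneg hβ k (y := y) (l := l)
  linarith

/-- From the second step on, the decrease of `Delta` controls the residual. -/
lemma IsInnerRun.Delta_succ_add_residual_le (h : P.IsInnerRun μ β K x y l) (hP : P.Regular)
    (hβ : 0 < β) (hμ : 0 < μ) (hmono : P.MonotoneOp P.eqSet)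
    {xμ : EuclideanSpace ℝ (Fin n)} (hx : P.IsStationary μ xμ) {k : ℕ} (hk : k + 1 < K) :
    Delta β (y (k + 2)) (l (k + 2)) xμ (μ • P.barrierGrad xμ) + residual β y l (k + 1)
      ≤ Delta β (y (k + 1)) (l (k + 1)) xμ (μ • P.barrierGrad xμ) := by
  have h1 := h.central_identity hβ hx hk
  have h2 := h.inner_l_central_nonneg hP hμ hx hk
  have h3 := hmono _ (h.x_mem _ hk) _ hx.mem_eq
  have h4 := h.inner_l_nonneg hP hμ hk (show k < K by omega)
  linarith

lemma IsInnerRun.Delta_le_of_le (h : P.IsInnerRun μ β K x y l) (hP : P.Regular) (hβ : 0 < β)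
    (hμ : 0 < μ) (hmono : P.MonotoneOp P.eqSet)
    {xμ : EuclideanSpace ℝ (Fin n)} (hx : P.IsStationary μ xμ) {j k : ℕ} (hjk : j ≤ k)
    (hk : k ≤ K) :
    Delta β (y k) (l k) xμ (μ • P.barrierGrad xμ)
      ≤ Delta β (y j) (l j) xμ (μ • P.barrierGrad xμ) := by
  induction k, hjk using Nat.le_induction with
  | base => exact le_rfl
  | succ k hjk ih => exact (h.Delta_succ_le hP hβ hμ hmono hx hk).trans (ih (by omega))

lemma IsInnerRun.sum_residual_le (h : P.IsInnerRun μ β K x y l) (hP : P.Regular) (hβ : 0 < β)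
    (hμ : 0 < μ) (hmono : P.MonotoneOp P.eqSet)
    {xμ : EuclideanSpace ℝ (Fin n)} (hx : P.IsStationary μ xμ) {k : ℕ} (hk : k + 1 ≤ K) :
    ∑ j ∈ Finset.range k, residual β y l (j + 1)
      ≤ Delta β (y 0) (l 0) xμ (μ • P.barrierGrad xμ) := by
  have key : ∀ k, k + 1 ≤ K → ∑ j ∈ Finset.range k, residual β y l (j + 1)
      + Delta β (y (k + 1)) (l (k + 1)) xμ (μ • P.barrierGrad xμ)
      ≤ Delta β (y 1) (l 1) xμ (μ • P.barrierGrad xμ) := by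
    intro k
    induction k with
    | zero => simp
    | succ k ih =>
      intro hk
      have h1 := ih (by omega)
      have h2 := h.Delta_succ_add_residual_le hP hβ hμ hmono hx (show k + 1 < K by omega)
      rw [Finset.sum_range_succ]
      linarith
  have h1 := key k hk
  have h2 := h.Delta_succ_le hP hβ hμ hmono hx (show 0 < K by omega)
  have h3 := Delta_nonneg hβ (y (k + 1)) (l (k + 1)) xμ (μ • P.barrierGrad xμ)
  simp only [zero_add] at h2
  linarith

lemma residual_antitone_aux {E : Type*} [NormedAddCommGroup E] [InnerProductSpace ℝ E] (hβ : 0 < β)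
    (a b c d : E) (h : ⟪b + β • (d - c), d + (1 / β) • (b - a)⟫_ℝ ≤ 0) (hbd : 0 ≤ ⟪b, d⟫_ℝ) :
    1 / β * ‖b‖ ^ 2 + β * ‖d‖ ^ 2 ≤ 1 / β * ‖a‖ ^ 2 + β * ‖c‖ ^ 2 := by
  have h1 := step_identity_aux hβ a b c d
    (-(b + β • (d - c))) (by simp [neg_add_cancel])
  rw [inner_neg_left] at h1
  have h2 : 0 ≤ 1 / 2 * (1 / β * ‖b - a‖ ^ 2 + β * ‖d - c‖ ^ 2) + ⟪b - a, d - c⟫_ℝ := by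
    have := half_residual_add_inner_nonneg_aux hβ (b - a) (d - c)
    exact this
  linarith

/-- Two consecutive inner steps, subtracted from each other, show that the residual is antitone. -/
lemma IsInnerRun.residual_succ_le (h : P.IsInnerRun μ β K x y l) (hP : P.Regular) (hβ : 0 < β)
    (hμ : 0 < μ) (hmono : P.MonotoneOp P.eqSet) {k : ℕ} (hk : k + 1 < K) :
    residual β y l (k + 1) ≤ residual β y l k := by
  have hk' : k < K := by omega
  refine residual_antitone_aux hβ _ _ _ _ ?_ (h.inner_l_nonneg hP hμ hk hk')
  have h1 := h.inner_eq _ hk _ (h.x_mem _ hk) _ (h.x_mem _ hk')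
  have h2 := h.inner_eq _ hk' _ (h.x_mem _ hk) _ (h.x_mem _ hk')
  have h3 := hmono _ (h.x_mem _ hk) _ (h.x_mem _ hk')
  have h4 : x (k + 1 + 1) - x (k + 1) = y (k + 1 + 1) - y (k + 1)
      + (1 / β) • (l (k + 1 + 1) - l (k + 1) - (l (k + 1) - l k)) := by
    rw [h.x_eq hβ hk, h.x_eq hβ hk']; module
  rw [← h4]
  have h5 : l (k + 1 + 1) - l (k + 1) + β • (y (k + 1 + 1) - y (k + 1) - (y (k + 1) - y k))
      = (P.F (x (k + 1 + 1)) + l (k + 1 + 1) + β • (y (k + 1 + 1) - y (k + 1)))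
      - (P.F (x (k + 1)) + l (k + 1) + β • (y (k + 1) - y k))
      - (P.F (x (k + 1 + 1)) - P.F (x (k + 1))) := by module
  rw [h5, inner_sub_left, inner_sub_left, h1, h2, real_inner_comm]
  linarith

/-- The residual decays like `1 / k`, being antitone and summable. -/
lemma IsInnerRun.residual_le (h : P.IsInnerRun μ β K x y l) (hP : P.Regular) (hβ : 0 < β)
    (hμ : 0 < μ) (hmono : P.MonotoneOp P.eqSet)
    {xμ : EuclideanSpace ℝ (Fin n)} (hx : P.IsStationary μ xμ) {k : ℕ} (hk : k + 1 < K) :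
    (k + 1 : ℝ) * residual β y l (k + 1) ≤ Delta β (y 0) (l 0) xμ (μ • P.barrierGrad xμ) := by
  have hanti : ∀ j i, j ≤ i → i + 1 < K → residual β y l (i + 1) ≤ residual β y l (j + 1) := by
    intro j i hji
    induction i, hji using Nat.le_induction with
    | base => intro _; exact le_rfl
    | succ i hji ih =>
      intro hi
      exact (h.residual_succ_le hP hβ hμ hmono hi).trans (ih (by omega))
  refine le_trans ?_ (h.sum_residual_le hP hβ hμ hmono hx (show (k + 1) + 1 ≤ K by omega))
  calc (k + 1 : ℝ) * residual β y l (k + 1)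
      = ∑ j ∈ Finset.range (k + 1), residual β y l (k + 1) := by simp
    _ ≤ _ := Finset.sum_le_sum fun j hj =>
      hanti j k (by have := Finset.mem_range.1 hj; omega) hk

lemma norm_le_of_Delta_le {a b c d : EuclideanSpace ℝ (Fin n)} {E : ℝ} (hβ : 0 < β)
    (h : Delta β a b c d ≤ E) : ‖a - c‖ ≤ √(E / β) ∧ ‖b - d‖ ≤ √(E * β) := by
  unfold Delta at h
  have h1 : 0 ≤ 1 / β * ‖b - d‖ ^ 2 := by positivity
  have h2 : 0 ≤ β * ‖a - c‖ ^ 2 := by positivity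
  constructor
  · refine Real.le_sqrt_of_sq_le ?_
    rw [le_div_iff₀ hβ]; linarith
  · refine Real.le_sqrt_of_sq_le ?_
    rw [← div_le_iff₀ hβ]
    have : ‖b - d‖ ^ 2 / β = 1 / β * ‖b - d‖ ^ 2 := by ring
    linarith

lemma Delta_le_of_norm_le {a b c d : EuclideanSpace ℝ (Fin n)} {r s : ℝ} (hβ : 0 < β)
    (h1 : ‖a - c‖ ≤ r) (h2 : ‖b - d‖ ≤ s) : Delta β a b c d ≤ 1 / β * s ^ 2 + β * r ^ 2 := by
  unfold Delta; gcongr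

/-- The two increments of an inner step, bounded by the residual. -/
lemma IsInnerRun.norm_le_residual (h : P.IsInnerRun μ β K x y l) (hβ : 0 < β) {k : ℕ}
    (hk : k < K) : β * ‖x (k + 1) - y (k + 1)‖ ^ 2 ≤ residual β y l k ∧
      β * ‖y (k + 1) - y k‖ ^ 2 ≤ residual β y l k := by
  have h1 : l (k + 1) - l k = β • (x (k + 1) - y (k + 1)) := by rw [h.step k hk]; module
  have h2 : residual β y l k
      = β * ‖x (k + 1) - y (k + 1)‖ ^ 2 + β * ‖y (k + 1) - y k‖ ^ 2 := by
    rw [residual, h1, norm_smul, Real.norm_of_nonneg hβ.le]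
    field_simp
  rw [h2]
  constructor
  · have : 0 ≤ β * ‖y (k + 1) - y k‖ ^ 2 := by positivity
    linarith
  · have : 0 ≤ β * ‖x (k + 1) - y (k + 1)‖ ^ 2 := by positivity
    linarith

end

/-! ### Uniform boundedness of the iterates -/

section

variable {n m p : ℕ} {P : CVI n m p} {z xS : EuclideanSpace ℝ (Fin n)} {μ β : ℝ} {K : ℕ}
  {x y l : ℕ → EuclideanSpace ℝ (Fin n)}

/-- The standing assumptions on the problem: regular constraints and an operator that is monotone
and `L`-Lipschitz on the affine constraints, with the strictness that makes the central path
unique. -/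
structure IsWellPosed (P : CVI n m p) (L : ℝ) : Prop where
  regular : P.Regular
  L_pos : 0 < L
  mono : P.MonotoneOp P.eqSet
  lip : ∀ x ∈ P.eqSet, ∀ z ∈ P.eqSet, ‖P.F x - P.F z‖ ≤ L * ‖x - z‖
  strict : P.StrictMonotoneOp P.feasible ∨ ∃ i, StrictConvexOn ℝ Set.univ (P.φ i)

/-- Since the feasible set is compact, the points with `φ ≤ 0` grow at most linearly with their
distance from the affine constraints. -/
lemma exists_norm_sub_le (hP : P.Regular) (hS : xS ∈ P.feasible) :
    ∃ ρ : ℝ, 0 < ρ ∧ ∀ y, (∀ i, P.φ i y ≤ 0) → ∀ x ∈ P.eqSet, ‖y - xS‖ ≤ ρ * (1 + ‖x - y‖) := by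
  obtain ⟨W, hW, hWb⟩ := hP.exists_norm_le
  -- a radius beyond which there are no feasible points
  set R : ℝ := W + ‖xS‖ + 1 with hR
  have hR0 : 0 < R := by positivity
  set T := LinearMap.toContinuousLinearMap (Matrix.toEuclideanLin P.A) with hT
  have hcomp : IsCompact (Metric.sphere xS R ∩ {u | ∀ i, P.φ i u ≤ 0}) := by
    refine (isCompact_sphere xS R).inter_right ?_
    simp only [ofPred_forall]
    exact isClosed_iInter fun i => isClosed_le (hP.continuous_φ i) continuous_const
  obtain ⟨η, hη, hηb⟩ := hcomp.exists_forall_le' (f := fun u => ‖T u - P.d‖)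
    (by fun_prop) (a := 0) (by
      rintro u ⟨hu1, hu2⟩
      rw [norm_pos_iff, sub_ne_zero]
      intro hu
      have h1 := hWb u ⟨hu2, hu⟩
      have h2 : ‖u - xS‖ = R := by simpa [dist_eq_norm] using hu1
      have h3 := norm_sub_le u xS
      linarith)
  refine ⟨R * (1 + ‖T‖ / η), by positivity, fun y hy x hx => ?_⟩
  rcases le_or_gt ‖y - xS‖ R with hle | hgt
  · refine hle.trans ?_
    have h1 : 0 ≤ ‖T‖ / η := by positivity
    have h2 : 1 ≤ (1 + ‖T‖ / η) * (1 + ‖x - y‖) := by nlinarith [norm_nonneg (x - y)]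
    nlinarith
  · have hy0 : 0 < ‖y - xS‖ := hR0.trans hgt
    set θ : ℝ := R / ‖y - xS‖ with hθ
    have hθ0 : 0 < θ := by positivity
    have hθ1 : θ < 1 := (div_lt_one hy0).2 hgt
    have hu : xS + θ • (y - xS) = (1 - θ) • xS + θ • y := by module
    have h1 := hηb (xS + θ • (y - xS)) ⟨by
      simp [norm_smul, abs_of_pos hθ0]; rw [hθ, div_mul_cancel₀ _ hy0.ne'], fun i => by
      rw [hu]
      have := (hP.convex i).2 (mem_univ xS) (mem_univ y) (sub_nonneg.2 hθ1.le) hθ0.le (by ring)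
      refine this.trans ?_
      simp only [smul_eq_mul]
      nlinarith [hy i, hS.1 i]⟩
    have h2 : T (xS + θ • (y - xS)) - P.d = θ • T (y - x) := by
      have e1 : T xS = P.d := hS.2
      have e2 : T x = P.d := hx
      simp only [map_add, map_smul, map_sub, e1, e2]; module
    have h3 := T.le_opNorm (y - x)
    rw [h2, norm_smul, Real.norm_of_nonneg hθ0.le] at h1
    have h4 : η ≤ θ * (‖T‖ * ‖x - y‖) := by
      rw [norm_sub_rev x y]
      exact h1.trans (by gcongr)
    have h5 : ‖y - xS‖ ≤ R * (‖T‖ / η) * ‖x - y‖ := by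
      rw [hθ, div_mul_eq_mul_div, le_div_iff₀ hy0] at h4
      rw [mul_div_assoc', div_mul_eq_mul_div, le_div_iff₀ hη]
      linarith
    have h6 : 0 ≤ R * (1 + ‖T‖ / η) + R * ‖x - y‖ := by positivity
    linarith

/-- The central path and its multipliers stay bounded as the barrier parameter vanishes: a Slater
point bounds the multipliers. -/
lemma IsWellPosed.exists_central_bound {L : ℝ} (h : P.IsWellPosed L) (μ₀ : ℝ) :
    ∃ W : ℝ, 0 < W ∧ ∀ μ, 0 < μ → μ ≤ μ₀ → ∀ xμ, P.IsStationary μ xμ →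
      ‖xμ‖ ≤ W ∧ ‖μ • P.barrierGrad xμ‖ ≤ W := by
  have hP := h.regular
  obtain ⟨xS, hS, σ, hσ, hSσ⟩ := hP.exists_slater
  obtain ⟨W, hW, hWb⟩ := hP.exists_norm_le
  have hF := (continuousOn_F h.lip).mono feasible_subset
  obtain ⟨c, hc⟩ := hP.compact.exists_bound_of_continuousOn
    (f := fun x => ⟪P.F x, xS - x⟫_ℝ) (hF.inner (by fun_prop))
  obtain ⟨G, hG, hGb⟩ := exists_norm_gradient_le hP 0 W
  refine ⟨max W (G * ((m * μ₀ + c) / σ)), by positivity, fun μ hμ hμ₀ xμ hx => ?_⟩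
  have hxW := hWb xμ hx.mem_feasible
  refine ⟨hxW.trans (le_max_left _ _), le_trans ?_ (le_max_right _ _)⟩
  have h1 := sum_inv_le hP hx.mem_strict hSσ
  have h2 := norm_barrierGrad_le hx.mem_strict (hGb xμ (by simpa using hxW))
  have h3 := hx.inner_eq xS hS
  have h4 := (le_abs_self _).trans (hc xμ hx.mem_feasible)
  rw [inner_add_left, inner_smul_left, conj_trivial] at h3
  rw [← neg_sub xS xμ, inner_neg_right] at h1
  have h5 : σ * (μ * ∑ i, (-(P.φ i xμ))⁻¹) ≤ m * μ₀ + c := by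
    have := mul_le_mul_of_nonneg_left h1 hμ.le
    have : (m : ℝ) * μ ≤ m * μ₀ := by gcongr
    linarith
  rw [norm_smul, Real.norm_of_nonneg hμ.le]
  calc μ * ‖P.barrierGrad xμ‖ ≤ μ * (G * ∑ i, (-(P.φ i xμ))⁻¹) := by gcongr
    _ = G * (μ * ∑ i, (-(P.φ i xμ))⁻¹) := by ring
    _ ≤ _ := by
      gcongr
      rw [le_div_iff₀' hσ]; exact h5

/-- Monotonicity of `Delta` along the inner loop in the form of a norm bound. -/
lemma IsInnerRun.norm_le_of_norm_le (h : P.IsInnerRun μ β K x y l) (hP : P.Regular) (hβ : 0 < β)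
    (hμ : 0 < μ) (hmono : P.MonotoneOp P.eqSet) {xμ : EuclideanSpace ℝ (Fin n)}
    (hx : P.IsStationary μ xμ) {W D : ℝ} (hW : ‖xμ‖ ≤ W ∧ ‖μ • P.barrierGrad xμ‖ ≤ W)
    {j k : ℕ} (hjk : j ≤ k) (hk : k ≤ K) (hj : ‖y j‖ ≤ D ∧ ‖l j‖ ≤ D) :
    ‖y k‖ ≤ W + (β + 1 / β) * (D + W) ∧ ‖l k‖ ≤ W + (β + 1 / β) * (D + W) := by
  have h1 := h.Delta_le_of_le hP hβ hμ hmono hx hjk hk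
  have h2 : Delta β (y j) (l j) xμ (μ • P.barrierGrad xμ)
      ≤ 1 / β * (D + W) ^ 2 + β * (D + W) ^ 2 := by
    refine Delta_le_of_norm_le hβ ((norm_sub_le _ _).trans ?_) ((norm_sub_le _ _).trans ?_) <;>
    linarith
  have hDW : 0 ≤ D + W := by linarith [norm_nonneg (y j), norm_nonneg xμ]
  have h3 := norm_le_of_Delta_le hβ (h1.trans h2)
  have hc : 1 ≤ (β + 1 / β) * β := by rw [add_mul]; field_simp; nlinarith
  have hc' : 1 ≤ (β + 1 / β) * (1 / β) := by
    rw [add_mul, mul_one_div_cancel hβ.ne']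
    have : 0 < 1 / β * (1 / β) := by positivity
    linarith
  have hcp : 0 < β + 1 / β := by positivity
  constructor
  · have h4 : √((1 / β * (D + W) ^ 2 + β * (D + W) ^ 2) / β) ≤ (β + 1 / β) * (D + W) := by
      refine Real.sqrt_le_iff.2 ⟨by positivity, ?_⟩
      have : (1 / β * (D + W) ^ 2 + β * (D + W) ^ 2) / β
        = (β + 1 / β) * (1 / β) * (D + W) ^ 2 := by ring
      rw [this, mul_pow, sq (β + 1 / β)]
      gcongr
      linarith
    have h5 := norm_le_norm_add_norm_sub' (y k) xμ
    linarith [h3.1]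
  · have h4 : √((1 / β * (D + W) ^ 2 + β * (D + W) ^ 2) * β) ≤ (β + 1 / β) * (D + W) := by
      refine Real.sqrt_le_iff.2 ⟨by positivity, ?_⟩
      have : (1 / β * (D + W) ^ 2 + β * (D + W) ^ 2) * β
        = (β + 1 / β) * β * (D + W) ^ 2 := by ring
      rw [this, mul_pow, sq (β + 1 / β)]
      gcongr
      have : 0 < 1 / β := by positivity
      linarith
    have h5 := norm_le_norm_add_norm_sub' (l k) (μ • P.barrierGrad xμ)
    linarith [h3.2]

/-- Compared with a Slater point `xS` and the multiplier `0`, an inner step pays for the size of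
the weights `μ (-φᵢ)⁻¹` of the new multiplier. -/
lemma IsInnerRun.slater_step (h : P.IsInnerRun μ β K x y l) (hP : P.Regular) (hβ : 0 < β)
    (hμ : 0 < μ) {μ₀ : ℝ} (hμ₀ : μ ≤ μ₀) (hmono : P.MonotoneOp P.eqSet) {σ ρ : ℝ}
    (hS : xS ∈ P.eqSet) (hSσ : ∀ i, P.φ i xS ≤ -σ) (hρ : 0 < ρ)
    (hρb : ∀ y, (∀ i, P.φ i y ≤ 0) → ∀ x ∈ P.eqSet, ‖y - xS‖ ≤ ρ * (1 + ‖x - y‖))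
    {k : ℕ} (hk : k < K) :
    σ * (μ * ∑ i, (-(P.φ i (y (k + 1))))⁻¹)
      + 1 / 2 * (Delta β (y (k + 1)) (l (k + 1)) xS 0 - Delta β (y k) (l k) xS 0)
      ≤ m * μ₀ + ‖P.F xS‖ * (1 + ρ) * (2 + ‖x (k + 1) - y (k + 1)‖ ^ 2) := by
  set e := ‖x (k + 1) - y (k + 1)‖ with he
  have h1 := h.step_identity hβ hk hS 0
  have h2 := half_residual_add_inner_nonneg hβ k (y := y) (l := l)
  have h3 := hmono _ (h.x_mem k hk) _ hS
  have h4 := sum_inv_le hP (h.y_mem k hk) hSσ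
  have h5 := hρb _ (fun i => (h.y_mem k hk i).le) _ (h.x_mem k hk)
  have h6 : ‖x (k + 1) - xS‖ ≤ (1 + ρ) * (2 + e ^ 2) := by
    have h7 := norm_sub_le_norm_sub_add_norm_sub (x (k + 1)) (y (k + 1)) xS
    have h8 : e ≤ 1 + e ^ 2 := by nlinarith [sq_nonneg (e - 1)]
    have he0 : 0 ≤ e := norm_nonneg _
    calc ‖x (k + 1) - xS‖ ≤ e + ρ * (1 + e) := by linarith
      _ ≤ (1 + ρ) * (1 + e) := by linarith
      _ ≤ _ := by gcongr ?_ * ?_; linarith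
  have h7 : -(‖P.F xS‖ * ((1 + ρ) * (2 + e ^ 2))) ≤ ⟪P.F xS, x (k + 1) - xS⟫_ℝ := by
    have h8 := (abs_le.1 (abs_real_inner_le_norm (P.F xS) (x (k + 1) - xS))).1
    have h9 : ‖P.F xS‖ * ‖x (k + 1) - xS‖ ≤ ‖P.F xS‖ * ((1 + ρ) * (2 + e ^ 2)) := by gcongr
    linarith
  rw [real_inner_comm, inner_sub_left] at h3
  have h8 : σ * (μ * ∑ i, (-(P.φ i (y (k + 1))))⁻¹) ≤ m * μ₀ + ⟪l (k + 1), y (k + 1) - xS⟫_ℝ := by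
    rw [h.l_eq k hk, inner_smul_left, conj_trivial]
    have := mul_le_mul_of_nonneg_left h4 hμ.le
    have : (m : ℝ) * μ ≤ m * μ₀ := by gcongr
    linarith
  simp only [add_zero, sub_zero] at h1
  linarith

/-- A quantity whose sum telescopes up to summable terms cannot exceed its mean at every step. -/
lemma exists_le_of_telescoping {N : ℕ} {u r d : ℕ → ℝ} {q c C : ℝ}
    (hstep : ∀ j < N, u j ≤ q + 1 / 2 * (d j - d (j + 1)) + c * r j) (hd : 0 ≤ d N)
    (hsum : 1 / 2 * d 0 + c * ∑ j ∈ Finset.range N, r j ≤ C) (hC : C < N) :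
    ∃ j < N, u j ≤ q + 1 := by
  by_contra! hcon
  have h1 : (N : ℝ) * (q + 1) ≤ ∑ j ∈ Finset.range N, u j := by
    calc (N : ℝ) * (q + 1) = ∑ j ∈ Finset.range N, (q + 1) := by simp [mul_add]
      _ ≤ _ := Finset.sum_le_sum fun j hj => (hcon j (Finset.mem_range.1 hj)).le
  have h2 := Finset.sum_le_sum fun j hj => hstep j (Finset.mem_range.1 hj)
  have h3 : ∑ j ∈ Finset.range N, (q + 1 / 2 * (d j - d (j + 1)) + c * r j)
      = N * q + 1 / 2 * (d 0 - d N) + c * ∑ j ∈ Finset.range N, r j := by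
    rw [Finset.sum_add_distrib, Finset.sum_add_distrib, ← Finset.mul_sum, ← Finset.mul_sum,
      Finset.sum_range_sub']
    simp
  linarith

/-- A long enough inner loop visits a bounded region that does not depend on its starting point. -/
lemma IsWellPosed.exists_bounded_iterate {L : ℝ} (h : P.IsWellPosed L) (hβ : 0 < β) {μ₀ : ℝ}
    (hμ₀ : 0 < μ₀) :
    ∃ D : ℝ, ∀ E : ℝ, ∃ N : ℕ, ∀ K > N, ∀ μ, 0 < μ → μ ≤ μ₀ →
      ∀ x y l : ℕ → EuclideanSpace ℝ (Fin n), P.IsInnerRun μ β K x y l →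
      ‖y 0‖ ≤ E → ‖l 0‖ ≤ E → ∃ k ≤ K, ‖y k‖ ≤ D ∧ ‖l k‖ ≤ D := by
  have hP := h.regular
  obtain ⟨xS, hS, σ, hσ, hSσ⟩ := hP.exists_slater
  have hSf : xS ∈ P.feasible := mem_feasible hS fun i => by linarith [hSσ i]
  obtain ⟨ρ, hρ, hρb⟩ := exists_norm_sub_le hP hSf
  obtain ⟨W, hW, hWb⟩ := h.exists_central_bound μ₀
  set f : ℝ := ‖P.F xS‖ * (1 + ρ) with hf
  have hf0 : 0 ≤ f := by positivity
  -- over a long loop, the mean of `σ μ ∑ (-φᵢ(y))⁻¹ + ‖x - y‖²` is below `q`, by `slater_step`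
  set q : ℝ := m * μ₀ + 2 * f + 1 with hq
  have hq0 : 0 < q := by positivity
  obtain ⟨G, hG, hGb⟩ := exists_norm_gradient_le hP xS (ρ * (2 + q))
  refine ⟨max (‖xS‖ + ρ * (2 + q)) (G * (q / σ)), fun E => ?_⟩
  set E₁ : ℝ := W + (β + 1 / β) * (E + W) with hE₁
  set C : ℝ := 1 / 2 * (1 / β * E₁ ^ 2 + β * (E₁ + ‖xS‖) ^ 2)
    + (f + 1) / β * (1 / β * (E + W) ^ 2 + β * (E + W) ^ 2) with hC
  obtain ⟨N, hN⟩ := exists_nat_gt C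
  refine ⟨N + 1, fun K hK μ hμ hμμ₀ x y l hr hy0 hl0 => ?_⟩
  obtain ⟨xμ, hx⟩ := exists_isStationary hP h.L_pos h.mono h.lip hμ
  have hWx := hWb μ hμ hμμ₀ xμ hx
  have hΔ0 : Delta β (y 0) (l 0) xμ (μ • P.barrierGrad xμ)
      ≤ 1 / β * (E + W) ^ 2 + β * (E + W) ^ 2 := by
    refine Delta_le_of_norm_le hβ ((norm_sub_le _ _).trans ?_) ((norm_sub_le _ _).trans ?_) <;>
    linarith
  have h1b := hr.norm_le_of_norm_le hP hβ hμ h.mono hx hWx (zero_le_one) (by omega : 1 ≤ K)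
    ⟨hy0, hl0⟩
  have hN1 : Delta β (y 1) (l 1) xS 0 ≤ 1 / β * E₁ ^ 2 + β * (E₁ + ‖xS‖) ^ 2 :=
    Delta_le_of_norm_le hβ ((norm_sub_le _ _).trans (by linarith [h1b.1]))
      (by rw [sub_zero]; exact h1b.2)
  obtain ⟨K', rfl⟩ : ∃ K', K = K' + 1 := ⟨K - 1, by omega⟩
  have hsum : 1 / 2 * Delta β (y 1) (l 1) xS 0
      + (f + 1) / β * ∑ j ∈ Finset.range K', residual β y l (j + 1) ≤ C := by
    have h3 := (hr.sum_residual_le hP hβ hμ h.mono hx (k := K') le_rfl).trans hΔ0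
    rw [hC]
    gcongr
  obtain ⟨j, hj, hjq⟩ := exists_le_of_telescoping
    (u := fun j => σ * (μ * ∑ i, (-(P.φ i (y (j + 2))))⁻¹) + ‖x (j + 2) - y (j + 2)‖ ^ 2)
    (d := fun j => Delta β (y (j + 1)) (l (j + 1)) xS 0) (q := m * μ₀ + 2 * f)
    (fun j hj => by
      have h1 := hr.slater_step hP hβ hμ hμμ₀ h.mono hS hSσ hρ hρb (k := j + 1) (by omega)
      have h2 := (hr.norm_le_residual hβ (k := j + 1) (by omega)).1
      have h3 : (f + 1) * ‖x (j + 2) - y (j + 2)‖ ^ 2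
          ≤ (f + 1) / β * residual β y l (j + 1) := by
        rw [div_mul_eq_mul_div, le_div_iff₀ hβ, mul_assoc, mul_comm _ β]
        exact mul_le_mul_of_nonneg_left h2 (by positivity)
      rw [← hf] at h1
      linarith) (Delta_nonneg hβ _ _ _ _) hsum
    (hN.trans (by exact_mod_cast (by omega : N < K')))
  rw [← hq] at hjq
  generalize hs : μ * ∑ i, (-(P.φ i (y (j + 2))))⁻¹ = s at hjq
  generalize he : ‖x (j + 2) - y (j + 2)‖ = e at hjq
  have hys : y (j + 2) ∈ P.strictSet := hr.y_mem (j + 1) (by omega)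
  have hs0 : 0 ≤ s := hs ▸ mul_nonneg hμ.le
    (Finset.sum_nonneg fun i _ => (inv_pos.2 (by linarith [hys i])).le)
  have hsσ := mul_nonneg hσ.le hs0
  have he1 : e ≤ 1 + q := by
    have h1 := sq_nonneg (e - 1)
    rw [sub_sq] at h1
    linarith
  have hs1 : s ≤ q / σ := by
    rw [le_div_iff₀' hσ]; linarith [sq_nonneg e]
  have hyS : ‖y (j + 2) - xS‖ ≤ ρ * (2 + q) := by
    refine (hρb _ (fun i => (hys i).le) _ (hr.x_mem (j + 1) (by omega))).trans ?_
    rw [he]; exact mul_le_mul_of_nonneg_left (by linarith) hρ.le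
  refine ⟨j + 2, by omega, le_trans ?_ (le_max_left _ _), le_trans ?_ (le_max_right _ _)⟩
  · have := norm_le_norm_add_norm_sub' (y (j + 2)) xS
    linarith
  · rw [hr.l_eq (j + 1) (by omega), norm_smul, Real.norm_of_nonneg hμ.le]
    calc μ * ‖P.barrierGrad (y (j + 2))‖ ≤ μ * (G * ∑ i, (-(P.φ i (y (j + 2))))⁻¹) := by
          gcongr; exact norm_barrierGrad_le hys (hGb _ hyS)
      _ = G * s := by rw [← hs]; ring
      _ ≤ _ := by gcongr

lemma muSeq_pos {μ₀ δ : ℝ} (hμ₀ : 0 < μ₀) (hδ₀ : 0 < δ) (t : ℕ) : 0 < muSeq μ₀ δ t := by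
  unfold muSeq; positivity

lemma muSeq_le {μ₀ δ : ℝ} (hμ₀ : 0 < μ₀) (hδ₀ : 0 < δ) (hδ₁ : δ < 1) (t : ℕ) :
    muSeq μ₀ δ t ≤ μ₀ :=
  mul_le_of_le_one_right hμ₀.le (pow_le_one₀ hδ₀.le hδ₁.le)

/-- If the inner loops are long enough, all the iterates of all the outer steps stay in one bounded
set: each inner loop visits a fixed bounded region, and from then on the monotonicity of `Delta`
bounds its iterates, in particular the starting point of the next loop. -/
lemma IsWellPosed.exists_uniform_bound {L : ℝ} (h : P.IsWellPosed L) (hβ : 0 < β) {μ₀ δ : ℝ}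
    (hμ₀ : 0 < μ₀) (hδ₀ : 0 < δ) (hδ₁ : δ < 1) (y₀ l₀ : EuclideanSpace ℝ (Fin n)) :
    ∃ Λ : ℝ, 0 < Λ ∧ ∃ N : ℕ, ∀ K > N, ∀ T, ∀ x y l : ℕ → ℕ → EuclideanSpace ℝ (Fin n),
      P.IsRun β δ μ₀ T K y₀ l₀ x y l → ∀ t < T, ∀ k ≤ K, ‖y t k‖ ≤ Λ ∧ ‖l t k‖ ≤ Λ := by
  have hP := h.regular
  obtain ⟨W, hW, hWb⟩ := h.exists_central_bound μ₀
  obtain ⟨D, hD⟩ := h.exists_bounded_iterate hβ hμ₀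
  set E : ℝ := max (W + (β + 1 / β) * (D + W)) (max ‖y₀‖ ‖l₀‖) with hE
  have hE0 : 0 ≤ E := (norm_nonneg y₀).trans ((le_max_left _ _).trans (le_max_right _ _))
  obtain ⟨N, hN⟩ := hD E
  refine ⟨W + (β + 1 / β) * (E + W), by positivity, N, fun K hK T x y l hr => ?_⟩
  have hstart : ∀ t < T, ‖y t 0‖ ≤ E ∧ ‖l t 0‖ ≤ E := by
    intro t
    induction t with
    | zero =>
      intro _
      rw [hr.init_y, hr.init_l]
      exact ⟨(le_max_left _ _).trans (le_max_right _ _), (le_max_right _ _).trans (le_max_right _ _)⟩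
    | succ t ih =>
      intro ht
      have hμ := muSeq_pos hμ₀ hδ₀ t
      have hμ' := muSeq_le hμ₀ hδ₀ hδ₁ t
      have hi := hr.isInnerRun hP hβ (show t < T by omega)
      obtain ⟨xμ, hx⟩ := exists_isStationary hP h.L_pos h.mono h.lip hμ
      obtain ⟨h1, h2⟩ := ih (by omega)
      obtain ⟨k, hk, hkD⟩ := hN K hK _ hμ hμ' _ _ _ hi h1 h2
      have h3 := hi.norm_le_of_norm_le hP hβ hμ h.mono hx (hWb _ hμ hμ' xμ hx) hk le_rfl hkD
      rw [hr.warm_y t ht, hr.warm_l t ht]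
      exact ⟨h3.1.trans (le_max_left _ _), h3.2.trans (le_max_left _ _)⟩
  intro t ht k hk
  have hμ := muSeq_pos hμ₀ hδ₀ t
  obtain ⟨xμ, hx⟩ := exists_isStationary hP h.L_pos h.mono h.lip hμ
  exact (hr.isInnerRun hP hβ ht).norm_le_of_norm_le hP hβ hμ h.mono hx
    (hWb _ hμ (muSeq_le hμ₀ hδ₀ hδ₁ t) xμ hx) (zero_le) hk (hstart t ht)

end

/-! ### Error bounds near the feasible set -/

section

variable {n m p : ℕ} {P : CVI n m p} {z xS xs : EuclideanSpace ℝ (Fin n)} {μ β L a b : ℝ} {K : ℕ}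
  {x y l : ℕ → EuclideanSpace ℝ (Fin n)}

lemma IsEnlargement.feasible_subset {S : Set (EuclideanSpace ℝ (Fin n))} (h : P.IsEnlargement S) :
    P.feasible ⊆ S := by
  rintro u ⟨h1, h2⟩
  rcases h with ⟨r, hr, rfl⟩ | ⟨s, hs, rfl⟩
  · exact ⟨fun i => (h1 i).trans hr.le, h2⟩
  · exact ⟨h1, by rw [h2, sub_self, norm_zero]; exact hs.le⟩

/-- The angle condition, used on the feasible set only and cleared of its denominator. -/
lemma mul_norm_le_of_isGLB {S : Set (EuclideanSpace ℝ (Fin n))}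
    {G : EuclideanSpace ℝ (Fin n) → EuclideanSpace ℝ (Fin n)} (hS : P.IsEnlargement S)
    (h : IsGLB ((fun x => ⟪G x, x - xs⟫_ℝ / ‖x - xs‖) '' (S \ {xs})) a) :
    ∀ u ∈ P.feasible, a * ‖u - xs‖ ≤ ⟪G u, u - xs⟫_ℝ := by
  intro u hu
  by_cases hux : u = xs
  · simp [hux]
  · have h1 := h.1 (mem_image_of_mem _ (⟨hS.feasible_subset hu, hux⟩ : u ∈ S \ {xs}))
    exact (le_div_iff₀ (norm_pos_iff.2 (sub_ne_zero.2 hux))).1 h1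

/-- A point of the affine constraints is no farther from the feasible set than a multiple of its
distance from `{φ ≤ 0}`: it is enough to move towards a Slater point. -/
lemma exists_feasible_near (hP : P.Regular) (ρ : ℝ) :
    ∃ H : ℝ, 0 ≤ H ∧ ∀ u ∈ P.eqSet, ‖u‖ ≤ ρ → ∀ v, (∀ i, P.φ i v ≤ 0) →
      ∃ w ∈ P.feasible, ‖w - u‖ ≤ H * ‖u - v‖ := by
  obtain ⟨xS, hS, σ, hσ, hSσ⟩ := hP.exists_slater
  obtain ⟨G, hG, hGb⟩ := exists_norm_gradient_le hP 0 ρ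
  refine ⟨G / σ * |ρ + ‖xS‖|, by positivity, fun u hu huρ v hv => ?_⟩
  set t : ℝ := G * ‖u - v‖ with ht
  have ht0 : 0 ≤ t := by positivity
  have htσ : 0 < t + σ := by positivity
  have hφ : ∀ i, P.φ i u ≤ t := by
    intro i
    have h1 := hP.gradient_le i u v
    have h2 := (abs_le.1 (abs_real_inner_le_norm (gradient (P.φ i) u) (v - u))).1
    have h3 : ‖gradient (P.φ i) u‖ * ‖v - u‖ ≤ t := by
      rw [ht, norm_sub_rev v u]
      gcongr
      exact hGb u (by simpa using huρ) i
    linarith [hv i]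
  refine ⟨u + (t / (t + σ)) • (xS - u), mem_feasible (add_smul_mem_eqSet hu hu hS _) fun i => ?_, ?_⟩
  · have h1 : u + (t / (t + σ)) • (xS - u) = (σ / (t + σ)) • u + (t / (t + σ)) • xS := by
      match_scalars <;> field_simp
      ring
    rw [h1]
    have h2 := (hP.convex i).2 (mem_univ u) (mem_univ xS) (show 0 ≤ σ / (t + σ) by positivity)
      (show 0 ≤ t / (t + σ) by positivity) (by field_simp; ring)
    refine h2.trans ?_
    simp only [smul_eq_mul]
    have h3 : σ / (t + σ) * P.φ i u ≤ σ / (t + σ) * t := by gcongr; exact hφ i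
    have h4 : t / (t + σ) * P.φ i xS ≤ t / (t + σ) * (-σ) := by gcongr; exact hSσ i
    have h5 : σ / (t + σ) * t + t / (t + σ) * (-σ) = 0 := by ring
    linarith
  · rw [add_sub_cancel_left, norm_smul, Real.norm_of_nonneg (by positivity)]
    have h1 : t / (t + σ) ≤ t / σ := by gcongr; linarith
    have h2 : ‖xS - u‖ ≤ |ρ + ‖xS‖| :=
      ((norm_sub_le _ _).trans (by linarith)).trans (le_abs_self _)
    calc t / (t + σ) * ‖xS - u‖ ≤ t / σ * |ρ + ‖xS‖| := by gcongr
      _ = _ := by rw [ht]; ring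

/-- The angle condition at `x` itself bounds the distance to `xs`, up to infeasibility. -/
lemma IsWellPosed.exists_norm_le_last (h : P.IsWellPosed L) (hxs : xs ∈ P.feasible) (ha : 0 < a)
    (hsharp : ∀ u ∈ P.feasible, a * ‖u - xs‖ ≤ ⟪P.F u, u - xs⟫_ℝ) (ρ : ℝ) :
    ∃ C : ℝ, 0 ≤ C ∧ ∀ u ∈ P.eqSet, ‖u‖ ≤ ρ → ∀ v, (∀ i, P.φ i v ≤ 0) →
      a * ‖u - xs‖ ≤ ⟪P.F u, u - xs⟫_ℝ + C * ‖u - v‖ := by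
  obtain ⟨W, hW, hWb⟩ := h.regular.exists_norm_le
  obtain ⟨H, hH, hHb⟩ := exists_feasible_near h.regular ρ
  have hL := h.L_pos
  refine ⟨(a + L * (W + ‖xs‖) + (‖P.F xs‖ + L * (|ρ| + ‖xs‖))) * H, by positivity,
    fun u hu huρ v hv => ?_⟩
  obtain ⟨w, hw, hwu⟩ := hHb u hu huρ v hv
  have h1 := hsharp w hw
  have h2 : a * ‖u - xs‖ ≤ a * ‖w - xs‖ + a * ‖w - u‖ := by
    rw [← mul_add]
    gcongr
    have := norm_sub_le_norm_sub_add_norm_sub u w xs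
    rw [norm_sub_rev u w] at this
    linarith
  have h3 : ⟪P.F w, w - xs⟫_ℝ = ⟪P.F u, u - xs⟫_ℝ + ⟪P.F w - P.F u, w - xs⟫_ℝ
      + ⟪P.F u, w - u⟫_ℝ := by
    simp only [inner_sub_left, inner_sub_right]; ring
  have h4 : ⟪P.F w - P.F u, w - xs⟫_ℝ ≤ L * ‖w - u‖ * (W + ‖xs‖) := by
    refine (real_inner_le_norm _ _).trans ?_
    gcongr
    · exact h.lip _ hw.2 _ hu
    · exact (norm_sub_le _ _).trans (by gcongr; exact hWb w hw)
  have h5 : ‖P.F u‖ ≤ ‖P.F xs‖ + L * (|ρ| + ‖xs‖) := by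
    have h6 := norm_le_norm_add_norm_sub' (P.F u) (P.F xs)
    have h7 := h.lip u hu xs hxs.2
    have h8 : ‖u - xs‖ ≤ |ρ| + ‖xs‖ := (norm_sub_le _ _).trans (by
      gcongr; exact huρ.trans (le_abs_self _))
    have h9 : L * ‖u - xs‖ ≤ L * (|ρ| + ‖xs‖) := by gcongr
    linarith
  have h6 : ⟪P.F u, w - u⟫_ℝ ≤ (‖P.F xs‖ + L * (|ρ| + ‖xs‖)) * ‖w - u‖ :=
    (real_inner_le_norm _ _).trans (by gcongr)
  have h7 : (a + L * (W + ‖xs‖) + (‖P.F xs‖ + L * (|ρ| + ‖xs‖))) * ‖w - u‖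
      ≤ (a + L * (W + ‖xs‖) + (‖P.F xs‖ + L * (|ρ| + ‖xs‖))) * (H * ‖u - v‖) := by gcongr
  linarith

/-- The angle condition at `xs` bounds the distance to `xs`, up to infeasibility. -/
lemma IsWellPosed.exists_norm_le_average (h : P.IsWellPosed L) (hb : 0 < b)
    (hsharp : ∀ u ∈ P.feasible, b * ‖u - xs‖ ≤ ⟪P.F xs, u - xs⟫_ℝ) (ρ : ℝ) :
    ∃ C : ℝ, 0 ≤ C ∧ ∀ u ∈ P.eqSet, ‖u‖ ≤ ρ → ∀ v, (∀ i, P.φ i v ≤ 0) →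
      b * ‖u - xs‖ ≤ ⟪P.F xs, u - xs⟫_ℝ + C * ‖u - v‖ := by
  obtain ⟨H, hH, hHb⟩ := exists_feasible_near h.regular ρ
  refine ⟨(b + ‖P.F xs‖) * H, by positivity, fun u hu huρ v hv => ?_⟩
  obtain ⟨w, hw, hwu⟩ := hHb u hu huρ v hv
  have h1 := hsharp w hw
  have h2 : b * ‖u - xs‖ ≤ b * ‖w - xs‖ + b * ‖w - u‖ := by
    rw [← mul_add]
    gcongr
    have := norm_sub_le_norm_sub_add_norm_sub u w xs
    rw [norm_sub_rev u w] at this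
    linarith
  have h3 : ⟪P.F xs, w - xs⟫_ℝ = ⟪P.F xs, u - xs⟫_ℝ + ⟪P.F xs, w - u⟫_ℝ := by
    rw [← inner_add_right]; congr 1; abel
  have h6 : ⟪P.F xs, w - u⟫_ℝ ≤ ‖P.F xs‖ * ‖w - u‖ := real_inner_le_norm _ _
  have h7 : (b + ‖P.F xs‖) * ‖w - u‖ ≤ (b + ‖P.F xs‖) * (H * ‖u - v‖) := by gcongr
  linarith

/-! ### The gap function -/

lemma IsWellPosed.norm_F_le_opBound (h : P.IsWellPosed L) (hz : z ∈ P.feasible) :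
    ‖P.F z‖ ≤ P.opBound := by
  have hF := ((continuousOn_F h.lip).mono feasible_subset).norm
  exact le_csSup (h.regular.compact.image_of_continuousOn hF).bddAbove (mem_image_of_mem _ hz)

lemma IsWellPosed.norm_sub_le_radius (h : P.IsWellPosed L) (hz : z ∈ P.feasible) :
    ‖xs - z‖ ≤ P.radius xs :=
  le_csSup (h.regular.compact.image_of_continuousOn (by fun_prop)).bddAbove (mem_image_of_mem _ hz)

lemma IsWellPosed.gap_le (h : P.IsWellPosed L) (hxs : P.IsSolution xs)
    {u : EuclideanSpace ℝ (Fin n)} (hu : u ∈ P.eqSet) :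
    P.gap P.feasible u ≤ (L * (‖u - xs‖ + P.radius xs) + P.opBound) * ‖u - xs‖ := by
  have hL := h.L_pos
  refine csSup_le (Set.Nonempty.image _ ⟨xs, hxs.1⟩) ?_
  rintro _ ⟨z, hz, rfl⟩
  have h1 := hxs.2 z hz
  have h2 : ⟪P.F u, u - z⟫_ℝ = ⟪P.F u - P.F xs, u - z⟫_ℝ + ⟪P.F xs, u - xs⟫_ℝ
      - ⟪P.F xs, z - xs⟫_ℝ := by
    simp only [inner_sub_left, inner_sub_right]; ring
  have h3 : ⟪P.F u - P.F xs, u - z⟫_ℝ ≤ L * ‖u - xs‖ * (‖u - xs‖ + P.radius xs) := by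
    refine (real_inner_le_norm _ _).trans ?_
    gcongr
    · exact h.lip u hu xs hxs.1.2
    · refine (norm_sub_le_norm_sub_add_norm_sub u xs z).trans ?_
      gcongr
      exact h.norm_sub_le_radius hz
  have h4 : ⟪P.F xs, u - xs⟫_ℝ ≤ P.opBound * ‖u - xs‖ :=
    (real_inner_le_norm _ _).trans (by gcongr; exact h.norm_F_le_opBound hxs.1)
  simp only
  linarith

/-! ### Rates after logarithmically many outer steps -/

/-- After `log K / log (1/δ)` outer steps the barrier parameter is `O(1/K)`. -/
lemma muSeq_le_div {μ₀ δ : ℝ} (hμ₀ : 0 < μ₀) (hδ₀ : 0 < δ) (hδ₁ : δ < 1) {K t : ℕ} (hK : 0 < K)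
    (ht : 1 / Real.log (1 / δ) * Real.log K ≤ t) : muSeq μ₀ δ t ≤ μ₀ / K := by
  have hK' : (0 : ℝ) < K := by exact_mod_cast hK
  have hlog : 0 < Real.log (1 / δ) := Real.log_pos (by rw [lt_div_iff₀ hδ₀]; linarith)
  have h1 : Real.log K ≤ t * Real.log (1 / δ) := by
    rw [one_div_mul_eq_div, div_le_iff₀ hlog] at ht
    exact ht
  have h2 : (K : ℝ) ≤ (1 / δ) ^ t := by
    rw [← Real.log_le_log_iff hK' (by positivity), Real.log_pow]
    exact h1
  have h3 : δ ^ t ≤ 1 / K := by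
    rw [le_div_iff₀ hK']
    calc δ ^ t * K ≤ δ ^ t * (1 / δ) ^ t := by gcongr
      _ = 1 := by rw [← mul_pow, mul_one_div_cancel hδ₀.ne', one_pow]
  rw [muSeq, div_eq_mul_one_div]
  gcongr
  exact (pow_le_pow_of_le_one hδ₀.le hδ₁.le (Nat.le_succ t)).trans h3

lemma IsInnerRun.norm_x_le (h : P.IsInnerRun μ β K x y l) (hβ : 0 < β) {Λ : ℝ}
    (hΛ : ∀ k ≤ K, ‖y k‖ ≤ Λ ∧ ‖l k‖ ≤ Λ) {k : ℕ} (hk : k < K) :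
    ‖x (k + 1)‖ ≤ Λ + 1 / β * (Λ + Λ) := by
  rw [h.x_eq hβ hk]
  refine (norm_add_le _ _).trans ?_
  rw [norm_smul, Real.norm_of_nonneg (by positivity)]
  gcongr
  · exact (hΛ _ hk).1
  · exact (norm_sub_le _ _).trans (add_le_add (hΛ _ hk).2 (hΛ _ hk.le).2)

/-- The multiplier `μ ∇B(y)` is almost a normal vector of the feasible set. -/
lemma IsInnerRun.neg_inner_l_le (h : P.IsInnerRun μ β K x y l) (hP : P.Regular) (hμ : 0 < μ)
    (hz : z ∈ P.feasible) {k : ℕ} (hk : k < K) :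
    -⟪l (k + 1), y (k + 1) - z⟫_ℝ ≤ m * μ := by
  have h1 := inner_barrierGrad_le hP (h.y_mem k hk) hz.1
  rw [h.l_eq k hk, ← inner_neg_right, neg_sub, inner_smul_left, conj_trivial, mul_comm]
  gcongr

/-- The last inner iterate satisfies the variational inequality at `xs` up to `O(1/√K) + m μ`,
and is within `O(1/√K)` of `{φ ≤ 0}`. -/
lemma IsInnerRun.last_estimate (h : P.IsInnerRun μ β K x y l) (hw : P.IsWellPosed L) (hβ : 0 < β)
    (hμ : 0 < μ) {xμ : EuclideanSpace ℝ (Fin n)} (hx : P.IsStationary μ xμ)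
    (hxs : xs ∈ P.feasible) {E : ℝ} (hE : Delta β (y 0) (l 0) xμ (μ • P.barrierGrad xμ) ≤ E)
    {Λ : ℝ} (hΛ : ∀ k ≤ K, ‖y k‖ ≤ Λ ∧ ‖l k‖ ≤ Λ) (hK : 2 ≤ K) :
    ‖x K - y K‖ ≤ √(2 * E / β) / √K ∧
    ⟪P.F (x K), x K - xs⟫_ℝ ≤ m * μ
      + (Λ + β * (Λ + 1 / β * (Λ + Λ) + ‖xs‖)) * (√(2 * E / β) / √K) := by
  have hP := hw.regular
  obtain ⟨j, rfl⟩ : ∃ j, K = j + 2 := ⟨K - 2, by omega⟩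
  have hr := h.residual_le hP hβ hμ hw.mono hx (k := j) (by omega)
  obtain ⟨h1, h2⟩ := h.norm_le_residual hβ (k := j + 1) (by omega)
  have hres : residual β y l (j + 1) ≤ 2 * E / ((j + 2 : ℕ) : ℝ) := by
    rw [le_div_iff₀ (by positivity)]
    have h3 := residual_nonneg hβ (j + 1) (y := y) (l := l)
    push_cast
    nlinarith
  have hsq : ∀ e : ℝ, β * e ^ 2 ≤ residual β y l (j + 1) → e ≤ √(2 * E / β) / √((j + 2 : ℕ) : ℝ) := by
    intro e he
    rw [← Real.sqrt_div' _ (by positivity)]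
    refine Real.le_sqrt_of_sq_le ?_
    rw [div_right_comm, le_div_iff₀' hβ]
    exact he.trans hres
  have e1 := hsq _ h1
  have e2 := hsq _ h2
  refine ⟨e1, ?_⟩
  have h3 := h.inner_eq (j + 1) (by omega) _ (h.x_mem (j + 1) (by omega)) xs hxs.2
  have h4 := h.neg_inner_l_le hP hμ hxs (k := j + 1) (by omega)
  have hxb := h.norm_x_le hβ hΛ (k := j + 1) (by omega)
  have hΛ0 : 0 ≤ Λ := (norm_nonneg _).trans (hΛ 0 (by omega)).1
  set r := √(2 * E / β) / √((j + 2 : ℕ) : ℝ) with hrdef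
  rw [inner_add_left, inner_add_left, inner_smul_left, conj_trivial] at h3
  have h5 : ⟪l (j + 1 + 1), x (j + 1 + 1) - xs⟫_ℝ = ⟪l (j + 1 + 1), y (j + 1 + 1) - xs⟫_ℝ
      + ⟪l (j + 1 + 1), x (j + 1 + 1) - y (j + 1 + 1)⟫_ℝ := by
    rw [← inner_add_right]; congr 1; abel
  have h6 : -(Λ * r) ≤ ⟪l (j + 1 + 1), x (j + 1 + 1) - y (j + 1 + 1)⟫_ℝ := by
    have h7 := (abs_le.1 (abs_real_inner_le_norm (l (j + 1 + 1))
      (x (j + 1 + 1) - y (j + 1 + 1)))).1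
    have h8 : ‖l (j + 1 + 1)‖ * ‖x (j + 1 + 1) - y (j + 1 + 1)‖ ≤ Λ * r := by
      gcongr
      exact (hΛ _ le_rfl).2
    linarith
  have h9 : -(r * (Λ + 1 / β * (Λ + Λ) + ‖xs‖)) ≤
      ⟪y (j + 1 + 1) - y (j + 1), x (j + 1 + 1) - xs⟫_ℝ := by
    have h7 := (abs_le.1 (abs_real_inner_le_norm (y (j + 1 + 1) - y (j + 1))
      (x (j + 1 + 1) - xs))).1
    have h8 : ‖y (j + 1 + 1) - y (j + 1)‖ * ‖x (j + 1 + 1) - xs‖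
        ≤ r * (Λ + 1 / β * (Λ + Λ) + ‖xs‖) := by
      gcongr
      exact (norm_sub_le _ _).trans (by gcongr)
    linarith
  have h10 := mul_le_mul_of_nonneg_left h9 hβ.le
  show ⟪P.F (x (j + 1 + 1)), x (j + 1 + 1) - xs⟫_ℝ ≤ _
  linarith

/-- An `O(1/√K)` rate for the last iterate, once `μ_t = O(1/K)`. -/
lemma IsWellPosed.last_rate (h : P.IsWellPosed L) (hxs : P.IsSolution xs) (ha : 0 < a)
    (hsharp : ∀ u ∈ P.feasible, a * ‖u - xs‖ ≤ ⟪P.F u, u - xs⟫_ℝ)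
    (hβ : 0 < β) {μ₀ δ : ℝ} (hμ₀ : 0 < μ₀) (hδ₀ : 0 < δ) (hδ₁ : δ < 1)
    (y₀ l₀ : EuclideanSpace ℝ (Fin n)) :
    ∃ (c Q : ℝ) (K₀ : ℕ), ∀ K > K₀, ∀ (T : ℕ) (x y l : ℕ → ℕ → EuclideanSpace ℝ (Fin n)),
      P.IsRun β δ μ₀ T K y₀ l₀ x y l →
      ∀ t < T, c * Real.log K ≤ t →
        ‖x t K - xs‖ ≤ Q / √K ∧ P.gap P.feasible (x t K) ≤ Q / √K := by
  obtain ⟨Λ, hΛ, N, hN⟩ := h.exists_uniform_bound hβ hμ₀ hδ₀ hδ₁ y₀ l₀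
  obtain ⟨W, hW, hWb⟩ := h.exists_central_bound μ₀
  set ρ : ℝ := Λ + 1 / β * (Λ + Λ) with hρ
  obtain ⟨C, hC, hCb⟩ := h.exists_norm_le_last hxs.1 ha hsharp ρ
  set r : ℝ := √(2 * (1 / β * (Λ + W) ^ 2 + β * (Λ + W) ^ 2) / β) with hr
  set Q₁ : ℝ := (m * μ₀ + (Λ + β * (ρ + ‖xs‖)) * r + C * r) / a with hQ₁
  set g : ℝ := L * (ρ + ‖xs‖ + P.radius xs) + P.opBound with hg
  have hL := h.L_pos
  have hρ0 : 0 < ρ := by positivity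
  have hrad : 0 ≤ P.radius xs := (norm_nonneg _).trans (h.norm_sub_le_radius hxs.1)
  have hop : 0 ≤ P.opBound := (norm_nonneg _).trans (h.norm_F_le_opBound hxs.1)
  have hQ₁0 : 0 ≤ Q₁ := by positivity
  have hg0 : 0 ≤ g := by positivity
  refine ⟨1 / Real.log (1 / δ), (1 + g) * Q₁, N + 1, fun K hK T x y l hrun t ht hct => ?_⟩
  have hμ := muSeq_pos hμ₀ hδ₀ t
  have hi := hrun.isInnerRun h.regular hβ ht
  have hb := hN K (by omega) T x y l hrun t ht
  obtain ⟨xμ, hx⟩ := exists_isStationary h.regular h.L_pos h.mono h.lip hμ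
  have hWx := hWb _ hμ (muSeq_le hμ₀ hδ₀ hδ₁ t) xμ hx
  have hΔ : Delta β (y t 0) (l t 0) xμ (muSeq μ₀ δ t • P.barrierGrad xμ)
      ≤ 1 / β * (Λ + W) ^ 2 + β * (Λ + W) ^ 2 := by
    have := hb 0 (by omega)
    refine Delta_le_of_norm_le hβ ((norm_sub_le _ _).trans ?_) ((norm_sub_le _ _).trans ?_) <;>
    linarith
  obtain ⟨e1, e2⟩ := hi.last_estimate h hβ hμ hx hxs.1 hΔ hb (by omega)
  have hK1 : (1 : ℝ) ≤ K := by exact_mod_cast (by omega : 1 ≤ K)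
  have hsK : 0 < √(K : ℝ) := Real.sqrt_pos.2 (by linarith)
  obtain ⟨k, rfl⟩ : ∃ k, K = k + 1 := ⟨K - 1, by omega⟩
  have hxm := hi.x_mem k (by omega)
  have hxb := hi.norm_x_le hβ hb (k := k) (by omega)
  have h1 := hCb _ hxm hxb _ (fun i => (hi.y_mem k (by omega) i).le)
  have h2 : (m : ℝ) * muSeq μ₀ δ t ≤ m * μ₀ / √((k + 1 : ℕ) : ℝ) := by
    rw [mul_div_assoc]
    gcongr
    refine (muSeq_le_div hμ₀ hδ₀ hδ₁ (by omega) hct).trans ?_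
    gcongr
    exact Real.sqrt_le_iff.2 ⟨by linarith, by nlinarith⟩
  have h3 : C * ‖x t (k + 1) - y t (k + 1)‖ ≤ C * (r / √((k + 1 : ℕ) : ℝ)) := by gcongr
  have h4 : ‖x t (k + 1) - xs‖ ≤ Q₁ / √((k + 1 : ℕ) : ℝ) := by
    rw [hQ₁, div_div, mul_comm a, ← div_div, le_div_iff₀' ha]
    have : (m * μ₀ + (Λ + β * (ρ + ‖xs‖)) * r + C * r) / √((k + 1 : ℕ) : ℝ)
      = m * μ₀ / √((k + 1 : ℕ) : ℝ) + (Λ + β * (ρ + ‖xs‖)) * (r / √((k + 1 : ℕ) : ℝ))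
        + C * (r / √((k + 1 : ℕ) : ℝ)) := by ring
    rw [this]
    linarith
  constructor
  · refine h4.trans ?_
    gcongr
    nlinarith
  · refine (h.gap_le hxs hxm).trans ?_
    have h5 : ‖x t (k + 1) - xs‖ ≤ ρ + ‖xs‖ := (norm_sub_le _ _).trans (by gcongr)
    calc (L * (‖x t (k + 1) - xs‖ + P.radius xs) + P.opBound) * ‖x t (k + 1) - xs‖
        ≤ g * (Q₁ / √((k + 1 : ℕ) : ℝ)) := by rw [hg]; gcongr
      _ = g * Q₁ / √((k + 1 : ℕ) : ℝ) := by ring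
      _ ≤ _ := by gcongr; linarith

end

/-! ### The averaged iterates -/

section

variable {n m p : ℕ} {P : CVI n m p} {xs : EuclideanSpace ℝ (Fin n)} {μ β L a b : ℝ} {K : ℕ}
  {x y l : ℕ → EuclideanSpace ℝ (Fin n)}

lemma average_eq (K : ℕ) (x : ℕ → EuclideanSpace ℝ (Fin n)) :
    average K x = (1 / (K : ℝ)) • ∑ k ∈ Finset.range K, x (k + 1) := by
  rw [average]
  congr 1
  rw [Finset.range_eq_Ico, Finset.sum_Ico_add' x 0 K 1]
  rfl

lemma average_mem {U : Set (EuclideanSpace ℝ (Fin n))} (hU : Convex ℝ U) (hK : 0 < K)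
    (h : ∀ k < K, x (k + 1) ∈ U) : average K x ∈ U := by
  have hK' : (0 : ℝ) < K := by exact_mod_cast hK
  rw [average_eq, Finset.smul_sum]
  refine hU.sum_mem (fun _ _ => by positivity) ?_ fun k hk => h k (Finset.mem_range.1 hk)
  simp [hK'.ne']

lemma convex_eqSet : Convex ℝ P.eqSet := fun x hx y hy a b _ _ hab => by
  show Matrix.toEuclideanLin P.A (a • x + b • y) = P.d
  rw [map_add, map_smul, map_smul, show Matrix.toEuclideanLin P.A x = P.d from hx,
    show Matrix.toEuclideanLin P.A y = P.d from hy, ← add_smul, hab, one_smul]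

lemma norm_average_sub_le (hK : 0 < K) {c : EuclideanSpace ℝ (Fin n)} :
    ‖average K x - c‖ ≤ 1 / K * ∑ k ∈ Finset.range K, ‖x (k + 1) - c‖ := by
  have hK' : (0 : ℝ) < K := by exact_mod_cast hK
  have h1 : average K x - c = (1 / (K : ℝ)) • ∑ k ∈ Finset.range K, (x (k + 1) - c) := by
    rw [average_eq, Finset.sum_sub_distrib, smul_sub]
    congr 1
    simp only [Finset.sum_const, Finset.card_range]
    rw [← Nat.cast_smul_eq_nsmul ℝ, smul_smul, one_div_mul_cancel hK'.ne', one_smul]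
  rw [h1, norm_smul, Real.norm_of_nonneg (by positivity)]
  gcongr
  exact norm_sum_le _ _

lemma inner_average_sub (hK : 0 < K) (g c : EuclideanSpace ℝ (Fin n)) :
    ⟪g, average K x - c⟫_ℝ = 1 / K * ∑ k ∈ Finset.range K, ⟪g, x (k + 1) - c⟫_ℝ := by
  have hK' : (0 : ℝ) < K := by exact_mod_cast hK
  simp only [inner_sub_right, average_eq, inner_smul_right, inner_sum, Finset.sum_sub_distrib,
    Finset.sum_const, Finset.card_range, nsmul_eq_mul, mul_sub]
  rw [← mul_assoc (1 / (K : ℝ)), one_div_mul_cancel hK'.ne', one_mul]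

/-- The energy identity, summed against `xs` and the multiplier `0`: the averaged iterate satisfies
the variational inequality at `xs` up to `O(1/K) + m μ`. -/
lemma IsInnerRun.inner_average_le (h : P.IsInnerRun μ β K x y l) (hw : P.IsWellPosed L)
    (hβ : 0 < β) (hμ : 0 < μ) (hxs : xs ∈ P.feasible) (hK : 0 < K) :
    ⟪P.F xs, average K x - xs⟫_ℝ ≤ m * μ + 1 / 2 * Delta β (y 0) (l 0) xs 0 / K := by
  have hK' : (0 : ℝ) < K := by exact_mod_cast hK
  have hstep : ∀ k < K, ⟪P.F xs, x (k + 1) - xs⟫_ℝ ≤ m * μ + 1 / 2 *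
      (Delta β (y k) (l k) xs 0 - Delta β (y (k + 1)) (l (k + 1)) xs 0) := by
    intro k hk
    have h1 := h.step_identity hβ hk hxs.2 0
    have h2 := half_residual_add_inner_nonneg hβ k (y := y) (l := l)
    have h3 := hw.mono _ (h.x_mem k hk) _ hxs.2
    have h4 := h.neg_inner_l_le hw.regular hμ hxs hk
    rw [real_inner_comm, inner_sub_left] at h3
    simp only [add_zero, sub_zero] at h1
    linarith
  have h1 := Finset.sum_le_sum fun k hk => hstep k (Finset.mem_range.1 hk)
  rw [Finset.sum_add_distrib, Finset.sum_const, Finset.card_range, nsmul_eq_mul,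
    ← Finset.mul_sum, Finset.sum_range_sub' (fun k => Delta β (y k) (l k) xs 0)] at h1
  have h2 := Delta_nonneg hβ (y K) (l K) xs 0
  rw [inner_average_sub hK, one_div_mul_eq_div, div_le_iff₀ hK', add_mul, div_mul_cancel₀ _ hK'.ne']
  linarith

/-- The sum of the multiplier updates telescopes, so the two averages differ by `O(1/K)`. -/
lemma IsInnerRun.average_sub_average (h : P.IsInnerRun μ β K x y l) (hβ : 0 < β) :
    average K x - average K y = (1 / (K * β)) • (l K - l 0) := by
  have h1 : ∑ k ∈ Finset.range K, (x (k + 1) - y (k + 1)) = (1 / β) • (l K - l 0) := by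
    rw [← Finset.sum_range_sub l K, Finset.smul_sum]
    refine Finset.sum_congr rfl fun k hk => ?_
    rw [h.x_eq hβ (Finset.mem_range.1 hk), add_sub_cancel_left]
  rw [average_eq, average_eq, ← smul_sub, ← Finset.sum_sub_distrib, h1, smul_smul,
    one_div_mul_one_div]

/-- An `O(1/K)` rate for the averaged iterate, once `μ_t = O(1/K)`. -/
lemma IsWellPosed.average_rate (h : P.IsWellPosed L) (hxs : P.IsSolution xs) (hb : 0 < b)
    (hsharp : ∀ u ∈ P.feasible, b * ‖u - xs‖ ≤ ⟪P.F xs, u - xs⟫_ℝ)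
    (hβ : 0 < β) {μ₀ δ : ℝ} (hμ₀ : 0 < μ₀) (hδ₀ : 0 < δ) (hδ₁ : δ < 1)
    (y₀ l₀ : EuclideanSpace ℝ (Fin n)) :
    ∃ (c Q : ℝ) (K₀ : ℕ), ∀ K > K₀, ∀ (T : ℕ) (x y l : ℕ → ℕ → EuclideanSpace ℝ (Fin n)),
      P.IsRun β δ μ₀ T K y₀ l₀ x y l →
      ∀ t < T, c * Real.log K ≤ t →
        ‖average K (x t) - xs‖ ≤ Q / K ∧ P.gap P.feasible (average K (x t)) ≤ Q / K := by
  obtain ⟨Λ, hΛ, N, hN⟩ := h.exists_uniform_bound hβ hμ₀ hδ₀ hδ₁ y₀ l₀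
  set ρ : ℝ := Λ + 1 / β * (Λ + Λ) with hρ
  obtain ⟨C, hC, hCb⟩ := h.exists_norm_le_average hb hsharp ρ
  set E : ℝ := 1 / 2 * (1 / β * Λ ^ 2 + β * (Λ + ‖xs‖) ^ 2) with hE
  set Q₁ : ℝ := (m * μ₀ + E + C * (1 / β * (Λ + Λ))) / b with hQ₁
  set g : ℝ := L * (ρ + ‖xs‖ + P.radius xs) + P.opBound with hg
  have hL := h.L_pos
  have hρ0 : 0 < ρ := by positivity
  have hrad : 0 ≤ P.radius xs := (norm_nonneg _).trans (h.norm_sub_le_radius hxs.1)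
  have hop : 0 ≤ P.opBound := (norm_nonneg _).trans (h.norm_F_le_opBound hxs.1)
  have hQ₁0 : 0 ≤ Q₁ := by positivity
  have hg0 : 0 ≤ g := by positivity
  refine ⟨1 / Real.log (1 / δ), (1 + g) * Q₁, N + 1, fun K hK T x y l hrun t ht hct => ?_⟩
  have hμ := muSeq_pos hμ₀ hδ₀ t
  have hi := hrun.isInnerRun h.regular hβ ht
  have hbd := hN K (by omega) T x y l hrun t ht
  have hK0 : 0 < K := by omega
  have hK1 : (0 : ℝ) < K := by exact_mod_cast hK0
  have hxm : average K (x t) ∈ P.eqSet := average_mem convex_eqSet hK0 hi.x_mem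
  have hxb : ‖average K (x t)‖ ≤ ρ := by
    have := average_mem (x := x t) (convex_closedBall (0 : EuclideanSpace ℝ (Fin n)) ρ) hK0
      fun k hk => mem_closedBall_zero_iff.2 (hi.norm_x_le hβ hbd hk)
    exact mem_closedBall_zero_iff.1 this
  have hyφ : ∀ i, P.φ i (average K (y t)) ≤ 0 := fun i =>
    (average_mem (x := y t) (U := {u | P.φ i u ≤ 0})
      (by simpa using (h.regular.convex i).convex_le 0) hK0 fun k hk => (hi.y_mem k hk i).le :)
  have h1 := hCb _ hxm hxb _ hyφ
  have h2 := hi.inner_average_le h hβ hμ hxs.1 hK0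
  have h3 : 1 / 2 * Delta β (y t 0) (l t 0) xs 0 / K ≤ E / K := by
    rw [hE]
    gcongr
    refine Delta_le_of_norm_le hβ ((norm_sub_le _ _).trans ?_) ?_
    · gcongr; exact (hbd 0 (by omega)).1
    · rw [sub_zero]; exact (hbd 0 (by omega)).2
  have h4 : C * ‖average K (x t) - average K (y t)‖ ≤ C * (1 / β * (Λ + Λ) / K) := by
    gcongr
    rw [hi.average_sub_average hβ, norm_smul, Real.norm_of_nonneg (by positivity)]
    have h5 : ‖l t K - l t 0‖ ≤ Λ + Λ :=
      (norm_sub_le _ _).trans (add_le_add (hbd K le_rfl).2 (hbd 0 (by omega)).2)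
    calc 1 / (K * β) * ‖l t K - l t 0‖ ≤ 1 / (K * β) * (Λ + Λ) := by gcongr
      _ = _ := by field_simp
  have h5 : (m : ℝ) * muSeq μ₀ δ t ≤ m * μ₀ / K := by
    rw [mul_div_assoc]
    gcongr
    exact muSeq_le_div hμ₀ hδ₀ hδ₁ hK0 hct
  have h6 : ‖average K (x t) - xs‖ ≤ Q₁ / K := by
    rw [hQ₁, div_div, mul_comm b, ← div_div, le_div_iff₀' hb]
    have : (m * μ₀ + E + C * (1 / β * (Λ + Λ))) / K
      = m * μ₀ / K + E / K + C * (1 / β * (Λ + Λ) / K) := by ring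
    rw [this]
    linarith
  constructor
  · refine h6.trans ?_
    gcongr
    nlinarith
  · refine (h.gap_le hxs hxm).trans ?_
    have h5 : ‖average K (x t) - xs‖ ≤ ρ + ‖xs‖ := (norm_sub_le _ _).trans (by gcongr)
    calc (L * (‖average K (x t) - xs‖ + P.radius xs) + P.opBound) * ‖average K (x t) - xs‖
        ≤ g * (Q₁ / K) := by rw [hg]; gcongr
      _ = g * Q₁ / K := by ring
      _ ≤ _ := by gcongr; linarith

end

/-! ### Convergence of the inner loop to the central path -/

section

variable {n m p : ℕ} {P : CVI n m p} {xμ : EuclideanSpace ℝ (Fin n)} {μ β L a E : ℝ} {K : ℕ}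
  {x y l : ℕ → EuclideanSpace ℝ (Fin n)}

/-- `Delta` does not involve `x`, which is recovered from `y` and the increment of `l`. -/
lemma IsInnerRun.norm_x_sub_le (h : P.IsInnerRun μ β K x y l) (hw : P.IsWellPosed L) (hβ : 0 < β)
    (hμ : 0 < μ) (hx : P.IsStationary μ xμ)
    (hE : Delta β (y 0) (l 0) xμ (μ • P.barrierGrad xμ) ≤ E) {k : ℕ} (hk : k < K) :
    ‖x (k + 1) - xμ‖ ≤ √(E / β) + 1 / β * (√(E * β) + √(E * β)) := by
  have h1 := norm_le_of_Delta_le hβ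
    ((h.Delta_le_of_le hw.regular hβ hμ hw.mono hx (Nat.zero_le (k + 1)) hk).trans hE)
  have h2 := norm_le_of_Delta_le hβ
    ((h.Delta_le_of_le hw.regular hβ hμ hw.mono hx (Nat.zero_le k) hk.le).trans hE)
  have h3 : x (k + 1) - xμ = (y (k + 1) - xμ)
      + (1 / β) • ((l (k + 1) - μ • P.barrierGrad xμ) - (l k - μ • P.barrierGrad xμ)) := by
    rw [h.x_eq hβ hk]; module
  rw [h3]
  refine (norm_add_le _ _).trans ?_
  rw [norm_smul, Real.norm_of_nonneg (by positivity)]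
  gcongr
  · exact h1.1
  · exact (norm_sub_le _ _).trans (add_le_add h1.2 h2.2)

/-- The monotonicity gap between an inner iterate and the central path point is controlled by the
residual. -/
lemma IsInnerRun.merit_le (h : P.IsInnerRun μ β K x y l) (hw : P.IsWellPosed L) (hβ : 0 < β)
    (hμ : 0 < μ) (hx : P.IsStationary μ xμ)
    (hE : Delta β (y 0) (l 0) xμ (μ • P.barrierGrad xμ) ≤ E) {k : ℕ} (hk : k < K) :
    ⟪x (k + 1) - xμ, P.F (x (k + 1)) - P.F xμ⟫_ℝ
      + ⟪μ • P.barrierGrad (y (k + 1)) - μ • P.barrierGrad xμ, y (k + 1) - xμ⟫_ℝ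
      + ‖x (k + 1) - y (k + 1)‖
      ≤ (√(E * β) + β * (√(E / β) + 1 / β * (√(E * β) + √(E * β))) + 1)
        * √(residual β y l k / β) := by
  obtain ⟨r1, r2⟩ := h.norm_le_residual hβ hk
  set r := √(residual β y l k / β) with hr
  have e1 : ‖x (k + 1) - y (k + 1)‖ ≤ r :=
    Real.le_sqrt_of_sq_le (by rw [le_div_iff₀' hβ]; exact r1)
  have e2 : ‖y (k + 1) - y k‖ ≤ r := Real.le_sqrt_of_sq_le (by rw [le_div_iff₀' hβ]; exact r2)
  have h1 := h.inner_eq k hk _ (h.x_mem k hk) xμ hx.mem_eq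
  have h2 := hx.inner_eq _ (h.x_mem k hk)
  have hl := (norm_le_of_Delta_le hβ
    ((h.Delta_le_of_le hw.regular hβ hμ hw.mono hx (Nat.zero_le (k + 1)) hk).trans hE)).2
  have hxb := h.norm_x_sub_le hw hβ hμ hx hE hk
  rw [← h.l_eq k hk]
  set lμ := μ • P.barrierGrad xμ with hlμ
  set ρ := √(E / β) + 1 / β * (√(E * β) + √(E * β)) with hρ
  have hρ0 : 0 ≤ ρ := by positivity
  rw [inner_add_left, inner_add_left, inner_smul_left, conj_trivial] at h1
  rw [inner_add_left] at h2
  have h3 : ⟪l (k + 1) - lμ, y (k + 1) - xμ⟫_ℝ = ⟪l (k + 1), x (k + 1) - xμ⟫_ℝ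
      - ⟪lμ, x (k + 1) - xμ⟫_ℝ - ⟪l (k + 1) - lμ, x (k + 1) - y (k + 1)⟫_ℝ := by
    simp only [inner_sub_left, inner_sub_right]; ring
  have h4 : -⟪l (k + 1) - lμ, x (k + 1) - y (k + 1)⟫_ℝ ≤ √(E * β) * r := by
    have h5 := (abs_le.1 (abs_real_inner_le_norm (l (k + 1) - lμ) (x (k + 1) - y (k + 1)))).1
    have h6 : ‖l (k + 1) - lμ‖ * ‖x (k + 1) - y (k + 1)‖ ≤ √(E * β) * r := by gcongr
    linarith
  have h7 : -⟪y (k + 1) - y k, x (k + 1) - xμ⟫_ℝ ≤ r * ρ := by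
    have h5 := (abs_le.1 (abs_real_inner_le_norm (y (k + 1) - y k) (x (k + 1) - xμ))).1
    have h6 : ‖y (k + 1) - y k‖ * ‖x (k + 1) - xμ‖ ≤ r * ρ := by gcongr
    linarith
  have h8 := mul_le_mul_of_nonneg_left h7 hβ.le
  rw [h3, real_inner_comm, inner_sub_left]
  linarith

/-- On compact sets, a small monotonicity gap forces closeness to the point of the central path. -/
lemma IsWellPosed.exists_merit_lower_bound (h : P.IsWellPosed L) (hμ : 0 < μ)
    (hx : P.IsStationary μ xμ) (ρ τ : ℝ) (hτ : 0 < τ) {ε : ℝ} (hε : 0 < ε) :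
    ∃ η : ℝ, 0 < η ∧ ∀ u ∈ P.eqSet, ‖u - xμ‖ ≤ ρ → ∀ v, ‖v - xμ‖ ≤ ρ → (∀ i, P.φ i v ≤ -τ) →
      ε ≤ ‖u - xμ‖ + ‖v - xμ‖ + ‖μ • P.barrierGrad v - μ • P.barrierGrad xμ‖ →
      η ≤ ⟪u - xμ, P.F u - P.F xμ⟫_ℝ
        + ⟪μ • P.barrierGrad v - μ • P.barrierGrad xμ, v - xμ⟫_ℝ + ‖u - v‖ := by
  have hP := h.regular
  set Z : Set (EuclideanSpace ℝ (Fin n) × EuclideanSpace ℝ (Fin n)) :=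
    (Metric.closedBall xμ ρ ∩ P.eqSet) ×ˢ (Metric.closedBall xμ ρ ∩ {v | ∀ i, P.φ i v ≤ -τ})
    with hZ
  have hZc : IsCompact Z := by
    refine ((isCompact_closedBall xμ ρ).inter_right isClosed_eqSet).prod
      ((isCompact_closedBall xμ ρ).inter_right ?_)
    simp only [ofPred_forall]
    exact isClosed_iInter fun i => isClosed_le (hP.continuous_φ i) continuous_const
  have hstr : ∀ w ∈ Z, w.2 ∈ P.strictSet := fun w hw i => by
    have := hw.2.2 i; linarith
  have hF : ContinuousOn (fun w : EuclideanSpace ℝ (Fin n) × EuclideanSpace ℝ (Fin n) => P.F w.1) Z :=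
    (continuousOn_F h.lip).comp continuousOn_fst fun w hw => hw.1.2
  have hB : ContinuousOn (fun w : EuclideanSpace ℝ (Fin n) × EuclideanSpace ℝ (Fin n) =>
      μ • P.barrierGrad w.2) Z :=
    ((continuousOn_barrierGrad hP).comp continuousOn_snd hstr).const_smul μ
  have hg : ContinuousOn (fun w : EuclideanSpace ℝ (Fin n) × EuclideanSpace ℝ (Fin n) =>
      ‖w.1 - xμ‖ + ‖w.2 - xμ‖ + ‖μ • P.barrierGrad w.2 - μ • P.barrierGrad xμ‖) Z :=
    (ContinuousOn.add (by fun_prop) (by fun_prop)).add (hB.sub continuousOn_const).norm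
  have hΦ : ContinuousOn (fun w : EuclideanSpace ℝ (Fin n) × EuclideanSpace ℝ (Fin n) =>
      ⟪w.1 - xμ, P.F w.1 - P.F xμ⟫_ℝ
        + ⟪μ • P.barrierGrad w.2 - μ • P.barrierGrad xμ, w.2 - xμ⟫_ℝ + ‖w.1 - w.2‖) Z :=
    ((ContinuousOn.inner (by fun_prop) (hF.sub continuousOn_const)).add
      ((hB.sub continuousOn_const).inner (by fun_prop))).add (by fun_prop)
  have hZ' := hZc.of_isClosed_subset
    (hg.preimage_isClosed_of_isClosed hZc.isClosed (isClosed_Ici (a := ε))) inter_subset_left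
  obtain ⟨η, hη, hηb⟩ := hZ'.exists_forall_le' (hΦ.mono inter_subset_left) (a := 0) (by
    rintro ⟨u, v⟩ ⟨huv, hge⟩
    have hv := hstr _ huv
    have hu : u ∈ P.eqSet := huv.1.2
    simp only at hv
    have h1 := h.mono u hu xμ hx.mem_eq
    have h2 := mul_nonneg hμ.le (barrierGrad_monotone hP hx.mem_strict hv)
    have h3 : ⟪μ • P.barrierGrad v - μ • P.barrierGrad xμ, v - xμ⟫_ℝ
        = μ * ⟪P.barrierGrad v - P.barrierGrad xμ, v - xμ⟫_ℝ := by
      rw [← smul_sub, inner_smul_left, conj_trivial]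
    simp only [h3]
    have h4 := norm_nonneg (u - v)
    by_contra! hle
    have h5 : u = v := by
      rw [← sub_eq_zero, ← norm_le_zero_iff]; linarith
    subst h5
    by_cases hux : u = xμ
    · subst hux
      simp only [mem_preimage, mem_Ici, sub_self, norm_zero, add_zero] at hge
      linarith
    · rcases h.strict with hs | hs
      · have := hs u (mem_feasible_of_strict hu hv) xμ hx.mem_feasible hux
        linarith
      · have := mul_pos hμ (barrierGrad_strictMonotone hP hs hx.mem_strict hv (Ne.symm hux))
        linarith)
  refine ⟨η, hη, fun u hu huρ v hvρ hvτ hge => ?_⟩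
  exact hηb (u, v) ⟨⟨⟨by simpa [dist_eq_norm] using huρ, hu⟩,
    ⟨by simpa [dist_eq_norm] using hvρ, hvτ⟩⟩, hge⟩

/-- The inner iterates converge to the point of the central path and its multiplier, uniformly over
all starting points with bounded `Delta`. -/
lemma IsWellPosed.exists_inner_convergence (h : P.IsWellPosed L) (hβ : 0 < β) (hμ : 0 < μ)
    (hx : P.IsStationary μ xμ) (E : ℝ) {ε : ℝ} (hε : 0 < ε) :
    ∃ N : ℕ, ∀ K, ∀ x y l : ℕ → EuclideanSpace ℝ (Fin n), P.IsInnerRun μ β K x y l →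
      Delta β (y 0) (l 0) xμ (μ • P.barrierGrad xμ) ≤ E → ∀ k, N < k → k ≤ K →
      ‖x k - xμ‖ + ‖y k - xμ‖ + ‖l k - μ • P.barrierGrad xμ‖ < ε := by
  have hP := h.regular
  set lμ := μ • P.barrierGrad xμ with hlμ
  set ρ := √(E / β) + 1 / β * (√(E * β) + √(E * β)) with hρ
  have hRρ : √(E / β) ≤ ρ := le_add_of_nonneg_right (by positivity)
  have hρ0 : 0 ≤ ρ := by positivity
  obtain ⟨τ, hτ, hτb⟩ := exists_φ_le_neg hP xμ ρ
    (P.barrier xμ + (√(E * β) + ‖lμ‖) * ρ / μ)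
  obtain ⟨η, hη, hηb⟩ := h.exists_merit_lower_bound hμ hx ρ τ hτ hε
  set c := √(E * β) + β * ρ + 1 with hc
  have hc0 : 0 < c := by positivity
  obtain ⟨N, hN⟩ := exists_nat_gt (c ^ 2 * E / (β * η ^ 2))
  refine ⟨N + 1, fun K x y l hr hE k hNk hkK => ?_⟩
  obtain ⟨j, rfl⟩ : ∃ j, k = j + 2 := ⟨k - 2, by omega⟩
  have hb := norm_le_of_Delta_le hβ
    ((hr.Delta_le_of_le hP hβ hμ h.mono hx (Nat.zero_le (j + 2)) hkK).trans hE)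
  have hxb := hr.norm_x_sub_le h hβ hμ hx hE (k := j + 1) (by omega)
  have hys := hr.y_mem (j + 1) (by omega)
  have hl := hr.l_eq (j + 1) (by omega)
  have hyρ : ‖y (j + 2) - xμ‖ ≤ ρ := hb.1.trans hRρ
  have hB : P.barrier (y (j + 2)) ≤ P.barrier xμ + (√(E * β) + ‖lμ‖) * ρ / μ := by
    have h1 := barrier_le hP hys hx.mem_strict
    have h2 : -⟪P.barrierGrad (y (j + 2)), xμ - y (j + 2)⟫_ℝ ≤ (√(E * β) + ‖lμ‖) * ρ / μ := by
      have h3 : ⟪l (j + 2), xμ - y (j + 2)⟫_ℝ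
          = μ * ⟪P.barrierGrad (y (j + 2)), xμ - y (j + 2)⟫_ℝ := by
        rw [hl, inner_smul_left, conj_trivial]
      have h4 := (abs_le.1 (abs_real_inner_le_norm (l (j + 2)) (xμ - y (j + 2)))).1
      have h5 : ‖l (j + 2)‖ ≤ √(E * β) + ‖lμ‖ := by
        have := norm_le_norm_add_norm_sub' (l (j + 2)) lμ
        linarith [hb.2]
      have h6 : ‖l (j + 2)‖ * ‖xμ - y (j + 2)‖ ≤ (√(E * β) + ‖lμ‖) * ρ := by
        rw [norm_sub_rev]; gcongr
      rw [le_div_iff₀ hμ]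
      linarith
    linarith
  by_contra! hge
  have h1 := hηb _ (hr.x_mem (j + 1) (by omega)) hxb _ hyρ (hτb _ hys hyρ hB) (by rw [← hl]; exact hge)
  have h2 := hr.merit_le h hβ hμ hx hE (k := j + 1) (by omega)
  have h3 := (hr.residual_le hP hβ hμ h.mono hx (k := j) (by omega)).trans hE
  have h4 : η ≤ c * √(residual β y l (j + 1) / β) := h1.trans h2
  have h5 : η ^ 2 ≤ c ^ 2 * (residual β y l (j + 1) / β) := by
    calc η ^ 2 ≤ (c * √(residual β y l (j + 1) / β)) ^ 2 := by gcongr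
      _ = _ := by
        rw [mul_pow, Real.sq_sqrt (div_nonneg (residual_nonneg hβ _) hβ.le)]
  rw [div_lt_iff₀ (by positivity)] at hN
  have hNj : (N : ℝ) < (j : ℝ) + 1 := by exact_mod_cast (by omega : N < j + 1)
  have h6 : ((j : ℝ) + 1) * (β * η ^ 2) ≤ c ^ 2 * E := by
    calc ((j : ℝ) + 1) * (β * η ^ 2)
        ≤ ((j : ℝ) + 1) * (β * (c ^ 2 * (residual β y l (j + 1) / β))) := by gcongr
      _ = c ^ 2 * (((j : ℝ) + 1) * residual β y l (j + 1)) := by field_simp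
      _ ≤ _ := by gcongr
  have h7 : (N : ℝ) * (β * η ^ 2) ≤ ((j : ℝ) + 1) * (β * η ^ 2) := by gcongr
  linarith

/-- The averaged iterates converge as well. -/
lemma IsWellPosed.exists_average_convergence (h : P.IsWellPosed L) (hβ : 0 < β) (hμ : 0 < μ)
    (hx : P.IsStationary μ xμ) (E : ℝ) {ε : ℝ} (hε : 0 < ε) :
    ∃ N : ℕ, ∀ K > N, ∀ x y l : ℕ → EuclideanSpace ℝ (Fin n), P.IsInnerRun μ β K x y l →
      Delta β (y 0) (l 0) xμ (μ • P.barrierGrad xμ) ≤ E → ‖average K x - xμ‖ < ε := by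
  obtain ⟨N, hN⟩ := h.exists_inner_convergence hβ hμ hx E (half_pos hε)
  set ρ := √(E / β) + 1 / β * (√(E * β) + √(E * β)) with hρ
  have hρ0 : 0 ≤ ρ := by positivity
  obtain ⟨N', hN'⟩ := exists_nat_gt (2 * (N * ρ) / ε)
  refine ⟨N', fun K hK x y l hr hE => ?_⟩
  have hK0 : 0 < K := by omega
  have hK1 : (0 : ℝ) < K := by exact_mod_cast hK0
  refine (norm_average_sub_le hK0).trans_lt ?_
  rw [one_div_mul_eq_div, div_lt_iff₀ hK1]
  have h1 : ∀ k ∈ Finset.range K, ‖x (k + 1) - xμ‖ ≤ ε / 2 + if k < N then ρ else 0 := by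
    intro k hk
    have hk' := Finset.mem_range.1 hk
    split_ifs with hkN
    · have := hr.norm_x_sub_le h hβ hμ hx hE hk'
      linarith
    · have := hN K x y l hr hE (k + 1) (by omega) (by omega)
      have := norm_nonneg (y (k + 1) - xμ)
      have := norm_nonneg (l (k + 1) - μ • P.barrierGrad xμ)
      linarith
  have h2 : ∑ k ∈ Finset.range K, (if k < N then ρ else 0) ≤ N * ρ := by
    rw [← Finset.sum_filter, Finset.sum_const, nsmul_eq_mul]
    gcongr
    calc _ ≤ (Finset.range N).card := Finset.card_le_card fun k hk => by
          simp only [Finset.mem_filter] at hk; exact Finset.mem_range.2 hk.2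
      _ = N := Finset.card_range N
  have h3 := Finset.sum_le_sum h1
  rw [Finset.sum_add_distrib, Finset.sum_const, Finset.card_range, nsmul_eq_mul] at h3
  rw [div_lt_iff₀ hε] at hN'
  have h4 : (N' : ℝ) * ε < K * ε := by
    have : (N' : ℝ) < K := by exact_mod_cast hK
    gcongr
  linarith

end

/-! ### Strict slack along the central path -/

section

variable {n m p : ℕ} {P : CVI n m p} {z xS xs xμ lμ : EuclideanSpace ℝ (Fin n)}
  {μ β L a b E μ₀ δ : ℝ} {K : ℕ} {x y l : ℕ → EuclideanSpace ℝ (Fin n)}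

/-- The point of the central path satisfies the variational inequality at `xs` up to `m μ`. -/
lemma IsStationary.inner_F_le (hx : P.IsStationary μ xμ) (hP : P.Regular) (hμ : 0 < μ)
    (hxs : xs ∈ P.feasible) : ⟪P.F xμ, xμ - xs⟫_ℝ ≤ m * μ := by
  have h1 := hx.inner_eq xs hxs.2
  have h2 := mul_le_mul_of_nonneg_left (inner_barrierGrad_le hP hx.mem_strict hxs.1) hμ.le
  rw [inner_add_left, inner_smul_left, conj_trivial] at h1
  rw [← neg_sub, inner_neg_right]
  linarith

/-- Points of the affine constraints other than `xs` give feasible points other than `xs`. -/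
lemma exists_feasible_ne (hP : P.Regular) (hz : z ∈ P.eqSet) (hzs : z ≠ xs) :
    ∃ w ∈ P.feasible, w ≠ xs := by
  obtain ⟨xS, hS1, hS2⟩ := hP.slater
  by_cases hne : xS = xs
  · subst hne
    have h1 := (eventually_add_smul_mem (isOpen_strictSet hP) hS1 (z - xS)).filter_mono
      (nhdsWithin_le_nhds (s := Ioi 0))
    obtain ⟨t, ht1, ht2⟩ := (h1.and self_mem_nhdsWithin).exists
    refine ⟨_, mem_feasible_of_strict (add_smul_mem_eqSet hS2 hS2 hz t) ht1, fun h => ?_⟩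
    have h2 : t • (z - xS) = 0 := by simpa using h
    rcases smul_eq_zero.1 h2 with h3 | h3
    · exact (ne_of_gt ht2) h3
    · exact hzs (sub_eq_zero.1 h3)
  · exact ⟨xS, mem_feasible_of_strict hS2 hS1, hne⟩

/-- The multipliers of the central path do not vanish: otherwise `xs` would be an interior solution
with `F xs` normal to the affine constraints, which the angle condition excludes. -/
lemma IsStationary.barrierGrad_ne_zero (hx : P.IsStationary μ xμ) (h : P.IsWellPosed L)
    (hxs : P.IsSolution xs) (ha : 0 < a)
    (hsharp : ∀ u ∈ P.feasible, a * ‖u - xs‖ ≤ ⟪P.F u, u - xs⟫_ℝ)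
    (hz : z ∈ P.eqSet) (hzs : z ≠ xs) : P.barrierGrad xμ ≠ 0 := by
  intro h0
  have hP := h.regular
  have horth : ∀ z ∈ P.eqSet, ⟪P.F xμ, z - xμ⟫_ℝ = 0 := fun z hz => by
    simpa [h0] using hx.inner_eq z hz
  have heq : xμ = xs := by
    have h1 := hsharp xμ hx.mem_feasible
    rw [← neg_sub, inner_neg_right, horth xs hxs.1.2, neg_zero, norm_neg] at h1
    have h2 : ‖xs - xμ‖ ≤ 0 := nonpos_of_mul_nonpos_right h1 ha
    exact (sub_eq_zero.1 (norm_le_zero_iff.1 h2)).symm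
  subst heq
  have hd : 0 < ‖z - xμ‖ := norm_pos_iff.2 (sub_ne_zero.2 hzs)
  have e1 := (eventually_add_smul_mem (isOpen_strictSet hP) hx.mem_strict (z - xμ)).filter_mono
    (nhdsWithin_le_nhds (s := Ioi 0))
  have e2 : ∀ᶠ t in 𝓝[>] (0 : ℝ), L * t * ‖z - xμ‖ < a := by
    have : ContinuousAt (fun t : ℝ => L * t * ‖z - xμ‖) 0 := by fun_prop
    exact (this.eventually_lt_const (by simpa using ha)).filter_mono nhdsWithin_le_nhds
  obtain ⟨t, ⟨ht1, ht2⟩, ht⟩ := ((e1.and e2).and self_mem_nhdsWithin).exists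
  have ht : 0 < t := ht
  have hu := add_smul_mem_eqSet hx.mem_eq hx.mem_eq hz t
  have h1 := hsharp _ (mem_feasible_of_strict hu ht1)
  have h2 := h.lip _ hu _ hx.mem_eq
  have h3 : ⟪P.F (xμ + t • (z - xμ)), xμ + t • (z - xμ) - xμ⟫_ℝ
      = ⟪P.F (xμ + t • (z - xμ)) - P.F xμ, xμ + t • (z - xμ) - xμ⟫_ℝ := by
    rw [inner_sub_left, horth _ hu, sub_zero]
  have h4 := real_inner_le_norm (P.F (xμ + t • (z - xμ)) - P.F xμ) (xμ + t • (z - xμ) - xμ)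
  rw [h3] at h1
  rw [add_sub_cancel_left, norm_smul, Real.norm_of_nonneg ht.le] at h1 h2 h4
  have h5 : ‖P.F (xμ + t • (z - xμ)) - P.F xμ‖ * (t * ‖z - xμ‖)
      ≤ L * (t * ‖z - xμ‖) * (t * ‖z - xμ‖) := by gcongr
  have h6 : 0 < t * ‖z - xμ‖ := by positivity
  have h7 : a ≤ L * (t * ‖z - xμ‖) := le_of_mul_le_mul_right (by linarith) h6
  linarith

/-- Where its gradient does not vanish, the barrier takes smaller values nearby. -/
lemma exists_barrier_lt (hP : P.Regular) (hx : xμ ∈ P.strictSet) (h0 : P.barrierGrad xμ ≠ 0)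
    {r : ℝ} (hr : 0 < r) : ∃ z ∈ P.strictSet, ‖z - xμ‖ ≤ r ∧ P.barrier z < P.barrier xμ := by
  by_contra! hcon
  refine h0 (inner_self_eq_zero (𝕜 := ℝ).1 (inner_eq_zero_of_eventually_le
    (hasGradientAt_barrier hP hx) ?_))
  filter_upwards [eventually_add_smul_mem (isOpen_strictSet hP) hx (P.barrierGrad xμ),
    eventually_add_smul_mem (U := Metric.ball xμ r) (x := xμ) Metric.isOpen_ball
      (Metric.mem_ball_self hr) (P.barrierGrad xμ)]
    with t h1 h2
  exact hcon _ h1 (by simpa [dist_eq_norm] using (Metric.mem_ball.1 h2).le)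

lemma barrierInf_le (hP : P.Regular) {Δ : ℝ} (hz : z ∈ P.strictSet)
    (hzr : ‖z - xμ‖ ≤ 3 * √(Δ / β)) : P.barrierInf β Δ xμ ≤ P.barrier z := by
  obtain ⟨c, hc⟩ := exists_le_barrier hP xμ (3 * √(Δ / β))
  refine csInf_le ⟨c, ?_⟩ ⟨z, ⟨hz, hzr⟩, rfl⟩
  rintro _ ⟨w, ⟨-, hw⟩, rfl⟩
  exact hc w hw

/-- The bound for the last iterate, without its terms that vanish as `K` grows and with `B⋆` replaced
by the barrier at a point of the ball that defines it. -/
lemma IsWellPosed.le_lastBound (h : P.IsWellPosed L) (ha : 0 < a)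
    (hμ₀ : 0 < μ₀) (hδ₀ : 0 < δ) {Δ : ℝ} (hΔ : 0 ≤ Δ) (t K : ℕ)
    (hz : z ∈ P.strictSet) (hzr : ‖z - xμ‖ ≤ 3 * √(Δ / β)) :
    (m * P.opBound / a ^ 2 + (P.barrier xμ - P.barrier z) / a) * muSeq μ₀ δ t
      ≤ P.lastBound a β δ μ₀ Δ t K xμ lμ := by
  have h1 := barrierInf_le h.regular hz hzr
  have h2 : 0 ≤ 1 / a * (Δ / K + 2 * Δ / √K + ‖lμ‖ * √(Δ / (β * K))) := by positivity
  have h3 : (m * P.opBound / a ^ 2 + (P.barrier xμ - P.barrier z) / a) * muSeq μ₀ δ t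
      ≤ (m * P.opBound / a ^ 2 + (P.barrier xμ - P.barrierInf β Δ xμ) / a) * muSeq μ₀ δ t := by
    have := muSeq_pos hμ₀ hδ₀ t
    gcongr
  rw [lastBound]
  exact h3.trans (le_add_of_nonneg_left h2)

/-- The part of the bound for the averaged iterate that depends neither on `K` nor on `Delta`. -/
lemma IsWellPosed.le_avgBound (h : P.IsWellPosed L) (ha : 0 < a) (hb : 0 < b)
    (hβ : 0 < β) (hμ₀ : 0 < μ₀) (hδ₀ : 0 < δ) {Δ : ℝ} (hΔ : 0 ≤ Δ) (t K : ℕ)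
    (hxμ : xμ ∈ P.strictSet) :
    (m + L * m / a * (m / a * μ₀)) / b * muSeq μ₀ δ t
      ≤ P.avgBound L a b β δ μ₀ Δ t K xμ lμ := by
  have h1 : P.barrierInf β Δ xμ ≤ P.barrier xμ :=
    barrierInf_le h.regular hxμ (by rw [sub_self, norm_zero]; positivity)
  have hL := h.L_pos
  have h2 : 0 ≤ 1 / b * (Δ / (2 * K) + 2 * √(β * Δ) * ‖lμ‖ / (β * K)) := by positivity
  have h3 : m + L * m / a * (m / a * μ₀) ≤ P.M₃ L a β μ₀ Δ K xμ := by
    have h4 : 0 ≤ L * m / a * (2 * √(β * Δ) / (β * (K + 1)) + √(Δ / β)) := by positivity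
    rw [M₃]
    linarith
  have h5 := muSeq_pos hμ₀ hδ₀ t
  rw [avgBound]
  refine le_trans ?_ (le_add_of_nonneg_left h2)
  show _ ≤ P.M₃ L a β μ₀ Δ K xμ / b * muSeq μ₀ δ t
  gcongr

/-- A bound of the gap function at a feasible point `u`. Only the part of `F u` that is paired with
`xs - z` is compared with `F xs`, so that no term quadratic in `‖u - xs‖` appears. -/
lemma IsWellPosed.inner_le_M₀ (h : P.IsWellPosed L) (hxs : P.IsSolution xs)
    {u : EuclideanSpace ℝ (Fin n)} (hu : u ∈ P.feasible) (hz : z ∈ P.feasible) :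
    ⟪P.F u, u - z⟫_ℝ ≤ P.M₀ L xs * ‖u - xs‖ := by
  have hL := h.L_pos
  have h1 := hxs.2 z hz
  have h2 : ⟪P.F u, u - z⟫_ℝ = ⟪P.F u, u - xs⟫_ℝ + ⟪P.F u - P.F xs, xs - z⟫_ℝ
      - ⟪P.F xs, z - xs⟫_ℝ := by
    simp only [inner_sub_left, inner_sub_right]; ring
  have h3 : ⟪P.F u - P.F xs, xs - z⟫_ℝ ≤ L * ‖u - xs‖ * P.radius xs := by
    refine (real_inner_le_norm _ _).trans ?_
    gcongr
    · exact h.lip u hu.2 xs hxs.1.2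
    · exact h.norm_sub_le_radius hz
  have h4 : ⟪P.F u, u - xs⟫_ℝ ≤ P.opBound * ‖u - xs‖ :=
    (real_inner_le_norm _ _).trans (by gcongr; exact h.norm_F_le_opBound hu)
  rw [M₀]
  linarith

lemma IsWellPosed.gap_le_of_mem (h : P.IsWellPosed L) (hxs : P.IsSolution xs)
    {u : EuclideanSpace ℝ (Fin n)} (hu : u ∈ P.feasible) :
    P.gap P.feasible u ≤ P.M₀ L xs * ‖u - xs‖ := by
  refine csSup_le (Set.Nonempty.image _ ⟨xs, hxs.1⟩) ?_
  rintro _ ⟨z, hz, rfl⟩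
  exact h.inner_le_M₀ hxs hu hz

lemma IsWellPosed.M₀_nonneg (h : P.IsWellPosed L) (hxs : P.IsSolution xs) : 0 ≤ P.M₀ L xs := by
  have hL := h.L_pos
  have hrad : 0 ≤ P.radius xs := (norm_nonneg _).trans (h.norm_sub_le_radius hxs.1)
  have hop : 0 ≤ P.opBound := (norm_nonneg _).trans (h.norm_F_le_opBound hxs.1)
  rw [M₀]; positivity

lemma IsWellPosed.M₀_pos (h : P.IsWellPosed L) (hxs : P.IsSolution xs)
    (hz : z ∈ P.feasible) (hzs : z ≠ xs) : 0 < P.M₀ L xs := by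
  have hL := h.L_pos
  have hrad : 0 < P.radius xs :=
    (norm_pos_iff.2 (sub_ne_zero.2 (Ne.symm hzs))).trans_le (h.norm_sub_le_radius hz)
  have hop : 0 ≤ P.opBound := (norm_nonneg _).trans (h.norm_F_le_opBound hxs.1)
  rw [M₀]; positivity

/-- A strict bound at a feasible point extends to its neighbours on the affine constraints, both for
the distance to `xs` and for the gap. -/
lemma IsWellPosed.exists_forall_near (h : P.IsWellPosed L) (hxs : P.IsSolution xs)
    (hM : 0 < P.M₀ L xs) (hxμ : xμ ∈ P.feasible) {R₀ : ℝ} (hR₀ : ‖xμ - xs‖ < R₀) :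
    ∃ ε : ℝ, 0 < ε ∧ ∀ u ∈ P.eqSet, ‖u - xμ‖ < ε → ∀ R, R₀ ≤ R →
      ‖u - xs‖ ≤ R ∧ P.gap P.feasible u ≤ P.M₀ L xs * R := by
  have hL := h.L_pos
  have hcont : ContinuousAt (fun s : ℝ => P.M₀ L xs * ‖xμ - xs‖
      + L * s * (s + 2 * P.radius xs) + P.opBound * s) 0 := by fun_prop
  have h1 := hcont.eventually_lt_const (u := P.M₀ L xs * R₀) (by
    simp only [mul_zero, zero_mul, add_zero]; gcongr)
  obtain ⟨ε, hε, hεb⟩ := Metric.eventually_nhds_iff.1 h1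
  refine ⟨min ε (R₀ - ‖xμ - xs‖), lt_min hε (by linarith), fun u hu huε R hR => ⟨?_, ?_⟩⟩
  · have h2 := norm_sub_le_norm_sub_add_norm_sub u xμ xs
    have h3 := huε.trans_le (min_le_right _ _)
    linarith
  · have h4 := hεb (y := ‖u - xμ‖) (by simpa using huε.trans_le (min_le_left _ _))
    have h5 : P.M₀ L xs * R₀ ≤ P.M₀ L xs * R := by gcongr
    refine le_trans (csSup_le (Set.Nonempty.image _ ⟨xs, hxs.1⟩) ?_) (h4.le.trans h5)
    rintro _ ⟨z, hz, rfl⟩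
    have h6 := h.inner_le_M₀ hxs hxμ hz
    have h7 : ⟪P.F u, u - z⟫_ℝ = ⟪P.F xμ, xμ - z⟫_ℝ + ⟪P.F u - P.F xμ, u - z⟫_ℝ
        + ⟪P.F xμ, u - xμ⟫_ℝ := by
      simp only [inner_sub_left, inner_sub_right]; ring
    have h8 : ⟪P.F u - P.F xμ, u - z⟫_ℝ ≤ L * ‖u - xμ‖ * (‖u - xμ‖ + 2 * P.radius xs) := by
      refine (real_inner_le_norm _ _).trans ?_
      gcongr
      · exact h.lip u hu xμ hxμ.2
      · have h9 := norm_sub_le_norm_sub_add_norm_sub u xμ z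
        have h10 := norm_sub_le_norm_sub_add_norm_sub xμ xs z
        have h11 := h.norm_sub_le_radius (xs := xs) hz
        have h12 := h.norm_sub_le_radius (xs := xs) hxμ
        rw [norm_sub_rev] at h12
        linarith
    have h9 : ⟪P.F xμ, u - xμ⟫_ℝ ≤ P.opBound * ‖u - xμ‖ :=
      (real_inner_le_norm _ _).trans (by gcongr; exact h.norm_F_le_opBound hxμ)
    simp only
    linarith

/-! ### Explicit bounds at a fixed outer step -/

/-- `Delta` at the start of an outer step is bounded, uniformly in the length of the inner loops. -/
lemma IsWellPosed.exists_Delta_le (h : P.IsWellPosed L) (hβ : 0 < β)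
    (hμ₀ : 0 < μ₀) (hδ₀ : 0 < δ) (hδ₁ : δ < 1) (y₀ l₀ u v : EuclideanSpace ℝ (Fin n)) :
    ∃ E : ℝ, ∃ N : ℕ, ∀ K > N, ∀ T, ∀ x y l : ℕ → ℕ → EuclideanSpace ℝ (Fin n),
      P.IsRun β δ μ₀ T K y₀ l₀ x y l → ∀ t < T, Delta β (y t 0) (l t 0) u v ≤ E := by
  obtain ⟨Λ, hΛ, N, hN⟩ := h.exists_uniform_bound hβ hμ₀ hδ₀ hδ₁ y₀ l₀
  refine ⟨1 / β * (Λ + ‖v‖) ^ 2 + β * (Λ + ‖u‖) ^ 2, N, fun K hK T x y l hr t ht => ?_⟩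
  have h1 := hN K hK T x y l hr t ht 0 (Nat.zero_le _)
  exact Delta_le_of_norm_le hβ ((norm_sub_le _ _).trans (by linarith [h1.1]))
    ((norm_sub_le _ _).trans (by linarith [h1.2]))

/-- At the start of an outer step, `Delta` either vanishes or is bounded below uniformly in the
length of the inner loops: for `t > 0` the warm start converges to the previous point of the central
path, which differs from the next one in its multiplier or its position. -/
lemma IsWellPosed.exists_le_Delta (h : P.IsWellPosed L) (hxs : P.IsSolution xs) (ha : 0 < a)
    (hsharp : ∀ u ∈ P.feasible, a * ‖u - xs‖ ≤ ⟪P.F u, u - xs⟫_ℝ)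
    (hz : z ∈ P.eqSet) (hzs : z ≠ xs) (hβ : 0 < β)
    (hμ₀ : 0 < μ₀) (hδ₀ : 0 < δ) (hδ₁ : δ < 1) (y₀ l₀ : EuclideanSpace ℝ (Fin n)) (t : ℕ)
    (hx : P.IsStationary (muSeq μ₀ δ t) xμ) :
    ∃ η : ℝ, 0 < η ∧ ∃ N : ℕ, ∀ K > N, ∀ T, ∀ x y l : ℕ → ℕ → EuclideanSpace ℝ (Fin n),
      P.IsRun β δ μ₀ T K y₀ l₀ x y l → t < T →
      Delta β (y t 0) (l t 0) xμ (muSeq μ₀ δ t • P.barrierGrad xμ) = 0 ∨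
      η ≤ Delta β (y t 0) (l t 0) xμ (muSeq μ₀ δ t • P.barrierGrad xμ) := by
  have hP := h.regular
  cases t with
  | zero =>
    by_cases h0 : Delta β y₀ l₀ xμ (muSeq μ₀ δ 0 • P.barrierGrad xμ) = 0
    · exact ⟨1, one_pos, 0, fun K _ T x y l hr _ => Or.inl (by rw [hr.init_y, hr.init_l, h0])⟩
    · exact ⟨_, (Delta_nonneg hβ _ _ _ _).lt_of_ne' h0, 0, fun K _ T x y l hr _ =>
        Or.inr (by rw [hr.init_y, hr.init_l])⟩
  | succ t =>
    have hμ := muSeq_pos hμ₀ hδ₀ t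
    obtain ⟨xν, hν⟩ := exists_isStationary hP h.L_pos h.mono h.lip hμ
    set lν := muSeq μ₀ δ t • P.barrierGrad xν with hlν
    set lμ := muSeq μ₀ δ (t + 1) • P.barrierGrad xμ with hlμ
    have hne : 0 < ‖xν - xμ‖ + ‖lν - lμ‖ := by
      by_contra! hle
      have h1 : xν = xμ := sub_eq_zero.1 (norm_le_zero_iff.1 (by linarith [norm_nonneg (lν - lμ)]))
      have h2 : lν - lμ = 0 := norm_le_zero_iff.1 (by linarith [norm_nonneg (xν - xμ)])
      have h3 : lν - lμ = (μ₀ * δ ^ (t + 1) * (1 - δ)) • P.barrierGrad xμ := by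
        rw [hlν, hlμ, h1, muSeq, muSeq, ← sub_smul]; congr 1; ring
      rw [h3, smul_eq_zero] at h2
      rcases h2 with h2 | h2
      · have : 0 < μ₀ * δ ^ (t + 1) * (1 - δ) := mul_pos (by positivity) (by linarith)
        exact this.ne' h2
      · exact hx.barrierGrad_ne_zero h hxs ha hsharp hz hzs h2
    set d := ‖xν - xμ‖ + ‖lν - lμ‖ with hd
    obtain ⟨E, N₁, hN₁⟩ := h.exists_Delta_le hβ hμ₀ hδ₀ hδ₁ y₀ l₀ xν lν
    obtain ⟨N₂, hN₂⟩ := h.exists_inner_convergence hβ hμ hν E (half_pos hne)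
    refine ⟨min β (1 / β) * (d / 4) ^ 2, by positivity, max N₁ N₂, fun K hK T x y l hr ht => ?_⟩
    right
    have h1 := hN₂ K _ _ _ (hr.isInnerRun hP hβ (by omega : t < T))
      (hN₁ K (lt_of_le_of_lt (le_max_left _ _) hK) T x y l hr t (by omega)) K
      (lt_of_le_of_lt (le_max_right _ _) hK) le_rfl
    rw [hr.warm_y t ht, hr.warm_l t ht, Delta]
    have h2 := norm_sub_le_norm_sub_add_norm_sub xν (y t K) xμ
    have h3 := norm_sub_le_norm_sub_add_norm_sub lν (l t K) lμ
    rw [norm_sub_rev xν (y t K)] at h2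
    rw [norm_sub_rev lν (l t K)] at h3
    have h4 := norm_nonneg (x t K - xν)
    have h5 : d / 4 ≤ ‖l t K - lμ‖ ∨ d / 4 ≤ ‖y t K - xμ‖ := by
      by_contra! hcon
      linarith [hcon.1, hcon.2]
    have h6 : 0 ≤ 1 / β * ‖l t K - lμ‖ ^ 2 := by positivity
    have h7 : 0 ≤ β * ‖y t K - xμ‖ ^ 2 := by positivity
    rcases h5 with h5 | h5
    · have : min β (1 / β) * (d / 4) ^ 2 ≤ 1 / β * ‖l t K - lμ‖ ^ 2 := by
        gcongr; exact min_le_right _ _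
      linarith
    · have : min β (1 / β) * (d / 4) ^ 2 ≤ β * ‖y t K - xμ‖ ^ 2 := by
        gcongr; exact min_le_left _ _
      linarith

/-- If the inner loop starts at the point of the central path, it stays there. -/
lemma IsInnerRun.x_eq_of_Delta_eq_zero (h : P.IsInnerRun μ β K x y l) (hw : P.IsWellPosed L)
    (hβ : 0 < β) (hμ : 0 < μ) (hx : P.IsStationary μ xμ)
    (h0 : Delta β (y 0) (l 0) xμ (μ • P.barrierGrad xμ) = 0) {k : ℕ} (hk : k < K) :
    x (k + 1) = xμ := by
  have h1 := h.norm_x_sub_le hw hβ hμ hx h0.le hk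
  simp only [zero_div, zero_mul, Real.sqrt_zero, add_zero, mul_zero] at h1
  exact sub_eq_zero.1 (norm_le_zero_iff.1 h1)

/-- The explicit bound for the last iterate at one outer step. It holds with room to spare at the
point of the central path, to which the iterates converge. -/
lemma IsWellPosed.exists_last_bound (h : P.IsWellPosed L) (hxs : P.IsSolution xs) (ha : 0 < a)
    (hsharp : ∀ u ∈ P.feasible, a * ‖u - xs‖ ≤ ⟪P.F u, u - xs⟫_ℝ)
    (hβ : 0 < β) (hμ₀ : 0 < μ₀) (hδ₀ : 0 < δ) (hδ₁ : δ < 1)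
    (y₀ l₀ : EuclideanSpace ℝ (Fin n)) (t : ℕ) (hx : P.IsStationary (muSeq μ₀ δ t) xμ) :
    ∃ N : ℕ, ∀ K > N, ∀ T, ∀ x y l : ℕ → ℕ → EuclideanSpace ℝ (Fin n),
      P.IsRun β δ μ₀ T K y₀ l₀ x y l → t < T →
      ∀ R, R = P.lastBound a β δ μ₀ (Delta β (y t 0) (l t 0) xμ
        (muSeq μ₀ δ t • P.barrierGrad xμ)) t K xμ (muSeq μ₀ δ t • P.barrierGrad xμ) →
      ‖x t K - xs‖ ≤ R ∧ P.gap P.feasible (x t K) ≤ P.M₀ L xs * R := by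
  have hP := h.regular
  have hμ := muSeq_pos hμ₀ hδ₀ t
  by_cases hsing : ∀ z ∈ P.eqSet, z = xs
  · -- the affine constraints determine `xs`, and every iterate equals `xs`
    refine ⟨0, fun K hK T x y l hr ht R hR => ?_⟩
    obtain ⟨k, rfl⟩ : ∃ k, K = k + 1 := ⟨K - 1, by omega⟩
    have hxm := (hr.isInnerRun hP hβ ht).x_mem k (by omega)
    have hxx := hsing _ hxm
    have hop : 0 ≤ P.opBound := (norm_nonneg _).trans (h.norm_F_le_opBound hxs.1)
    have hR0 : 0 ≤ R := by
      rw [hR]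
      refine le_trans ?_ (h.le_lastBound ha hμ₀ hδ₀ (Delta_nonneg hβ _ _ _ _) t _
        hx.mem_strict (by rw [sub_self, norm_zero]; positivity))
      rw [sub_self, zero_div, add_zero]
      positivity
    have hg := h.gap_le hxs hxm
    rw [hxx, sub_self, norm_zero, mul_zero] at hg
    rw [hxx, sub_self, norm_zero]
    exact ⟨hR0, hg.trans (mul_nonneg (h.M₀_nonneg hxs) hR0)⟩
  push Not at hsing
  obtain ⟨z, hz, hzs⟩ := hsing
  obtain ⟨w, hw, hws⟩ := exists_feasible_ne hP hz hzs
  have hM := h.M₀_pos hxs hw hws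
  -- the angle condition at `w` gives `a ≤ sup ‖F‖`
  have haM : a ≤ P.opBound := by
    have h1 := (hsharp w hw).trans (real_inner_le_norm _ _)
    exact (le_of_mul_le_mul_right h1 (norm_pos_iff.2 (sub_ne_zero.2 hws))).trans
      (h.norm_F_le_opBound hw)
  have hdist : ‖xμ - xs‖ ≤ m * P.opBound / a ^ 2 * muSeq μ₀ δ t := by
    have h1 := (hsharp xμ hx.mem_feasible).trans (hx.inner_F_le hP hμ hxs.1)
    have h2 : m * P.opBound / a ^ 2 * muSeq μ₀ δ t = m * muSeq μ₀ δ t * P.opBound / a / a := by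
      field_simp
    rw [h2, le_div_iff₀' ha]
    refine h1.trans ?_
    rw [le_div_iff₀ ha]
    gcongr
  obtain ⟨η, hη, N₁, hN₁⟩ := h.exists_le_Delta hxs ha hsharp hz hzs hβ hμ₀ hδ₀ hδ₁ y₀ l₀ t hx
  obtain ⟨v, hv, hvr, hvB⟩ := exists_barrier_lt hP hx.mem_strict
    (hx.barrierGrad_ne_zero h hxs ha hsharp hz hzs) (r := 3 * √(η / β)) (by positivity)
  obtain ⟨ε, hε, hεb⟩ := h.exists_forall_near hxs hM hx.mem_feasible
    (R₀ := (m * P.opBound / a ^ 2 + (P.barrier xμ - P.barrier v) / a) * muSeq μ₀ δ t) (by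
      refine hdist.trans_lt ?_
      gcongr
      exact lt_add_of_pos_right _ (div_pos (by linarith) ha))
  obtain ⟨E, N₂, hN₂⟩ := h.exists_Delta_le hβ hμ₀ hδ₀ hδ₁ y₀ l₀ xμ
    (muSeq μ₀ δ t • P.barrierGrad xμ)
  obtain ⟨N₃, hN₃⟩ := h.exists_inner_convergence hβ hμ hx E hε
  refine ⟨max N₁ (max N₂ N₃), fun K hK T x y l hr ht R hR => ?_⟩
  simp only [gt_iff_lt, max_lt_iff] at hK
  obtain ⟨hK₁, hK₂, hK₃⟩ := hK
  obtain ⟨k, rfl⟩ : ∃ k, K = k + 1 := ⟨K - 1, by omega⟩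
  have hi := hr.isInnerRun hP hβ ht
  rcases hN₁ _ hK₁ T x y l hr ht with h0 | hge
  · -- the outer step starts exactly on the central path
    rw [hi.x_eq_of_Delta_eq_zero h hβ hμ hx h0 (Nat.lt_succ_self k)]
    have hR1 := h.le_lastBound (β := β) (lμ := muSeq μ₀ δ t • P.barrierGrad xμ) ha hμ₀ hδ₀
      (Delta_nonneg hβ (y t 0) (l t 0) xμ (muSeq μ₀ δ t • P.barrierGrad xμ)) t (k + 1)
      hx.mem_strict (by rw [sub_self, norm_zero]; positivity)
    rw [← hR, sub_self, zero_div, add_zero] at hR1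
    have hR2 := hdist.trans hR1
    refine ⟨hR2, (h.gap_le_of_mem hxs hx.mem_feasible).trans ?_⟩
    gcongr
  · have hR1 := h.le_lastBound (β := β) (lμ := muSeq μ₀ δ t • P.barrierGrad xμ) ha hμ₀ hδ₀
      (Delta_nonneg hβ (y t 0) (l t 0) xμ (muSeq μ₀ δ t • P.barrierGrad xμ)) t (k + 1)
      hv (hvr.trans (by gcongr))
    rw [← hR] at hR1
    refine hεb _ (hi.x_mem k (Nat.lt_succ_self k)) ?_ R hR1
    have h1 := hN₃ _ _ _ _ hi (hN₂ _ hK₂ T x y l hr t ht) (k + 1) hK₃ le_rfl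
    have h2 := norm_nonneg (y t (k + 1) - xμ)
    have h3 := norm_nonneg (l t (k + 1) - muSeq μ₀ δ t • P.barrierGrad xμ)
    linarith

/-- The explicit bound for the averaged iterate at one outer step, by the same argument. -/
lemma IsWellPosed.exists_average_bound (h : P.IsWellPosed L) (hxs : P.IsSolution xs) (ha : 0 < a)
    (hsharp : ∀ u ∈ P.feasible, a * ‖u - xs‖ ≤ ⟪P.F u, u - xs⟫_ℝ) (hb : 0 < b)
    (hsharp' : ∀ u ∈ P.feasible, b * ‖u - xs‖ ≤ ⟪P.F xs, u - xs⟫_ℝ)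
    (hβ : 0 < β) (hμ₀ : 0 < μ₀) (hδ₀ : 0 < δ) (hδ₁ : δ < 1)
    (y₀ l₀ : EuclideanSpace ℝ (Fin n)) (t : ℕ) (hx : P.IsStationary (muSeq μ₀ δ t) xμ) :
    ∃ N : ℕ, ∀ K > N, ∀ T, ∀ x y l : ℕ → ℕ → EuclideanSpace ℝ (Fin n),
      P.IsRun β δ μ₀ T K y₀ l₀ x y l → t < T →
      ∀ R, R = P.avgBound L a b β δ μ₀ (Delta β (y t 0) (l t 0) xμ
        (muSeq μ₀ δ t • P.barrierGrad xμ)) t K xμ (muSeq μ₀ δ t • P.barrierGrad xμ) →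
      ‖average K (x t) - xs‖ ≤ R ∧ P.gap P.feasible (average K (x t)) ≤ P.M₀ L xs * R := by
  have hP := h.regular
  have hL := h.L_pos
  have hμ := muSeq_pos hμ₀ hδ₀ t
  by_cases hsing : ∀ z ∈ P.eqSet, z = xs
  · refine ⟨0, fun K hK T x y l hr ht R hR => ?_⟩
    have hxm : average K (x t) ∈ P.eqSet :=
      average_mem convex_eqSet hK (hr.isInnerRun hP hβ ht).x_mem
    have hxx := hsing _ hxm
    have hR0 : 0 ≤ R := by
      rw [hR]
      refine le_trans ?_ (h.le_avgBound ha hb hβ hμ₀ hδ₀ (Delta_nonneg hβ _ _ _ _) t _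
        hx.mem_strict)
      positivity
    have hg := h.gap_le hxs hxm
    rw [hxx, sub_self, norm_zero, mul_zero] at hg
    rw [hxx, sub_self, norm_zero]
    exact ⟨hR0, hg.trans (mul_nonneg (h.M₀_nonneg hxs) hR0)⟩
  push Not at hsing
  obtain ⟨z, hz, hzs⟩ := hsing
  obtain ⟨w, hw, hws⟩ := exists_feasible_ne hP hz hzs
  have hM := h.M₀_pos hxs hw hws
  -- without inequality constraints the barrier gradient would vanish
  have hm : 0 < (m : ℝ) := by
    rcases Nat.eq_zero_or_pos m with rfl | hm
    · exact absurd (by simp [barrierGrad]) (hx.barrierGrad_ne_zero h hxs ha hsharp hz hzs)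
    · exact_mod_cast hm
  have hdist : ‖xμ - xs‖ ≤ m / b * muSeq μ₀ δ t := by
    have h1 := hx.inner_F_le hP hμ hxs.1
    have h2 := h.mono _ hx.mem_eq _ hxs.1.2
    rw [real_inner_comm, inner_sub_left] at h2
    rw [div_mul_eq_mul_div, le_div_iff₀' hb]
    linarith [hsharp' xμ hx.mem_feasible]
  obtain ⟨ε, hε, hεb⟩ := h.exists_forall_near hxs hM hx.mem_feasible
    (R₀ := (m + L * m / a * (m / a * μ₀)) / b * muSeq μ₀ δ t) (by
      refine hdist.trans_lt ?_
      gcongr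
      exact lt_add_of_pos_right _ (by positivity))
  obtain ⟨E, N₂, hN₂⟩ := h.exists_Delta_le hβ hμ₀ hδ₀ hδ₁ y₀ l₀ xμ
    (muSeq μ₀ δ t • P.barrierGrad xμ)
  obtain ⟨N₃, hN₃⟩ := h.exists_average_convergence hβ hμ hx E hε
  refine ⟨max N₂ N₃, fun K hK T x y l hr ht R hR => ?_⟩
  simp only [gt_iff_lt, max_lt_iff] at hK
  have hi := hr.isInnerRun hP hβ ht
  refine hεb _ (average_mem convex_eqSet (by omega) hi.x_mem)
    (hN₃ _ hK.2 _ _ _ hi (hN₂ _ hK.1 T x y l hr t ht)) R ?_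
  rw [hR]
  exact h.le_avgBound ha hb hβ hμ₀ hδ₀ (Delta_nonneg hβ _ _ _ _) t _ hx.mem_strict

/-- A threshold that works for each outer step separately can be made uniform over `t < T`. -/
lemma exists_uniform_threshold {Q : ℕ → ℕ → Prop} (h : ∀ t, ∃ N : ℕ, ∀ K > N, Q t K) (T : ℕ) :
    ∃ N : ℕ, ∀ K > N, ∀ t < T, Q t K := by
  choose N hN using h
  refine ⟨(Finset.range T).sup N, fun K hK t ht => hN t K (lt_of_le_of_lt ?_ hK)⟩
  exact Finset.le_sup (Finset.mem_range.2 ht)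

end

end CVI

theorem mainTheorem5 {n m p : ℕ} (P : CVI n m p) (hP : P.Regular)
    (L : ℝ) (hL : 0 < L)
    (hmono : P.MonotoneOp P.eqSet)
    (hlip : ∀ x ∈ P.eqSet, ∀ z ∈ P.eqSet, ‖P.F x - P.F z‖ ≤ L * ‖x - z‖)
    (hstrict : P.StrictMonotoneOp P.feasible ∨ ∃ i, StrictConvexOn ℝ Set.univ (P.φ i))
    (xs : EuclideanSpace ℝ (Fin n)) (hxs : P.IsSolution xs)
    (S : Set (EuclideanSpace ℝ (Fin n))) (hS : P.IsEnlargement S)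
    (a : ℝ) (ha : 0 < a)
    (hSa : IsGLB ((fun x => ⟪P.F x, x - xs⟫_ℝ / ‖x - xs‖) '' (S \ {xs})) a)
    (β δ μ₀ : ℝ) (hβ : 0 < β) (hδ₀ : 0 < δ) (hδ₁ : δ < 1) (hμ₀ : 0 < μ₀)
    (y₀ l₀ : EuclideanSpace ℝ (Fin n)) :
    -- the central path is well defined
    (∀ μ : ℝ, 0 < μ → ∃! z : EuclideanSpace ℝ (Fin n) × EuclideanSpace ℝ (Fin n),
      P.IsCentralPair μ z.1 z.2) ∧
    -- explicit bounds for the last iterate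
    (∀ T : ℕ, ∃ K₀ : ℕ, ∀ K > K₀, ∀ x y l : ℕ → ℕ → EuclideanSpace ℝ (Fin n),
      P.IsRun β δ μ₀ T K y₀ l₀ x y l →
      ∀ t < T, ∀ xμ lμ : EuclideanSpace ℝ (Fin n),
        P.IsCentralPair (CVI.muSeq μ₀ δ t) xμ lμ →
        ‖x t K - xs‖ ≤
          P.lastBound a β δ μ₀ (CVI.Delta β (y t 0) (l t 0) xμ lμ) t K xμ lμ ∧
        P.gap P.feasible (x t K) ≤ P.M₀ L xs *
          P.lastBound a β δ μ₀ (CVI.Delta β (y t 0) (l t 0) xμ lμ) t K xμ lμ) ∧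
    -- explicit bounds for the average iterate
    (∀ (S' : Set (EuclideanSpace ℝ (Fin n))) (b : ℝ), P.IsEnlargement S' → 0 < b →
      IsGLB ((fun x => ⟪P.F xs, x - xs⟫_ℝ / ‖x - xs‖) '' (S' \ {xs})) b →
      ∀ T : ℕ, ∃ K₀ : ℕ, ∀ K > K₀, ∀ x y l : ℕ → ℕ → EuclideanSpace ℝ (Fin n),
      P.IsRun β δ μ₀ T K y₀ l₀ x y l →
      ∀ t < T, ∀ xμ lμ : EuclideanSpace ℝ (Fin n),
        P.IsCentralPair (CVI.muSeq μ₀ δ t) xμ lμ →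
        ‖CVI.average K (x t) - xs‖ ≤
          P.avgBound L a b β δ μ₀ (CVI.Delta β (y t 0) (l t 0) xμ lμ) t K xμ lμ ∧
        P.gap P.feasible (CVI.average K (x t)) ≤ P.M₀ L xs *
          P.avgBound L a b β δ μ₀ (CVI.Delta β (y t 0) (l t 0) xμ lμ) t K xμ lμ) ∧
    -- rate `O(1/√K)` of the last iterate after `O(log K)` outer steps
    (∃ (c Q : ℝ) (K₀ : ℕ), ∀ K > K₀, ∀ (T : ℕ) (x y l : ℕ → ℕ → EuclideanSpace ℝ (Fin n)),
      P.IsRun β δ μ₀ T K y₀ l₀ x y l →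
      ∀ t < T, c * Real.log K ≤ t →
        ‖x t K - xs‖ ≤ Q / √K ∧ P.gap P.feasible (x t K) ≤ Q / √K) ∧
    -- rate `O(1/K)` of the average iterate after `O(log K)` outer steps
    (∀ (S' : Set (EuclideanSpace ℝ (Fin n))) (b : ℝ), P.IsEnlargement S' → 0 < b →
      IsGLB ((fun x => ⟪P.F xs, x - xs⟫_ℝ / ‖x - xs‖) '' (S' \ {xs})) b →
      ∃ (c Q : ℝ) (K₀ : ℕ), ∀ K > K₀, ∀ (T : ℕ) (x y l : ℕ → ℕ → EuclideanSpace ℝ (Fin n)),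
      P.IsRun β δ μ₀ T K y₀ l₀ x y l →
      ∀ t < T, c * Real.log K ≤ t →
        ‖CVI.average K (x t) - xs‖ ≤ Q / K ∧
        P.gap P.feasible (CVI.average K (x t)) ≤ Q / K) := by
  have h : P.IsWellPosed L := ⟨hP, hL, hmono, hlip, hstrict⟩
  have hsharp := CVI.mul_norm_le_of_isGLB (G := P.F) hS hSa
  refine ⟨fun μ hμ => CVI.existsUnique_isCentralPair hP hL hmono hlip hstrict hμ, fun T => ?_,
    fun S' b hS' hb hSb T => ?_, ?_, fun S' b hS' hb hSb => ?_⟩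
  · have hstep : ∀ t, ∃ N : ℕ, ∀ K > N, ∀ x y l : ℕ → ℕ → EuclideanSpace ℝ (Fin n),
        P.IsRun β δ μ₀ T K y₀ l₀ x y l → t < T → ∀ xμ lμ : EuclideanSpace ℝ (Fin n),
        P.IsCentralPair (CVI.muSeq μ₀ δ t) xμ lμ → ‖x t K - xs‖ ≤
          P.lastBound a β δ μ₀ (CVI.Delta β (y t 0) (l t 0) xμ lμ) t K xμ lμ ∧
        P.gap P.feasible (x t K) ≤ P.M₀ L xs *
          P.lastBound a β δ μ₀ (CVI.Delta β (y t 0) (l t 0) xμ lμ) t K xμ lμ := by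
      intro t
      have hμ := CVI.muSeq_pos hμ₀ hδ₀ t
      obtain ⟨u, hu⟩ := CVI.exists_isStationary hP hL hmono hlip hμ
      obtain ⟨N, hN⟩ := h.exists_last_bound hxs ha hsharp hβ hμ₀ hδ₀ hδ₁ y₀ l₀ t hu
      refine ⟨N, fun K hK x y l hr ht xμ lμ hpair => ?_⟩
      obtain ⟨hx, rfl⟩ := (CVI.isCentralPair_iff hP hμ).1 hpair
      obtain rfl := hx.eq hP hmono hstrict hμ hu
      exact hN K hK T x y l hr ht _ rfl
    obtain ⟨N, hN⟩ := CVI.exists_uniform_threshold hstep T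
    exact ⟨N, fun K hK x y l hr t ht => hN K hK t ht x y l hr ht⟩
  · have hsharp' := CVI.mul_norm_le_of_isGLB (G := fun _ => P.F xs) hS' hSb
    have hstep : ∀ t, ∃ N : ℕ, ∀ K > N, ∀ x y l : ℕ → ℕ → EuclideanSpace ℝ (Fin n),
        P.IsRun β δ μ₀ T K y₀ l₀ x y l → t < T → ∀ xμ lμ : EuclideanSpace ℝ (Fin n),
        P.IsCentralPair (CVI.muSeq μ₀ δ t) xμ lμ → ‖CVI.average K (x t) - xs‖ ≤
          P.avgBound L a b β δ μ₀ (CVI.Delta β (y t 0) (l t 0) xμ lμ) t K xμ lμ ∧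
        P.gap P.feasible (CVI.average K (x t)) ≤ P.M₀ L xs *
          P.avgBound L a b β δ μ₀ (CVI.Delta β (y t 0) (l t 0) xμ lμ) t K xμ lμ := by
      intro t
      have hμ := CVI.muSeq_pos hμ₀ hδ₀ t
      obtain ⟨u, hu⟩ := CVI.exists_isStationary hP hL hmono hlip hμ
      obtain ⟨N, hN⟩ :=
        h.exists_average_bound hxs ha hsharp hb hsharp' hβ hμ₀ hδ₀ hδ₁ y₀ l₀ t hu
      refine ⟨N, fun K hK x y l hr ht xμ lμ hpair => ?_⟩
      obtain ⟨hx, rfl⟩ := (CVI.isCentralPair_iff hP hμ).1 hpair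
      obtain rfl := hx.eq hP hmono hstrict hμ hu
      exact hN K hK T x y l hr ht _ rfl
    obtain ⟨N, hN⟩ := CVI.exists_uniform_threshold hstep T
    exact ⟨N, fun K hK x y l hr t ht => hN K hK t ht x y l hr ht⟩
  · exact h.last_rate hxs ha hsharp hβ hμ₀ hδ₀ hδ₁ y₀ l₀
  · exact h.average_rate hxs hb (CVI.mul_norm_le_of_isGLB (G := fun _ => P.F xs) hS' hSb) hβ hμ₀
      hδ₀ hδ₁ y₀ l₀
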